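/- **Theorem.** Consider programs of the following kind. Their memory consists of two-dimensional arrays (indexed by natural numbers, initially filled with zeros) of natural numbers, of elements of an abelian group $\Gamma$, and of real numbers. They are composed of assignments to single cells, sequential composition, branching, and while loops, and the elementary operations are: constants and the size $n$ of the ground set $E=\{0,\dots,n-1\}$; addition, truncated subtraction and comparison of natural numbers; reading a label $\psi(e)$, the neutral element $0$, addition, negation and the zero test in $\Gamma$; reading a weight $w(e)$, the number $0$, addition, subtraction and comparison of real numbers; reading or writing a memory cell; Boolean negation and conjunction; and a call of the independence oracle of $M_1$ or of $M_2$ on the subset of $E$ whose indicator vector is a row of an array. Every elementary operation, every oracle call and every branching counts as one step. There are one such program and one polynomial $p$ such that the following holds. Let $\Gamma$ be an abelian group with no subgroup isomorphic to $\mathbb{Z}_2$. Let $M_1$ and $M_2$ be matroids on the common ground set $E=\{0,\dots,n-1\}$, $n\ge 0$, let $\psi\colon E\to\Gamma$ be a labeling, and let $w\colon E\to\mathbb{R}_{\ge 0}$ be a weight function. Write $\psi(B)=\sum_{e\in B}\psi(e)$ and $w(B)=\sum_{e\in B}w(e)$ for $B\subseteq E$, and call a set $B$ that is a basis of both $M_1$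 and $M_2$ a non-zero common basis if $\psi(B)\neq 0$. Then, on the input $(M_1,M_2,\psi,w)$, the program halts after at most $p(n)$ steps, and it either outputs a non-zero common basis $B$ with $w(B)\le 2\,w(B^*)$ for every non-zero common basis $B^*$, or it reports that there is no non-zero common basis, and in that case there is none. -/

import Mathlib

/-! Non-zero common bases of two matroids, and a model of computation for algorithms that access
two matroids through independence oracles and an abelian group through its operations and a
zero test, with real weights. -/

namespace GroupLabeledMatroid

/-- The data of an instance on the ground set `{0, …, n - 1}`. -/
structure Input (Γ : Type*) (n : ℕ) where
  M₁ : Matroid (Fin n)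
  M₂ : Matroid (Fin n)
  ψ : Fin n → Γ
  w : Fin n → ℝ

/-- `B` is a common basis of the two matroids and its label `ψ(B)` is not zero. -/
def Input.IsNonZeroCommonBasis {Γ : Type*} [AddCommGroup Γ] {n : ℕ} (I : Input Γ n)
    (B : Finset (Fin n)) : Prop :=
  I.M₁.IsBase (B : Set (Fin n)) ∧ I.M₂.IsBase (B : Set (Fin n)) ∧ ∑ e ∈ B, I.ψ e ≠ 0

/-- The weight `w(B)`. -/
def Input.weight {Γ : Type*} {n : ℕ} (I : Input Γ n) (B : Finset (Fin n)) : ℝ :=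
  ∑ e ∈ B, I.w e

/-! ### The memory

Each of the three sorts of values (natural numbers, group elements, real numbers) has its own
two-dimensional arrays; the cell in row `i` and column `j` of array `a` is addressed by `a i j`. -/

structure Store (Γ : Type*) where
  nat : ℕ → ℕ → ℕ → ℕ
  grp : ℕ → ℕ → ℕ → Γ
  real : ℕ → ℕ → ℕ → ℝ

/-- All cells are zero at the start; the input is only read through the instructions below. -/
def Store.init (Γ : Type*) [AddCommGroup Γ] : Store Γ where
  nat := fun _ _ _ => 0
  grp := fun _ _ _ => 0
  real := fun _ _ _ => 0

/-- Overwrite one cell. -/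
def writeCell {α : Type*} (m : ℕ → ℕ → ℕ → α) (a i j : ℕ) (v : α) : ℕ → ℕ → ℕ → α :=
  fun a' i' j' => if a' = a ∧ i' = i ∧ j' = j then v else m a' i' j'

/-- The subset of the ground set whose indicator vector is row `i` of the number array `a`. -/
def Store.row {Γ : Type*} (s : Store Γ) (n a i : ℕ) : Finset (Fin n) :=
  Finset.univ.filter fun e => s.nat a i e ≠ 0

/-- The answer read off at the end: the cell `0 0 0` holds `0` for the report that there is no
non-zero common basis, and anything else announces the set in row `0` of array `1`. -/
def Store.output {Γ : Type*} (s : Store Γ) (n : ℕ) : Option (Finset (Fin n)) :=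
  if s.nat 0 0 0 = 0 then none else some (s.row n 1 0)

/-! ### Expressions

`cost` counts one elementary step for each constant, memory access, input access, arithmetic
operation, comparison, group operation, zero test and oracle call. There is no multiplication of
numbers, so that the lengths of numbers stay polynomial in the number of steps. -/

/-- Expressions for natural numbers; subtraction is truncated. -/
inductive NatExpr where
  | const (k : ℕ)
  | size
  | get (a : ℕ) (i j : NatExpr)
  | add (x y : NatExpr)
  | sub (x y : NatExpr)

def NatExpr.eval (n : ℕ) (m : ℕ → ℕ → ℕ → ℕ) : NatExpr → ℕ
  | .const k => k
  | .size => n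
  | .get a i j => m a (i.eval n m) (j.eval n m)
  | .add x y => x.eval n m + y.eval n m
  | .sub x y => x.eval n m - y.eval n m

def NatExpr.cost : NatExpr → ℕ
  | .const _ => 1
  | .size => 1
  | .get _ i j => i.cost + j.cost + 1
  | .add x y => x.cost + y.cost + 1
  | .sub x y => x.cost + y.cost + 1

/-- Expressions for group elements; `label i` is the label of the ground set element `i`. -/
inductive GrpExpr where
  | zero
  | label (i : NatExpr)
  | get (a : ℕ) (i j : NatExpr)
  | add (x y : GrpExpr)
  | neg (x : GrpExpr)

def GrpExpr.eval {Γ : Type*} [AddCommGroup Γ] {n : ℕ} (I : Input Γ n) (s : Store Γ) :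
    GrpExpr → Γ
  | .zero => 0
  | .label i => if h : i.eval n s.nat < n then I.ψ ⟨i.eval n s.nat, h⟩ else 0
  | .get a i j => s.grp a (i.eval n s.nat) (j.eval n s.nat)
  | .add x y => x.eval I s + y.eval I s
  | .neg x => - x.eval I s

def GrpExpr.cost : GrpExpr → ℕ
  | .zero => 1
  | .label i => i.cost + 1
  | .get _ i j => i.cost + j.cost + 1
  | .add x y => x.cost + y.cost + 1
  | .neg x => x.cost + 1

/-- Expressions for real numbers; `weight i` is the weight of the ground set element `i`. -/
inductive RealExpr where
  | zero
  | weight (i : NatExpr)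
  | get (a : ℕ) (i j : NatExpr)
  | add (x y : RealExpr)
  | sub (x y : RealExpr)

noncomputable def RealExpr.eval {Γ : Type*} {n : ℕ} (I : Input Γ n) (s : Store Γ) : RealExpr → ℝ
  | .zero => 0
  | .weight i => if h : i.eval n s.nat < n then I.w ⟨i.eval n s.nat, h⟩ else 0
  | .get a i j => s.real a (i.eval n s.nat) (j.eval n s.nat)
  | .add x y => x.eval I s + y.eval I s
  | .sub x y => x.eval I s - y.eval I s

def RealExpr.cost : RealExpr → ℕ
  | .zero => 1
  | .weight i => i.cost + 1
  | .get _ i j => i.cost + j.cost + 1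
  | .add x y => x.cost + y.cost + 1
  | .sub x y => x.cost + y.cost + 1

/-- Tests. `indep₁ a i` and `indep₂ a i` call the independence oracle of the first and of the
second matroid on the set in row `i` of the number array `a`. -/
inductive Test where
  | natEq (x y : NatExpr)
  | natLe (x y : NatExpr)
  | realLe (x y : RealExpr)
  | isZero (x : GrpExpr)
  | indep₁ (a : ℕ) (i : NatExpr)
  | indep₂ (a : ℕ) (i : NatExpr)
  | not (b : Test)
  | and (b c : Test)

def Test.Holds {Γ : Type*} [AddCommGroup Γ] {n : ℕ} (I : Input Γ n) (s : Store Γ) : Test → Prop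
  | .natEq x y => x.eval n s.nat = y.eval n s.nat
  | .natLe x y => x.eval n s.nat ≤ y.eval n s.nat
  | .realLe x y => x.eval I s ≤ y.eval I s
  | .isZero x => x.eval I s = 0
  | .indep₁ a i => I.M₁.Indep (s.row n a (i.eval n s.nat) : Set (Fin n))
  | .indep₂ a i => I.M₂.Indep (s.row n a (i.eval n s.nat) : Set (Fin n))
  | .not b => ¬ b.Holds I s
  | .and b c => b.Holds I s ∧ c.Holds I s

def Test.cost : Test → ℕ
  | .natEq x y => x.cost + y.cost + 1
  | .natLe x y => x.cost + y.cost + 1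
  | .realLe x y => x.cost + y.cost + 1
  | .isZero x => x.cost + 1
  | .indep₁ _ i => i.cost + 1
  | .indep₂ _ i => i.cost + 1
  | .not b => b.cost + 1
  | .and b c => b.cost + c.cost + 1

/-! ### Programs -/

/-- Programs: assignments to a cell, sequential composition, branching, and while loops. A program
is a finite object that mentions neither the group, nor the matroids, nor the ground set. -/
inductive Program where
  | skip
  | setNat (a : ℕ) (i j : NatExpr) (x : NatExpr)
  | setGrp (a : ℕ) (i j : NatExpr) (x : GrpExpr)
  | setReal (a : ℕ) (i j : NatExpr) (x : RealExpr)
  | seq (P Q : Program)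
  | cond (b : Test) (P Q : Program)
  | loop (b : Test) (P : Program)

/-- `Runs I P s t s'`: on the input `I`, the program `P` started in the memory state `s` halts
after exactly `t` elementary steps in the memory state `s'`. -/
inductive Runs {Γ : Type*} [AddCommGroup Γ] {n : ℕ} (I : Input Γ n) :
    Program → Store Γ → ℕ → Store Γ → Prop
  | skip (s : Store Γ) : Runs I .skip s 1 s
  | setNat (a : ℕ) (i j x : NatExpr) (s : Store Γ) :
      Runs I (.setNat a i j x) s (i.cost + j.cost + x.cost + 1)
        { s with nat := writeCell s.nat a (i.eval n s.nat) (j.eval n s.nat) (x.eval n s.nat) }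
  | setGrp (a : ℕ) (i j : NatExpr) (x : GrpExpr) (s : Store Γ) :
      Runs I (.setGrp a i j x) s (i.cost + j.cost + x.cost + 1)
        { s with grp := writeCell s.grp a (i.eval n s.nat) (j.eval n s.nat) (x.eval I s) }
  | setReal (a : ℕ) (i j : NatExpr) (x : RealExpr) (s : Store Γ) :
      Runs I (.setReal a i j x) s (i.cost + j.cost + x.cost + 1)
        { s with real := writeCell s.real a (i.eval n s.nat) (j.eval n s.nat) (x.eval I s) }
  | seq {P Q : Program} {s s' s'' : Store Γ} {t t' : ℕ} :
      Runs I P s t s' → Runs I Q s' t' s'' → Runs I (.seq P Q) s (t + t') s''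
  | condTrue {b : Test} {P Q : Program} {s s' : Store Γ} {t : ℕ} :
      b.Holds I s → Runs I P s t s' → Runs I (.cond b P Q) s (b.cost + 1 + t) s'
  | condFalse {b : Test} {P Q : Program} {s s' : Store Γ} {t : ℕ} :
      ¬ b.Holds I s → Runs I Q s t s' → Runs I (.cond b P Q) s (b.cost + 1 + t) s'
  | loopTrue {b : Test} {P : Program} {s s' s'' : Store Γ} {t t' : ℕ} :
      b.Holds I s → Runs I P s t s' → Runs I (.loop b P) s' t' s'' →
        Runs I (.loop b P) s (b.cost + 1 + t + t') s''
  | loopFalse {b : Test} {P : Program} {s : Store Γ} :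
      ¬ b.Holds I s → Runs I (.loop b P) s (b.cost + 1) s

/-- Programs are deterministic: the final state and the number of steps are unique. -/
theorem Runs.deterministic {Γ : Type*} [AddCommGroup Γ] {n : ℕ} {I : Input Γ n} {P : Program}
    {s s₁ s₂ : Store Γ} {t₁ t₂ : ℕ} (h₁ : Runs I P s t₁ s₁) (h₂ : Runs I P s t₂ s₂) :
    t₁ = t₂ ∧ s₁ = s₂ := by
  induction h₁ generalizing t₂ s₂ with
  | skip | setNat | setGrp | setReal => cases h₂; exact ⟨rfl, rfl⟩
  | seq _ _ ih ih' =>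
    cases h₂ with
    | seq h h' =>
      obtain ⟨rfl, rfl⟩ := ih h
      obtain ⟨rfl, rfl⟩ := ih' h'
      exact ⟨rfl, rfl⟩
  | condTrue hb _ ih =>
    cases h₂ with
    | condTrue _ h => obtain ⟨rfl, rfl⟩ := ih h; exact ⟨rfl, rfl⟩
    | condFalse hb' _ => exact absurd hb hb'
  | condFalse hb _ ih =>
    cases h₂ with
    | condTrue hb' _ => exact absurd hb' hb
    | condFalse _ h => obtain ⟨rfl, rfl⟩ := ih h; exact ⟨rfl, rfl⟩
  | loopTrue hb _ _ ih ih' =>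
    cases h₂ with
    | loopTrue _ h h' =>
      obtain ⟨rfl, rfl⟩ := ih h
      obtain ⟨rfl, rfl⟩ := ih' h'
      exact ⟨rfl, rfl⟩
    | loopFalse hb' => exact absurd hb hb'
  | loopFalse hb =>
    cases h₂ with
    | loopTrue hb' _ _ => exact absurd hb' hb
    | loopFalse _ => exact ⟨rfl, rfl⟩

/-- An answer is correct if it is either a non-zero common basis whose weight is at most twice
the weight of every non-zero common basis, or the report (`none`) that there is no non-zero common
basis and this is the case. -/
def Input.IsTwoApproxAnswer {Γ : Type*} [AddCommGroup Γ] {n : ℕ} (I : Input Γ n) :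
    Option (Finset (Fin n)) → Prop
  | some B => I.IsNonZeroCommonBasis B ∧
      ∀ B' : Finset (Fin n), I.IsNonZeroCommonBasis B' → I.weight B ≤ 2 * I.weight B'
  | none => ∀ B' : Finset (Fin n), ¬ I.IsNonZeroCommonBasis B'

end GroupLabeledMatroid

namespace GroupLabeledMatroid

/-! ### Exchange properties of the bases of a single matroid. -/

section Exchange

open Equiv Finset

variable {α : Type*} [DecidableEq α] {N : Matroid α} {A B X Y : Finset α}

/-! Take a lightest common basis `A`. If its label is non-zero, it is optimal. Otherwise consider
the exchange digraph `exchangeArc` of `A`: arcs leaving `A` are the single exchanges allowed by the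
first matroid, arcs entering `A` those allowed by the second. The relation `Covers` singles out the
vertex sets of families of disjoint directed cycles. For every common basis `B` the set `symmDiff A
B` is of this kind (`covers_symmDiff`), but conversely `symmDiff A V` need not be a common basis for
a covered `V`.

The central fact is `exists_smaller_covers`: if it is not, then `V` taken twice is, as a multiset, a
sum `K + R₁ + R₂` of covered sets, where `K` is a non-empty proper subset of `V`. Indeed, a
non-basis `symmDiff A V` forces a second perfect matching of exchanges in one of the matroids
(`exists_other_matching`), hence a second cycle family on `V`. A chord from this family shortcuts a
cycle or joins two cycles; in either case a smaller covered set splits off, and the remaining arcs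
regroup into two covered sets.

Now let `V` be inclusion-minimal among the covered sets whose exchange changes the label. If
`symmDiff A V` were not a common basis, then `K` would have label zero, and the labels of `R₁` and
`R₂` would sum to twice that of `V`. Not both of them equal `V`. If exactly one does, the other one
is a smaller non-zero set; if neither does, the label of `V` doubled is zero, which is excluded in
the absence of elements of order two (`isCommonBase_of_minimal_nonzero`). The same double cover
shows that a lightest `A` has no negative cycles (`exchangeCost_nonneg`) and that an
inclusion-minimal cheapest covered set through a given element can be exchanged
(`isCommonBase_of_minimal_through`).

For the factor two, charge `w` on elements outside of `A` and nothing inside. If `V` is a cheapest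
non-zero covered set, then the exchange raises the weight by at most the cost of `V`, which is at
most the cost of `symmDiff A B`, hence at most `w(B)`, for each non-zero common basis `B`. So the
result weighs at most `w(A) + w(B)`, and `w(A) ≤ w(B)`. These costs are non-negative, so shrinking
`V` to an inclusion-minimal non-zero set never makes it more expensive.

Algorithmically, a cheapest covered set is found through all-pairs shortest walks: a closed walk
decomposes into cycles, and by `Walk.label_eq_zero` it is enough to inspect closed walks made of two
selected shortest walks and at most one arc. Deleting vertices while the optimum persists then
yields minimality (`run_search`). To obtain `A`, the ground set is enlarged to `2n` elements by
parallel copies of greedy bases, so that a common basis is known from the start when the ranks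
agree. The copies are removed one at a time, and thereafter the weights are switched on one element
at a time; each of these steps is one cheapest exchange through a given element.

Memory layout. Numbers: `6` basis, `7` current vertex set, `8` arcs, `9` walks found, `10` and `11`
success flags, `12` the element to remove, `13` and `2` a set and its image for an oracle call, `3`
the verdict, `14` active elements, `15` infeasibility flag, `16` to `19` greedy bases and their
sizes, `20` to `28` loop counters, `31` and `32` the maps to the ground set. Reals: `0` vertex
costs, `1` arc costs, `2` walk costs, `3` and `4` optimal costs, `5` weights. Group elements: `0`
vertex labels, `1` arc labels, `2` walk labels, `3` the label of the basis. -/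

theorem isBase_exchange_iff (hE : N.E = Set.univ) (hA : N.IsBase A) {a b : α} (ha : a ∈ A)
    (hb : b ∉ A) :
    N.IsBase (insert b (A.erase a) : Finset α) ↔ b ∉ N.closure ((A : Set α) \ {a}) := by
  push_cast
  constructor
  · intro h
    rw [(hA.indep.sdiff _).notMem_closure_iff (by simp [hE])]
    exact ⟨h.indep, fun h' => hb (by simpa using h'.1)⟩
  · intro h
    exact hA.exchange_base_of_notMem_closure (by simpa using ha) h (by simp [hE])

/-- The fundamental circuit of `b` with respect to `A`, without `b`, spans `b`. It cannot lie in the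
closure of `B - b`, as that closure misses `b`; any of its elements outside of this closure serves
as `a`. -/
theorem exists_symmetric_exchange (hE : N.E = Set.univ) (hA : N.IsBase A) (hB : N.IsBase B)
    {b : α} (hb : b ∈ B) (hbA : b ∉ A) :
    ∃ a ∈ A, a ∉ B ∧ N.IsBase (insert b (A.erase a) : Finset α) ∧
      N.IsBase (insert a (B.erase b) : Finset α) := by
  have hcl : b ∈ N.closure A := by rw [hA.closure_eq, hE]; trivial
  have hbA' : b ∉ (A : Set α) := by simpa using hbA
  have hC := hA.indep.fundCircuit_isCircuit hcl hbA'
  have hbC : b ∈ N.closure (N.fundCircuit b A \ {b}) :=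
    hC.mem_closure_sdiff_singleton_of_mem (N.mem_fundCircuit b A)
  have hbB : b ∉ N.closure ((B : Set α) \ {b}) :=
    hB.indep.notMem_closure_sdiff_of_mem (by simpa using hb)
  obtain ⟨a, haC, haB⟩ : ∃ a ∈ N.fundCircuit b A \ {b}, a ∉ N.closure ((B : Set α) \ {b}) := by
    by_contra! h
    exact hbB (N.closure_subset_closure_of_subset_closure h hbC)
  have hab : a ≠ b := haC.2
  have haA : a ∈ A := by
    have := N.fundCircuit_subset_insert b A haC.1
    simpa [hab] using this
  have haB' : a ∉ B := fun h =>
    haB (N.mem_closure_of_mem (by simp [h, hab]) (by simp [hE]))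
  refine ⟨a, haA, haB', ?_, (isBase_exchange_iff hE hB hb haB').2 haB⟩
  have := (hA.indep.mem_fundCircuit_iff hcl hbA').1 haC.1
  push_cast
  refine hA.exchange_isBase_of_indep hbA' ?_
  rwa [← Set.insert_sdiff_singleton_comm hab.symm] at this

/-- A symmetric exchange replaces `B` by the basis `B - b + a`, which is closer to `A`, while `A`
stays fixed. So the pairs `(a, b)` collected by the induction are all exchanges in the same basis
`A`. -/
theorem exists_exchange_bijOn (hE : N.E = Set.univ) (hA : N.IsBase A) (hB : N.IsBase B) :
    ∃ σ : α → α, Set.BijOn σ ↑(A \ B) ↑(B \ A) ∧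
      ∀ a ∈ A \ B, N.IsBase (insert (σ a) (A.erase a) : Finset α) := by
  induction hk : (B \ A).card generalizing B with
  | zero =>
    rw [card_eq_zero, sdiff_eq_empty_iff_subset] at hk
    have : B = A := by exact_mod_cast hB.eq_of_subset_isBase hA (by exact_mod_cast hk)
    subst this
    exact ⟨id, by simp, by simp⟩
  | succ k ih =>
    obtain ⟨b, hb⟩ : (B \ A).Nonempty := by rw [← card_pos]; omega
    rw [mem_sdiff] at hb
    obtain ⟨a, haA, haB, h1, h2⟩ := exists_symmetric_exchange hE hA hB hb.1 hb.2
    have hab : a ≠ b := fun h => haB (h ▸ hb.1)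
    have e1 : insert a (B.erase b) \ A = (B \ A).erase b := by
      ext x; simp only [mem_sdiff, mem_insert, mem_erase]; grind
    have e2 : A \ insert a (B.erase b) = (A \ B).erase a := by
      ext x; simp only [mem_sdiff, mem_insert, mem_erase]; grind
    obtain ⟨σ, hσ, hσ'⟩ := ih h2 (by rw [e1, card_erase_of_mem (by simp [hb]), hk]; rfl)
    rw [e1, e2] at hσ
    rw [e2] at hσ'
    refine ⟨Function.update σ a b, ?_, ?_⟩
    · have h3 : Set.BijOn (Function.update σ a b) ↑((A \ B).erase a) ↑((B \ A).erase b) := by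
        refine hσ.congr fun x hx => ?_
        rw [Function.update_of_ne]
        exact ne_of_mem_erase (by exact_mod_cast hx)
      have h4 := h3.insert (a := a) (by simp)
      have e3 : insert a (((A \ B).erase a : Finset α) : Set α) = ↑(A \ B) := by
        rw [← coe_insert, insert_erase (by simp [haA, haB])]
      have e4 : insert b (((B \ A).erase b : Finset α) : Set α) = ↑(B \ A) := by
        rw [← coe_insert, insert_erase (by simp [hb])]
      simpa only [Function.update_self, e3, e4] using h4
    · intro x hx
      by_cases hxa : x = a
      · subst hxa; simpa using h1
      · rw [Function.update_of_ne hxa]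
        exact hσ' x (mem_erase.2 ⟨hxa, hx⟩)

/-- If each vertex of `X` has a second neighbour `τ a`, the self-map `σ⁻¹ ∘ τ` of the finite set `X`
has a periodic point and permutes its periodic points. Switching from `σ` to `τ` exactly there gives
another perfect matching. -/
theorem exists_other_bijOn {σ τ : α → α} (hσ : Set.BijOn σ X Y) (hX : X.Nonempty)
    (hτ : ∀ a ∈ X, τ a ∈ Y ∧ τ a ≠ σ a) :
    ∃ σ' : α → α, Set.BijOn σ' X Y ∧ (∀ a ∈ X, σ' a = σ a ∨ σ' a = τ a) ∧
      ∃ a ∈ X, σ' a ≠ σ a := by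
  classical
  have hex : ∀ x : X, ∃ y : X, σ y = τ x := by
    intro x
    obtain ⟨y, hy, h⟩ := hσ.surjOn (show τ x ∈ (Y : Set α) from (hτ x x.2).1)
    exact ⟨⟨y, hy⟩, h⟩
  choose h hh using hex
  have hbij := Function.bijOn_periodicPts h
  let ρ : X → X := fun x => if x ∈ Function.periodicPts h then h x else x
  have hρ : Function.Injective ρ := by
    intro x y hxy
    simp only [ρ] at hxy
    split_ifs at hxy with h1 h2 h2
    · exact hbij.injOn h1 h2 hxy
    · exact absurd (hxy ▸ hbij.mapsTo h1) h2
    · exact absurd (hxy ▸ hbij.mapsTo h2) h1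
    · exact hxy
  have hρs : Function.Surjective ρ := Finite.surjective_of_injective hρ
  have hval : ∀ (a : α) (ha : a ∈ X),
      (if ha : a ∈ X then σ (ρ ⟨a, ha⟩) else a) = σ (ρ ⟨a, ha⟩) := fun a ha => dif_pos ha
  refine ⟨fun a => if ha : a ∈ X then σ (ρ ⟨a, ha⟩) else a, ⟨?_, ?_, ?_⟩, ?_, ?_⟩
  · intro a ha
    simp only [hval a ha]
    exact hσ.mapsTo (ρ ⟨a, ha⟩).2
  · intro a ha b hb hab
    simp only [hval a ha, hval b hb] at hab
    exact congrArg Subtype.val (hρ (Subtype.ext (hσ.injOn (ρ ⟨a, ha⟩).2 (ρ ⟨b, hb⟩).2 hab)))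
  · intro y hy
    obtain ⟨x, hx, rfl⟩ := hσ.surjOn hy
    obtain ⟨z, hz⟩ := hρs ⟨x, hx⟩
    exact ⟨z, z.2, by simp [hz]⟩
  · intro a ha
    simp only [hval a ha, ρ]
    split_ifs
    · exact Or.inr (hh _)
    · exact Or.inl rfl
  · obtain ⟨x0, hx0⟩ := hX
    obtain ⟨x, hx⟩ : ∃ x : X, x ∈ Function.periodicPts h := by
      obtain ⟨i, j, hij, he⟩ := Finite.exists_ne_map_eq_of_infinite
        (fun i : ℕ => h^[i] ⟨x0, hx0⟩)
      wlog hlt : i < j generalizing i j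
      · exact this j i hij.symm he.symm (by omega)
      refine ⟨h^[i] ⟨x0, hx0⟩, j - i, by omega, ?_⟩
      simp only [Function.IsPeriodicPt, Function.IsFixedPt]
      rw [← Function.iterate_add_apply, Nat.sub_add_cancel hlt.le]
      exact he.symm
    refine ⟨x, x.2, ?_⟩
    show (if ha : (x : α) ∈ X then σ (ρ ⟨x, ha⟩) else x) ≠ σ x
    rw [hval x x.2]
    simp only [ρ, Subtype.coe_eta, if_pos hx, hh]
    exact (hτ x x.2).2

/-- Contrapositive of the unique matching criterion: a unique perfect matching of exchanges can be
carried out simultaneously. If every vertex of `X` has two neighbours, the previous lemma applies.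
Otherwise some `a` is a leaf with sole neighbour `σ a`; performing this exchange leaves the exchange
graph on the other vertices unchanged, and induction applies. -/
theorem exists_other_matching (hE : N.E = Set.univ) (hA : N.IsBase A) (hX : X ⊆ A)
    (hY : ∀ y ∈ Y, y ∉ A) {σ : α → α} (hσ : Set.BijOn σ X Y)
    (hb : ∀ a ∈ X, N.IsBase (insert (σ a) (A.erase a) : Finset α))
    (hn : ¬ N.IsBase ((A \ X) ∪ Y : Finset α)) :
    ∃ σ' : α → α, Set.BijOn σ' X Y ∧
      (∀ a ∈ X, N.IsBase (insert (σ' a) (A.erase a) : Finset α)) ∧ ∃ a ∈ X, σ' a ≠ σ a := by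
  induction hk : X.card generalizing A X Y with
  | zero =>
    rw [card_eq_zero] at hk
    subst hk
    have : Y = ∅ := by
      rw [← coe_eq_empty]; simpa using hσ.image_eq.symm
    subst this
    exact absurd (by simpa using hA) hn
  | succ k ih =>
    by_cases hall : ∀ a ∈ X, ∃ b ∈ Y, b ≠ σ a ∧ N.IsBase (insert b (A.erase a) : Finset α)
    · choose! τ h1 h2 h3 using hall
      obtain ⟨σ', h4, h5, h6⟩ := exists_other_bijOn hσ (card_pos.1 (by omega))
        (fun a ha => ⟨h1 a ha, h2 a ha⟩)
      refine ⟨σ', h4, fun a ha => ?_, h6⟩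
      rcases h5 a ha with h | h <;> rw [h]
      exacts [hb a ha, h3 a ha]
    · push Not at hall
      obtain ⟨a, ha, hleaf⟩ := hall
      set b := σ a with hbdef
      have hbY : b ∈ Y := hσ.mapsTo ha
      have haA := hX ha
      have hbA := hY b hbY
      have hA' := hb a ha
      set A' := insert b (A.erase a) with hA'def
      have hiff : ∀ a' ∈ X.erase a, ∀ b' ∈ Y.erase b,
          (N.IsBase (insert b' (A'.erase a') : Finset α) ↔
            N.IsBase (insert b' (A.erase a') : Finset α)) := by
        intro a' ha' b' hb'
        rw [mem_erase] at ha' hb'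
        have ha'A := hX ha'.2
        have hb'A := hY b' hb'.2
        have haX : a' ∈ A' := by simp [A', ha'.1, ha'A]
        have hb'A' : b' ∉ A' := by simp [A', hb'.1, hb'A]
        rw [isBase_exchange_iff hE hA' haX hb'A', isBase_exchange_iff hE hA ha'A hb'A, not_iff_not]
        -- As `a` is a leaf, `b'` is spanned by `A - a`. Inside this flat, being spanned by `A' -
        -- a'` and being spanned by `A - a'` both amount to being spanned by `A - a - a'`, because
        -- closure commutes with intersection for subsets of an independent set.
        have hb'cl : b' ∈ N.closure ((A : Set α) \ {a}) := by
          by_contra h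
          exact hleaf b' hb'.2 hb'.1 ((isBase_exchange_iff hE hA haA hb'A).2 h)
        have e1 : ((A : Set α) \ {a}) ∩ ((A' : Set α) \ {a'}) = (A : Set α) \ {a, a'} := by
          ext x
          simp only [A', coe_insert, coe_erase, Set.mem_inter_iff, Set.mem_sdiff,
            Set.mem_singleton_iff, Set.mem_insert_iff, mem_coe]
          grind
        have e2 : ((A : Set α) \ {a}) ∩ ((A : Set α) \ {a'}) = (A : Set α) \ {a, a'} := by
          ext x
          simp only [Set.mem_inter_iff, Set.mem_sdiff, Set.mem_singleton_iff, Set.mem_insert_iff]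
          tauto
        have i1 := Matroid.Indep.closure_inter_eq_inter_closure (M := N)
          (I := (A : Set α) \ {a}) (J := (A' : Set α) \ {a'})
          (hA'.indep.subset (by
            intro x
            simp only [A', coe_insert, coe_erase, Set.mem_union, Set.mem_sdiff,
              Set.mem_singleton_iff, Set.mem_insert_iff, mem_coe]
            tauto))
        have i2 := Matroid.Indep.closure_inter_eq_inter_closure (M := N)
          (I := (A : Set α) \ {a}) (J := (A : Set α) \ {a'})
          (hA.indep.subset (by
            intro x
            simp only [Set.mem_union, Set.mem_sdiff, Set.mem_singleton_iff, mem_coe]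
            tauto))
        rw [e1] at i1
        rw [e2] at i2
        have : b' ∈ N.closure ((A : Set α) \ {a}) ∩ N.closure ((A' : Set α) \ {a'}) ↔
          b' ∈ N.closure ((A : Set α) \ {a}) ∩ N.closure ((A : Set α) \ {a'}) := by
          rw [← i1, ← i2]
        simpa [hb'cl] using this
      have hσ1 : Set.BijOn σ ↑(X.erase a) ↑(Y.erase b) := by
        have := hσ.sdiff_singleton (a := a) (by simpa using ha)
        simpa using this
      obtain ⟨σ', h1, h2, h3⟩ := ih hA' (X := X.erase a) (Y := Y.erase b)
        (by
          intro x hx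
          rw [mem_erase] at hx
          simp [A', hx.1, hX hx.2])
        (by
          intro y hy
          rw [mem_erase] at hy
          simp [A', hy.1, hY y hy.2])
        hσ1
        (fun x hx => (hiff x hx (σ x) (hσ1.mapsTo (by exact_mod_cast hx))).2
          (hb x (mem_of_mem_erase hx)))
        (by
          convert hn using 3
          ext x
          simp only [A', mem_union, mem_sdiff, mem_insert, mem_erase]
          grind)
        (by rw [card_erase_of_mem ha, hk]; rfl)
      refine ⟨Function.update σ' a b, ?_, ?_, ?_⟩
      · have h4 : Set.BijOn (Function.update σ' a b) ↑(X.erase a) ↑(Y.erase b) := by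
          refine h1.congr fun x hx => ?_
          rw [Function.update_of_ne]
          exact ne_of_mem_erase (by exact_mod_cast hx)
        have h5 := h4.insert (a := a) (by simp)
        have e3 : insert a ((X.erase a : Finset α) : Set α) = X := by
          rw [← coe_insert, insert_erase ha]
        have e4 : insert b ((Y.erase b : Finset α) : Set α) = Y := by
          rw [← coe_insert, insert_erase hbY]
        simpa only [Function.update_self, e3, e4] using h5
      · intro x hx
        by_cases hxa : x = a
        · subst hxa; simpa [A'] using hA'
        · rw [Function.update_of_ne hxa]
          have hx' : x ∈ X.erase a := mem_erase.2 ⟨hxa, hx⟩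
          exact (hiff x hx' _ (h1.mapsTo (by exact_mod_cast hx'))).1 (h2 x hx')
      · obtain ⟨x, hx, hne⟩ := h3
        rw [mem_erase] at hx
        exact ⟨x, hx.2, by rwa [Function.update_of_ne hx.1]⟩

end Exchange

/-! ### Disjoint cycle families in a digraph, and double covers by smaller families. -/

section Digraph

open Equiv Finset

variable {α : Type*}

/-- `S` is the vertex set of a family of pairwise disjoint directed cycles of `r`. -/
def Covers (r : α → α → Prop) (S : Finset α) : Prop :=
  ∃ f : α → α, Function.Injective f ∧ (∀ v, f v ≠ v ↔ v ∈ S) ∧ ∀ v ∈ S, r v (f v)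

variable {r : α → α → Prop} {S V : Finset α}

theorem Covers.mono {r' : α → α → Prop} (h : Covers r S) (hr : ∀ u ∈ S, ∀ v ∈ S, r u v → r' u v) :
    Covers r' S := by
  obtain ⟨f, hf, hS, h⟩ := h
  refine ⟨f, hf, hS, fun v hv => hr v hv _ ?_ (h v hv)⟩
  rw [← hS]
  exact fun h' => (hS v).2 hv (hf h')

variable [Fintype α]

/-- The inverse permutation traverses the same cycles backwards. -/
theorem Covers.flip (h : Covers r S) : Covers (fun u v => r v u) S := by
  obtain ⟨f, hf, hS, hr⟩ := h
  let e := Equiv.ofBijective f (Finite.injective_iff_bijective.1 hf)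
  have he : ∀ v, f (e.symm v) = v := fun v => e.apply_symm_apply v
  have hiff : ∀ v, e.symm v ≠ v ↔ f v ≠ v := by
    intro v
    rw [not_iff_not]
    constructor
    · intro h; conv_rhs => rw [← he v, h]
    · intro h; apply hf; rw [he, h]
  refine ⟨e.symm, e.symm.injective, fun v => (hiff v).trans (hS v), fun v hv => ?_⟩
  have h2 : e.symm v ∈ S := by
    rw [← hS, he]
    exact fun h => (hiff v).2 ((hS v).2 hv) h.symm
  simpa only [he] using hr _ h2

variable [DecidableEq α]

/-- The pairs `(x, f x)` and `(x, g x)` form a 2-regular bipartite multigraph. Hall's condition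
holds by counting edges, and the complement of a perfect matching is again a perfect matching. -/
theorem exists_injective_split {f g : α → α}
    (h : ∀ y, (univ.filter fun x => f x = y).card + (univ.filter fun x => g x = y).card = 2) :
    ∃ ρ₁ ρ₂ : α → α, Function.Injective ρ₁ ∧ Function.Injective ρ₂ ∧
      ∀ x, (ρ₁ x = f x ∧ ρ₂ x = g x) ∨ (ρ₁ x = g x ∧ ρ₂ x = f x) := by
  obtain ⟨ρ, hρ, hρt⟩ := (Finset.all_card_le_biUnion_card_iff_exists_injective
    (fun x => ({f x, g x} : Finset α))).1 (by
      intro X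
      set T := X.biUnion fun x => ({f x, g x} : Finset α) with hT
      have h1 := card_eq_sum_card_fiberwise (f := f) (s := X) (t := T)
        (fun x hx => by simp only [hT, coe_biUnion, Set.mem_iUnion]; exact ⟨x, hx, by simp⟩)
      have h2 := card_eq_sum_card_fiberwise (f := g) (s := X) (t := T)
        (fun x hx => by simp only [hT, coe_biUnion, Set.mem_iUnion]; exact ⟨x, hx, by simp⟩)
      have h3 : ∑ y ∈ T, ((X.filter fun x => f x = y).card + (X.filter fun x => g x = y).card) ≤
          ∑ y ∈ T, 2 := by
        refine sum_le_sum fun y _ => ?_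
        rw [← h y]
        exact add_le_add (card_le_card (filter_subset_filter _ (subset_univ _)))
          (card_le_card (filter_subset_filter _ (subset_univ _)))
      rw [sum_add_distrib, ← h1, ← h2, sum_const, smul_eq_mul] at h3
      omega)
  have hρfg : ∀ x, ρ x = f x ∨ ρ x = g x := fun x => by simpa using hρt x
  let ρ₂ : α → α := fun x => if ρ x = f x then g x else f x
  have hsplit : ∀ x, (ρ x = f x ∧ ρ₂ x = g x) ∨ (ρ x = g x ∧ ρ₂ x = f x) := by
    intro x
    simp only [ρ₂]
    rcases hρfg x with h | h
    · simp [h]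
    · by_cases h' : g x = f x <;> simp [h, h']
  refine ⟨ρ, ρ₂, hρ, ?_, hsplit⟩
  have hcard : ∀ y, (univ.filter fun x => ρ₂ x = y).card ≤ 1 := by
    intro y
    have h1 : (univ.filter fun x => ρ x = y).card = 1 := by
      obtain ⟨x, hx⟩ := (Finite.injective_iff_surjective.1 hρ) y
      rw [card_eq_one]
      refine ⟨x, ?_⟩
      ext z
      simp only [mem_filter, mem_univ, true_and, mem_singleton, ← hx]
      exact hρ.eq_iff
    have h2 := h y
    have h3 : (univ.filter fun x => ρ x = y).card + (univ.filter fun x => ρ₂ x = y).card =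
        (univ.filter fun x => f x = y).card + (univ.filter fun x => g x = y).card := by
      simp only [card_filter, ← sum_add_distrib]
      refine sum_congr rfl fun x _ => ?_
      rcases hsplit x with ⟨h, h'⟩ | ⟨h, h'⟩ <;> rw [h, h']
      rw [add_comm]
    omega
  intro x y hxy
  exact card_le_one.1 (hcard (ρ₂ y)) x (by simp [hxy]) y (by simp)

theorem covers_of_function {f : α → α} (hf : Function.Injective f)
    (hr : ∀ v, f v ≠ v → r v (f v)) : Covers r (univ.filter fun v => f v ≠ v) :=
  ⟨f, hf, fun v => by simp, fun v hv => hr v (by simpa using hv)⟩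

/-- Take the arcs of `f` and `f'` together and remove those of the cycle `κ`, which uses `f'` at `a`
and `f` elsewhere. A loop at each vertex of `κ` makes the remainder 2-regular again, so it splits
into two permutations; their non-fixed points are `R₁` and `R₂`. -/
theorem exists_covers_of_chord {f f' κ : α → α} {a : α} (hf : Function.Injective f)
    (hf' : Function.Injective f') (hV : ∀ v, f v ≠ v ↔ v ∈ V) (hV' : ∀ v, f' v ≠ v ↔ v ∈ V)
    (hr : ∀ v ∈ V, r v (f v)) (hr' : ∀ v ∈ V, r v (f' v))
    (hκ : Function.Injective κ) (haV : a ∈ V) (hκa : κ a = f' a)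
    (hκf : ∀ v, v ≠ a → κ v = f v ∨ κ v = v) (hne : ∃ v ∈ V, κ v = v) :
    ∃ K R₁ R₂ : Finset α, Covers r K ∧ Covers r R₁ ∧ Covers r R₂ ∧ K.Nonempty ∧ K ⊂ V ∧
      K.val + R₁.val + R₂.val = 2 • V.val := by
  let p : α → α := fun v => if κ v = v then f v else v
  let q : α → α := fun v => if v = a then f a else f' v
  have ha' : f' a ≠ a := (hV' a).2 haV
  have key : ∀ v, (κ v = v ∧ p v = f v ∧ q v = f' v ∧ v ≠ a) ∨
      (κ v ≠ v ∧ p v = v ∧ v = a ∧ q v = f a) ∨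
      (κ v ≠ v ∧ p v = v ∧ v ≠ a ∧ κ v = f v ∧ q v = f' v) := by
    intro v
    by_cases hva : v = a
    · subst hva; simp [p, q, hκa, ha']
    · rcases hκf v hva with h | h
      · by_cases h2 : κ v = v
        · simp [p, q, h2, hva]
        · right; right; simp only [p, q, if_neg h2, if_neg hva]; rw [h] at h2; simp [h2, hva, h]
      · simp [p, q, h, hva]
  have hone : ∀ {h : α → α}, Function.Injective h → ∀ y,
      ∑ x, (if h x = y then 1 else 0 : ℕ) = 1 := by
    intro h hh y
    obtain ⟨x, rfl⟩ := (Finite.injective_iff_surjective.1 hh) y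
    simp [hh.eq_iff]
  obtain ⟨ρ₁, ρ₂, h1, h2, h12⟩ := exists_injective_split (f := p) (g := q) (by
    intro y
    -- At every vertex the values of `p`, `q`, `κ` are those of `f`, `f'`, `id` in some order. The
    -- latter three are permutations, as is `κ`, so `p` and `q` together hit each vertex twice.
    have e : ∑ x, ((if p x = y then 1 else 0) + (if q x = y then 1 else 0) +
        (if κ x = y then 1 else 0) : ℕ) = ∑ x, ((if f x = y then 1 else 0) +
        (if f' x = y then 1 else 0) + (if id x = y then 1 else 0)) := by
      refine sum_congr rfl fun v _ => ?_
      rcases key v with ⟨h, h3, h4, -⟩ | ⟨-, h3, rfl, h4⟩ | ⟨-, h3, -, h4, h5⟩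
      · rw [h, h3, h4]; rfl
      · rw [h3, h4, hκa, id]; ring
      · rw [h3, h4, h5, id]; ring
    simp only [sum_add_distrib, hone hf, hone hf', hone hκ, hone Function.injective_id] at e
    simp only [card_filter]
    omega)
  have hpV : ∀ v, p v ≠ v → r v (p v) := by
    intro v hv
    rcases key v with ⟨-, h3, -, -⟩ | ⟨-, h3, -⟩ | ⟨-, h3, -⟩
    · rw [h3] at hv ⊢; exact hr v ((hV v).1 hv)
    · exact absurd h3 hv
    · exact absurd h3 hv
  have hqV : ∀ v, q v ≠ v → r v (q v) := by
    intro v hv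
    rcases key v with ⟨-, -, h3, -⟩ | ⟨-, -, rfl, h3⟩ | ⟨-, -, -, -, h3⟩
    · rw [h3] at hv ⊢; exact hr' v ((hV' v).1 hv)
    · rw [h3] at hv ⊢; exact hr _ ((hV _).1 hv)
    · rw [h3] at hv ⊢; exact hr' v ((hV' v).1 hv)
  have hκr : ∀ v, κ v ≠ v → r v (κ v) := by
    intro v hv
    by_cases hva : v = a
    · subst hva; rw [hκa]; exact hr' _ haV
    · rcases hκf v hva with h | h
      · rw [h] at hv ⊢; exact hr v ((hV v).1 hv)
      · exact absurd h hv
  have hκV : ∀ v, κ v ≠ v → v ∈ V := by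
    intro v hv
    by_cases hva : v = a
    · subst hva; exact haV
    · rcases hκf v hva with h | h
      · rw [h] at hv; exact (hV v).1 hv
      · exact absurd h hv
  refine ⟨univ.filter fun v => κ v ≠ v, univ.filter fun v => ρ₁ v ≠ v,
    univ.filter fun v => ρ₂ v ≠ v, covers_of_function hκ hκr, covers_of_function h1 ?_,
    covers_of_function h2 ?_, ⟨a, by simp [hκa, ha']⟩, ?_, ?_⟩
  · intro v hv
    rcases h12 v with ⟨h, -⟩ | ⟨h, -⟩ <;> rw [h] at hv ⊢
    exacts [hpV v hv, hqV v hv]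
  · intro v hv
    rcases h12 v with ⟨-, h⟩ | ⟨-, h⟩ <;> rw [h] at hv ⊢
    exacts [hqV v hv, hpV v hv]
  · rw [Finset.ssubset_iff_subset_ne]
    refine ⟨fun v hv => hκV v (by simpa using hv), fun h => ?_⟩
    obtain ⟨v, hv, hv'⟩ := hne
    rw [← h] at hv
    simp [hv'] at hv
  · ext v
    simp only [Multiset.count_add, Multiset.count_nsmul]
    simp only [Multiset.count_eq_of_nodup (Finset.nodup _), mem_val, mem_filter, mem_univ,
      true_and]
    have hpq : (if ρ₁ v ≠ v then 1 else 0) + (if ρ₂ v ≠ v then 1 else 0) =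
        (if p v ≠ v then 1 else 0) + (if q v ≠ v then 1 else 0) := by
      rcases h12 v with ⟨h, h'⟩ | ⟨h, h'⟩ <;> rw [h, h']
      rw [add_comm]
    rw [add_assoc, hpq]
    have hv1 := hV v
    have hv2 := hV' v
    rcases key v with ⟨h, h3, h4, -⟩ | ⟨h, h3, rfl, h4⟩ | ⟨h, h3, h4, h5, h6⟩
    · rw [h, h3, h4]
      by_cases hv : v ∈ V <;> simp [hv1, hv2, hv]
    · rw [h3, h4]; simp [h, hv1, haV]
    · rw [h3, h6]
      have hv : v ∈ V := hκV v h
      simp [h, hv2, hv]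

/-- Choose `a` with `f' a ≠ f a` and follow `f` from `y = f' a`. If `a` is reached, the chord from
`a` to `y` closes a cycle that bypasses `f a`. If not, the `f`-cycle of `y` is itself a proper part
of `V`. -/
theorem exists_covers_of_ne {f f' : α → α} (hf : Function.Injective f)
    (hf' : Function.Injective f') (hV : ∀ v, f v ≠ v ↔ v ∈ V) (hV' : ∀ v, f' v ≠ v ↔ v ∈ V)
    (hr : ∀ v ∈ V, r v (f v)) (hr' : ∀ v ∈ V, r v (f' v)) (hne : f ≠ f') :
    ∃ K R₁ R₂ : Finset α, Covers r K ∧ Covers r R₁ ∧ Covers r R₂ ∧ K.Nonempty ∧ K ⊂ V ∧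
      K.val + R₁.val + R₂.val = 2 • V.val := by
  classical
  obtain ⟨a, ha⟩ := Function.ne_iff.1 hne
  have haV : a ∈ V := by
    by_contra h
    have h1 := mt (hV a).1 h
    have h2 := mt (hV' a).1 h
    rw [not_not] at h1 h2
    exact ha (h1.trans h2.symm)
  set y := f' a with hy
  have hya : y ≠ a := (hV' a).2 haV
  have hyV : y ∈ V := (hV' y).1 fun h => hya (hf' h)
  have hit : ∀ k, f^[k] y ∈ V := by
    intro k
    induction k with
    | zero => exact hyV
    | succ k ih =>
      rw [Function.iterate_succ_apply']
      exact (hV _).1 fun h => (hV _).2 ih (hf h)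
  by_cases hk : ∃ k, f^[k] y = a
  · have hspec := Nat.find_spec hk
    have hmin : ∀ j < Nat.find hk, f^[j] y ≠ a := fun j hj => Nat.find_min hk hj
    set k := Nat.find hk with hkdef
    -- The cycle formed by the chord and the `f`-path from `y` to the first visit of `a`, extended
    -- by fixed points.
    let κ : α → α := fun v => if v = a then y else if ∃ j < k, f^[j] y = v then f v else v
    have hκa : κ a = y := if_pos rfl
    have hκ1 : ∀ v, v ≠ a → (∃ j < k, f^[j] y = v) → κ v = f v := fun v h1 h2 => by
      simp only [κ, if_neg h1, if_pos h2]
    have hκ2 : ∀ v, v ≠ a → (¬ ∃ j < k, f^[j] y = v) → κ v = v := fun v h1 h2 => by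
      simp only [κ, if_neg h1, if_neg h2]
    -- An early return to `y` would make the orbit repeat and reach `a` in fewer than `k` steps.
    have hret : ∀ j < k, f (f^[j] y) ≠ y := by
      intro j hj h
      rw [← Function.iterate_succ_apply' (f := f)] at h
      refine hmin (k - (j + 1)) (by omega) ?_
      rw [← hspec, ← h, ← Function.iterate_add_apply, h]
      congr 2
      omega
    have houty : ∀ v, v ≠ a → (¬ ∃ j < k, f^[j] y = v) → ∀ j < k, f (f^[j] y) ≠ v := by
      intro v hva hv j hj h
      rw [← Function.iterate_succ_apply' (f := f)] at h
      rcases Nat.lt_or_ge (j + 1) k with h3 | h3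
      · exact hv ⟨j + 1, h3, h⟩
      · have : j.succ = k := by omega
        rw [this, hspec] at h
        exact hva h.symm
    have hyout : ∀ v, v ≠ a → (¬ ∃ j < k, f^[j] y = v) → y ≠ v := by
      intro v hva hv h
      rcases Nat.eq_zero_or_pos k with h3 | h3
      · rw [h3] at hspec; exact hya hspec
      · exact hv ⟨0, h3, h⟩
    have hκ : Function.Injective κ := by
      intro u v huv
      by_cases hu : u = a <;> by_cases hv : v = a
      · rw [hu, hv]
      · rw [hu, hκa] at huv
        by_cases h : ∃ j < k, f^[j] y = v
        · rw [hκ1 v hv h] at huv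
          obtain ⟨j, hj, rfl⟩ := h
          exact absurd huv.symm (hret j hj)
        · rw [hκ2 v hv h] at huv
          exact absurd huv (hyout v hv h)
      · rw [hv, hκa] at huv
        by_cases h : ∃ j < k, f^[j] y = u
        · rw [hκ1 u hu h] at huv
          obtain ⟨j, hj, rfl⟩ := h
          exact absurd huv (hret j hj)
        · rw [hκ2 u hu h] at huv
          exact absurd huv.symm (hyout u hu h)
      · by_cases h : ∃ j < k, f^[j] y = u <;> by_cases h' : ∃ j < k, f^[j] y = v
        · rw [hκ1 u hu h, hκ1 v hv h'] at huv; exact hf huv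
        · rw [hκ1 u hu h, hκ2 v hv h'] at huv
          obtain ⟨j, hj, rfl⟩ := h
          exact absurd huv (houty v hv h' j hj)
        · rw [hκ2 u hu h, hκ1 v hv h'] at huv
          obtain ⟨j, hj, rfl⟩ := h'
          exact absurd huv.symm (houty u hu h j hj)
        · rwa [hκ2 u hu h, hκ2 v hv h'] at huv
    refine exists_covers_of_chord hf hf' hV hV' hr hr' hκ haV hκa (fun v hv => ?_)
      ⟨f a, (hV _).1 fun h => (hV a).2 haV (hf h), ?_⟩
    · by_cases h : ∃ j < k, f^[j] y = v
      · exact Or.inl (hκ1 v hv h)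
      · exact Or.inr (hκ2 v hv h)
    · refine hκ2 _ ((hV a).2 haV) ?_
      rintro ⟨j, hj, h⟩
      rcases j with _ | j
      · exact ha h.symm
      · rw [Function.iterate_succ_apply'] at h
        exact hmin j (by omega) (hf h)
  · push Not at hk
    -- The orbit of `y` is also closed under predecessors, since `y` is periodic. Hence `f`
    -- restricts to the orbit and to its complement, and the double cover is orbit, complement, and
    -- all of `V`.
    have hinv : ∀ v, (∃ k, f^[k] y = f v) ↔ ∃ k, f^[k] y = v := by
      intro v
      constructor
      · rintro ⟨k, hkv⟩
        obtain ⟨p, hp, hpy⟩ := (Function.mem_periodicPts (f := f) (x := y)).1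
          (hf.mem_periodicPts y)
        refine ⟨k + (p - 1), hf ?_⟩
        rw [← hkv, ← Function.iterate_succ_apply' (f := f),
          show (k + (p - 1)).succ = k + p by omega, Function.iterate_add_apply, hpy.eq]
      · rintro ⟨k, rfl⟩
        exact ⟨k + 1, Function.iterate_succ_apply' f k y⟩
    have hmap : ∀ (P : α → Prop) [DecidablePred P], (∀ v, P (f v) ↔ P v) →
        Covers r (V.filter P) := by
      intro P _ hP
      refine ⟨fun v => if P v then f v else v, ?_, ?_, ?_⟩
      · intro u v huv
        dsimp only at huv
        split_ifs at huv with h1 h2 h2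
        · exact hf huv
        · exact absurd ((hP u).2 h1) (huv ▸ h2)
        · exact absurd ((hP v).2 h2) (huv ▸ h1)
        · exact huv
      · intro v
        by_cases h : P v <;> simp [h, ← hV]
      · intro v hv
        rw [mem_filter] at hv
        simp only [if_pos hv.2]
        exact hr v hv.1
    refine ⟨V.filter fun v => ∃ k, f^[k] y = v, V.filter fun v => ¬ ∃ k, f^[k] y = v, V,
      hmap _ hinv, hmap _ fun v => not_congr (hinv v), ⟨f, hf, hV, hr⟩, ⟨y, ?_⟩, ?_, ?_⟩
    · exact mem_filter.2 ⟨hyV, 0, rfl⟩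
    · rw [Finset.ssubset_iff_subset_ne]
      refine ⟨filter_subset _ _, fun h => ?_⟩
      rw [← h, mem_filter] at haV
      exact haV.2.elim hk
    · rw [two_nsmul]
      congr 1
      simp only [filter_val]
      exact Multiset.filter_add_not _ _

end Digraph

/-! ### The exchange digraph of a common basis, and minimal cycle families. -/

section CommonBases

open Equiv Finset

variable {α : Type*} [DecidableEq α] {N₁ N₂ : Matroid α} {A B V U : Finset α}

/-- The exchange digraph of a common basis `A` of two matroids. -/
def exchangeArc (N₁ N₂ : Matroid α) (A : Finset α) (u v : α) : Prop :=
  (u ∈ A ∧ v ∉ A ∧ N₁.IsBase (insert v (A.erase u) : Finset α)) ∨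
    (u ∉ A ∧ v ∈ A ∧ N₂.IsBase (insert u (A.erase v) : Finset α))

theorem exchangeArc_swap {u v : α} : exchangeArc N₂ N₁ A u v ↔ exchangeArc N₁ N₂ A v u := by
  unfold exchangeArc; tauto

theorem exchangeArc.mem_iff {u v : α} (h : exchangeArc N₁ N₂ A u v) : v ∈ A ↔ u ∉ A := by
  unfold exchangeArc at h; tauto

theorem exchangeArc.ne {u v : α} (h : exchangeArc N₁ N₂ A u v) : u ≠ v := by
  rintro rfl
  have := h.mem_iff
  tauto

/-- A common basis of two matroids. -/
def IsCommonBase (N₁ N₂ : Matroid α) (B : Finset α) : Prop := N₁.IsBase B ∧ N₂.IsBase B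

variable [Fintype α]

/-- The arcs of the cycle family that leave `A` form a perfect matching of `A ∩ V` with `V \ A` in
the exchange graph of `N₁`. A different matching, combined with the old arcs that enter `A`, is a
second cycle family on the same vertices. -/
theorem exists_smaller_covers_of_not_isBase (hE : N₁.E = Set.univ) (hA : N₁.IsBase A)
    (hV : Covers (exchangeArc N₁ N₂ A) V) (hn : ¬ N₁.IsBase (symmDiff A V : Finset α)) :
    ∃ K R₁ R₂ : Finset α, Covers (exchangeArc N₁ N₂ A) K ∧ Covers (exchangeArc N₁ N₂ A) R₁ ∧
      Covers (exchangeArc N₁ N₂ A) R₂ ∧ K.Nonempty ∧ K ⊂ V ∧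
      K.val + R₁.val + R₂.val = 2 • V.val := by
  obtain ⟨f, hf, hfV, hr⟩ := hV
  have hfmem : ∀ v ∈ V, f v ∈ V := fun v hv => (hfV _).1 fun h => (hfV v).2 hv (hf h)
  have hbij : Set.BijOn f ↑(A ∩ V) ↑(V \ A) := by
    refine ⟨fun x hx => ?_, hf.injOn, fun y hy => ?_⟩
    · simp only [coe_inter, Set.mem_inter_iff, mem_coe] at hx
      have := (hr x hx.2).mem_iff
      simp only [coe_sdiff, Set.mem_sdiff, mem_coe]
      exact ⟨hfmem x hx.2, by tauto⟩
    · simp only [coe_sdiff, Set.mem_sdiff, mem_coe] at hy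
      obtain ⟨x, rfl⟩ := (Finite.injective_iff_surjective.1 hf) y
      have hx : x ∈ V := (hfV x).1 fun h => (hfV (f x)).2 hy.1 (by rw [h, h])
      have := (hr x hx).mem_iff
      refine ⟨x, ?_, rfl⟩
      simp only [coe_inter, Set.mem_inter_iff, mem_coe]
      exact ⟨by tauto, hx⟩
  have hb : ∀ a ∈ A ∩ V, N₁.IsBase (insert (f a) (A.erase a) : Finset α) := by
    intro a ha
    rw [mem_inter] at ha
    rcases hr a ha.2 with h | h
    · exact h.2.2
    · exact absurd ha.1 h.1
  have hsd : (A \ (A ∩ V)) ∪ (V \ A) = symmDiff A V := by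
    ext x; simp only [mem_union, mem_sdiff, mem_inter, mem_symmDiff]; tauto
  obtain ⟨σ, hσ, hσb, a, ha, hne⟩ := exists_other_matching hE hA inter_subset_left
    (fun y hy => (mem_sdiff.1 hy).2) hbij hb (by rwa [hsd])
  let f' : α → α := fun v => if v ∈ A ∩ V then σ v else f v
  have h1 : ∀ v ∈ A ∩ V, f' v = σ v := fun v hv => if_pos hv
  have h2 : ∀ v, v ∉ A ∩ V → f' v = f v := fun v hv => if_neg hv
  have hcross : ∀ u ∈ A ∩ V, ∀ v, v ∉ A ∩ V → σ u ≠ f v := by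
    intro u hu v hv h
    obtain ⟨w, hw, hw'⟩ := hbij.surjOn (hσ.mapsTo hu)
    rw [← hw'] at h
    exact hv (hf h ▸ hw)
  have hinj : Function.Injective f' := by
    intro u v huv
    by_cases hu : u ∈ A ∩ V <;> by_cases hv : v ∈ A ∩ V
    · rw [h1 u hu, h1 v hv] at huv; exact hσ.injOn hu hv huv
    · rw [h1 u hu, h2 v hv] at huv; exact absurd huv (hcross u hu v hv)
    · rw [h2 u hu, h1 v hv] at huv; exact absurd huv.symm (hcross v hv u hu)
    · rw [h2 u hu, h2 v hv] at huv; exact hf huv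
  have hσV : ∀ v ∈ A ∩ V, σ v ∈ V ∧ σ v ∉ A := fun v hv => mem_sdiff.1 (hσ.mapsTo hv)
  refine exists_covers_of_ne hf hinj hfV (fun v => ?_) hr (fun v hv => ?_)
    (Function.ne_iff.2 ⟨a, by rw [h1 a ha]; exact hne.symm⟩)
  · by_cases hv : v ∈ A ∩ V
    · rw [h1 v hv]
      refine ⟨fun _ => (mem_inter.1 hv).2, fun _ h => (hσV v hv).2 ?_⟩
      rw [h]; exact (mem_inter.1 hv).1
    · rw [h2 v hv, hfV]
  · by_cases hv' : v ∈ A ∩ V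
    · rw [h1 v hv']
      exact Or.inl ⟨(mem_inter.1 hv').1, (hσV v hv').2, hσb v hv'⟩
    · rw [h2 v hv']
      exact hr v hv

theorem exists_smaller_covers (hE₁ : N₁.E = Set.univ) (hE₂ : N₂.E = Set.univ)
    (hA : IsCommonBase N₁ N₂ A) (hV : Covers (exchangeArc N₁ N₂ A) V)
    (hn : ¬ IsCommonBase N₁ N₂ (symmDiff A V)) :
    ∃ K R₁ R₂ : Finset α, Covers (exchangeArc N₁ N₂ A) K ∧ Covers (exchangeArc N₁ N₂ A) R₁ ∧
      Covers (exchangeArc N₁ N₂ A) R₂ ∧ K.Nonempty ∧ K ⊂ V ∧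
      K.val + R₁.val + R₂.val = 2 • V.val := by
  -- Interchanging the matroids reverses all arcs, so a failure in `N₂` reduces to one in `N₁`.
  have hflip : ∀ {N N' : Matroid α} {S : Finset α}, Covers (exchangeArc N N' A) S →
      Covers (exchangeArc N' N A) S := fun h =>
    h.flip.mono fun u _ v _ h => exchangeArc_swap.1 h
  by_cases h : N₁.IsBase (symmDiff A V : Finset α)
  · obtain ⟨K, R₁, R₂, h1, h2, h3, h4⟩ := exists_smaller_covers_of_not_isBase hE₂ hA.2 (hflip hV)
      (fun h' => hn ⟨h, h'⟩)
    exact ⟨K, R₁, R₂, hflip h1, hflip h2, hflip h3, h4⟩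
  · exact exists_smaller_covers_of_not_isBase hE₁ hA.1 hV h

omit [Fintype α] in
-- An exchange bijection of `N₁` leads from `A \ B` to `B \ A`, the inverse of one of `N₂` leads
-- back; together they permute the symmetric difference along arcs.
theorem covers_symmDiff (hE₁ : N₁.E = Set.univ) (hE₂ : N₂.E = Set.univ)
    (hA : IsCommonBase N₁ N₂ A) (hB : IsCommonBase N₁ N₂ B) :
    Covers (exchangeArc N₁ N₂ A) (symmDiff A B) := by
  classical
  obtain ⟨σ, hσ, hσb⟩ := exists_exchange_bijOn hE₁ hA.1 hB.1
  obtain ⟨τ, hτ, hτb⟩ := exists_exchange_bijOn hE₂ hA.2 hB.2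
  have hex : ∀ b ∈ B \ A, ∃ a ∈ A \ B, τ a = b := fun b hb => by
    obtain ⟨a, ha, h⟩ := hτ.surjOn hb
    exact ⟨a, ha, h⟩
  choose! g hg hg' using hex
  let f : α → α := fun v => if v ∈ A \ B then σ v else if v ∈ B \ A then g v else v
  have h1 : ∀ v ∈ A \ B, f v = σ v := fun v hv => if_pos hv
  have h2 : ∀ v ∈ B \ A, f v = g v := fun v hv => by
    have : v ∉ A \ B := fun h => (mem_sdiff.1 h).2 (mem_sdiff.1 hv).1
    simp only [f, if_neg this, if_pos hv]
  have h3 : ∀ v, v ∉ A \ B → v ∉ B \ A → f v = v := fun v hv hv' => by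
    simp only [f, if_neg hv, if_neg hv']
  have hcov : ∀ v, v ∈ A \ B ∨ v ∈ B \ A ∨ (v ∉ A \ B ∧ v ∉ B \ A) := fun v => by tauto
  have hdisj : ∀ v, v ∈ A \ B → v ∉ B \ A := fun v hv hv' =>
    (mem_sdiff.1 hv).2 (mem_sdiff.1 hv').1
  have hσm : ∀ v ∈ A \ B, σ v ∈ B \ A := fun v hv => hσ.mapsTo hv
  refine ⟨f, ?_, fun v => ?_, fun v hv => ?_⟩
  · intro u v huv
    rcases hcov u with hu | hu | hu <;> rcases hcov v with hv | hv | hv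
    · rw [h1 u hu, h1 v hv] at huv; exact hσ.injOn hu hv huv
    · rw [h1 u hu, h2 v hv] at huv
      exact absurd (hσm u hu) (huv ▸ hdisj _ (hg v hv))
    · rw [h1 u hu, h3 v hv.1 hv.2] at huv
      exact absurd (hσm u hu) (huv ▸ hv.2)
    · rw [h2 u hu, h1 v hv] at huv
      exact absurd (hσm v hv) (huv ▸ hdisj _ (hg u hu))
    · rw [h2 u hu, h2 v hv] at huv
      rw [← hg' u hu, ← hg' v hv, huv]
    · rw [h2 u hu, h3 v hv.1 hv.2] at huv
      exact absurd (hg u hu) (huv ▸ hv.1)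
    · rw [h3 u hu.1 hu.2, h1 v hv] at huv
      exact absurd (hσm v hv) (huv ▸ hu.2)
    · rw [h3 u hu.1 hu.2, h2 v hv] at huv
      exact absurd (hg v hv) (huv ▸ hu.1)
    · rwa [h3 u hu.1 hu.2, h3 v hv.1 hv.2] at huv
  · rw [mem_symmDiff]
    rcases hcov v with hv | hv | hv
    · rw [h1 v hv]
      refine ⟨fun _ => Or.inl (mem_sdiff.1 hv), fun _ h => ?_⟩
      have := hσm v hv
      rw [h] at this
      exact hdisj v hv this
    · rw [h2 v hv]
      refine ⟨fun _ => Or.inr (mem_sdiff.1 hv), fun _ h => ?_⟩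
      have := hg v hv
      rw [h] at this
      exact hdisj v this hv
    · rw [h3 v hv.1 hv.2, ← mem_sdiff, ← mem_sdiff]; tauto
  · rw [mem_symmDiff, ← mem_sdiff, ← mem_sdiff] at hv
    rcases hv with hv | hv
    · rw [h1 v hv]
      exact Or.inl ⟨(mem_sdiff.1 hv).1, (mem_sdiff.1 (hσm v hv)).2, hσb v hv⟩
    · rw [h2 v hv]
      refine Or.inr ⟨(mem_sdiff.1 hv).2, (mem_sdiff.1 (hg v hv)).1, ?_⟩
      have := hτb (g v) (hg v hv)
      rwa [hg' v hv] at this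

omit [Fintype α] [DecidableEq α] in
theorem sum_eq_of_val_add {M : Type*} [AddCommMonoid M] {K R₁ R₂ : Finset α}
    (h : K.val + R₁.val + R₂.val = 2 • V.val) (c : α → M) :
    ∑ v ∈ K, c v + ∑ v ∈ R₁, c v + ∑ v ∈ R₂, c v = ∑ v ∈ V, c v + ∑ v ∈ V, c v := by
  have := congrArg (fun m : Multiset α => (m.map c).sum) h
  simpa [two_nsmul, Multiset.map_add, Multiset.sum_add] using this

omit [Fintype α] [DecidableEq α] in
theorem subset_of_val_add {K R₁ R₂ : Finset α} (h : K.val + R₁.val + R₂.val = 2 • V.val) :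
    K ⊆ V ∧ R₁ ⊆ V ∧ R₂ ⊆ V := by
  have : ∀ x ∈ K.val + R₁.val + R₂.val, x ∈ V.val := by
    intro x hx
    rw [h] at hx
    exact Multiset.mem_of_mem_nsmul hx
  refine ⟨fun x hx => this x ?_, fun x hx => this x ?_, fun x hx => this x ?_⟩ <;>
    simp only [Multiset.mem_add, mem_val] <;> tauto

omit [Fintype α] in
/-- At most one of the three parts of a double cover contains everything, once `K` does not. -/
theorem eq_of_val_add {K R₁ R₂ : Finset α} (h : K.val + R₁.val + R₂.val = 2 • V.val)
    (hK : K.Nonempty) : R₁ ≠ V ∨ R₂ ≠ V := by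
  by_contra! h'
  rw [h'.1, h'.2, two_nsmul, add_assoc] at h
  have : K.val = 0 := by simpa using h
  rw [val_eq_zero] at this
  exact hK.ne_empty this

/-- The change of the weight when passing from `A` to `symmDiff A V`. -/
def exchangeCost {α M : Type*} [DecidableEq α] [AddCommGroup M] (w : α → M) (A : Finset α)
    (v : α) : M :=
  if v ∈ A then - w v else w v

omit [Fintype α] in
theorem sum_symmDiff {M : Type*} [AddCommGroup M] (w : α → M) (A V : Finset α) :
    ∑ v ∈ symmDiff A V, w v = ∑ v ∈ A, w v + ∑ v ∈ V, exchangeCost w A v := by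
  have h1 : ∑ v ∈ V, exchangeCost w A v = ∑ v ∈ V \ A, w v - ∑ v ∈ A ∩ V, w v := by
    rw [← sum_sdiff (inter_subset_right : A ∩ V ⊆ V), show V \ (A ∩ V) = V \ A by ext; simp,
      sub_eq_add_neg, ← sum_neg_distrib]
    congr 1
    · exact sum_congr rfl fun v hv => if_neg (mem_sdiff.1 hv).2
    · exact sum_congr rfl fun v hv => if_pos (mem_inter.1 hv).1
  have h2 : ∑ v ∈ A, w v = ∑ v ∈ A \ V, w v + ∑ v ∈ A ∩ V, w v := by
    rw [← sum_sdiff (inter_subset_left : A ∩ V ⊆ A), show A \ (A ∩ V) = A \ V by ext; simp]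
  have h3 : ∑ v ∈ symmDiff A V, w v = ∑ v ∈ A \ V, w v + ∑ v ∈ V \ A, w v :=
    sum_union (disjoint_sdiff_sdiff)
  rw [h1, h2, h3]
  abel

/-- The exchange digraph of a minimum weight common basis has no negative cycles. -/
theorem exchangeCost_nonneg (hE₁ : N₁.E = Set.univ) (hE₂ : N₂.E = Set.univ) (w : α → ℝ)
    (hA : IsCommonBase N₁ N₂ A) (hAU : A ⊆ U)
    (hmin : ∀ B ⊆ U, IsCommonBase N₁ N₂ B → ∑ v ∈ A, w v ≤ ∑ v ∈ B, w v) {S : Finset α}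
    (hSU : S ⊆ U) (hS : Covers (exchangeArc N₁ N₂ A) S) : 0 ≤ ∑ v ∈ S, exchangeCost w A v := by
  induction S using Finset.strongInduction with
  | H S ih =>
    by_cases hb : IsCommonBase N₁ N₂ (symmDiff A S)
    · have := hmin _ (symmDiff_subset_union.trans (union_subset hAU hSU)) hb
      rw [sum_symmDiff] at this
      linarith
    · obtain ⟨K, R₁, R₂, h1, h2, h3, h4, h5, h6⟩ := exists_smaller_covers hE₁ hE₂ hA hS hb
      obtain ⟨-, hs1, hs2⟩ := subset_of_val_add h6
      have hsum := sum_eq_of_val_add h6 (exchangeCost w A)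
      have hK := ih K h5 (h5.subset.trans hSU) h1
      have hR : ∀ {R}, R ⊆ S → R ≠ S → Covers (exchangeArc N₁ N₂ A) R →
          0 ≤ ∑ v ∈ R, exchangeCost w A v := fun hR hne hc =>
        ih _ (Finset.ssubset_iff_subset_ne.2 ⟨hR, hne⟩) (hR.trans hSU) hc
      -- The three costs sum to twice the cost of `S`. If one of `R₁`, `R₂` is `S` itself,
      -- cancelling it once leaves the cost of `S` as a sum of two terms that are non-negative by
      -- induction.
      by_cases e1 : R₁ = S
      · have e2 : R₂ ≠ S := (eq_of_val_add h6 h4).resolve_left (not_not.2 e1)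
        have := hR hs2 e2 h3
        rw [e1] at hsum
        linarith
      · by_cases e2 : R₂ = S
        · have := hR hs1 e1 h2
          rw [e2] at hsum
          linarith
        · have := hR hs1 e1 h2
          have := hR hs2 e2 h3
          linarith

/-- An inclusion-minimal cheapest cycle through `e` can be used for an exchange. -/
theorem isCommonBase_of_minimal_through (hE₁ : N₁.E = Set.univ) (hE₂ : N₂.E = Set.univ)
    (hA : IsCommonBase N₁ N₂ A) {c : α → ℝ}
    (hnn : ∀ S ⊆ V, Covers (exchangeArc N₁ N₂ A) S → 0 ≤ ∑ v ∈ S, c v) {e : α} {l : ℝ}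
    (hl : ∀ S ⊆ V, Covers (exchangeArc N₁ N₂ A) S → e ∈ S → l ≤ ∑ v ∈ S, c v)
    (hV : Covers (exchangeArc N₁ N₂ A) V) (heV : e ∈ V) (hVl : ∑ v ∈ V, c v ≤ l)
    (hmin : ∀ S ⊂ V, Covers (exchangeArc N₁ N₂ A) S → e ∈ S → ¬ ∑ v ∈ S, c v ≤ l) :
    IsCommonBase N₁ N₂ (symmDiff A V) := by
  by_contra hb
  obtain ⟨K, R₁, R₂, h1, h2, h3, h4, h5, h6⟩ := exists_smaller_covers hE₁ hE₂ hA hV hb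
  obtain ⟨hs, hs1, hs2⟩ := subset_of_val_add h6
  have hsum := sum_eq_of_val_add h6 c
  -- Exactly two of the three sets contain `e`. These cost at least `l` each, the third at least
  -- zero, and all together at most `2 * l`; so both are within the bound `l`, and one of them is a
  -- proper subset of `V`.
  have hcnt := sum_eq_of_val_add h6 (fun v => if v = e then 1 else 0 : α → ℕ)
  simp only [sum_ite_eq', heV, if_true] at hcnt
  have hK := hnn K hs h1
  have hR1 := hnn R₁ hs1 h2
  have hR2 := hnn R₂ hs2 h3
  have main : ∀ R ⊆ V, Covers (exchangeArc N₁ N₂ A) R → e ∈ R → ∑ v ∈ R, c v ≤ l → R = V := by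
    intro R hR hc he hle
    by_contra hne
    exact hmin R (Finset.ssubset_iff_subset_ne.2 ⟨hR, hne⟩) hc he hle
  by_cases k0 : e ∈ K
  · have b0 := hl K hs h1 k0
    by_cases k1 : e ∈ R₁
    · have := hl R₁ hs1 h2 k1
      exact hmin K h5 h1 k0 (by linarith)
    · by_cases k2 : e ∈ R₂
      · have := hl R₂ hs2 h3 k2
        exact hmin K h5 h1 k0 (by linarith)
      · simp [k1, k2, k0] at hcnt
  · have k1 : e ∈ R₁ := by by_contra k1; by_cases k2 : e ∈ R₂ <;> simp [k0, k1, k2] at hcnt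
    have k2 : e ∈ R₂ := by by_contra k2; simp [k0, k1, k2] at hcnt
    have b1 := hl R₁ hs1 h2 k1
    have b2 := hl R₂ hs2 h3 k2
    rcases eq_of_val_add h6 h4 with h | h
    · exact h (main R₁ hs1 h2 k1 (by linarith))
    · exact h (main R₂ hs2 h3 k2 (by linarith))

/-- An inclusion-minimal non-zero cycle can be used for an exchange if the group has no element of
order two. -/
theorem isCommonBase_of_minimal_nonzero {Γ : Type*} [AddCommGroup Γ]
    (hΓ : ∀ x : Γ, x + x = 0 → x = 0) (hE₁ : N₁.E = Set.univ) (hE₂ : N₂.E = Set.univ)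
    (hA : IsCommonBase N₁ N₂ A) {g : α → Γ}
    (hV : Covers (exchangeArc N₁ N₂ A) V) (hVg : ∑ v ∈ V, g v ≠ 0)
    (hmin : ∀ S ⊂ V, Covers (exchangeArc N₁ N₂ A) S → ∑ v ∈ S, g v = 0) :
    IsCommonBase N₁ N₂ (symmDiff A V) := by
  by_contra hb
  obtain ⟨K, R₁, R₂, h1, h2, h3, h4, h5, h6⟩ := exists_smaller_covers hE₁ hE₂ hA hV hb
  obtain ⟨hs, hs1, hs2⟩ := subset_of_val_add h6
  have hsum := sum_eq_of_val_add h6 g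
  have main : ∀ R ⊆ V, Covers (exchangeArc N₁ N₂ A) R → R ≠ V → ∑ v ∈ R, g v = 0 :=
    fun R hR hc hne => hmin R (Finset.ssubset_iff_subset_ne.2 ⟨hR, hne⟩) hc
  rw [hmin K h5 h1, zero_add] at hsum
  by_cases e1 : R₁ = V
  · have e2 : R₂ ≠ V := (eq_of_val_add h6 h4).resolve_left (not_not.2 e1)
    rw [main R₂ hs2 h3 e2, e1, add_zero] at hsum
    exact hVg (by simpa using hsum)
  · rw [main R₁ hs1 h2 e1, zero_add] at hsum
    by_cases e2 : R₂ = V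
    · rw [e2] at hsum
      exact hVg (by simpa using hsum)
    -- All three parts have label zero, so the label of `V` has double zero. This is where elements
    -- of order two have to be excluded.
    · rw [main R₂ hs2 h3 e2] at hsum
      exact hVg (hΓ _ hsum.symm)

end CommonBases

/-! ### Decomposition of closed walks into cycles. -/

section Walks

open Equiv Finset

variable {α : Type*} {r : α → α → Prop}

/-- `Walk r k u v m`: there is a walk with `k` arcs from `u` to `v` that enters the vertices in
the multiset `m`. -/
inductive Walk (r : α → α → Prop) : ℕ → α → α → Multiset α → Prop
  | nil (u : α) : Walk r 0 u u 0
  | snoc {k : ℕ} {u x v : α} {m : Multiset α} :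
      Walk r k u x m → r x v → Walk r (k + 1) u v (v ::ₘ m)

theorem Walk.append {k l : ℕ} {u v x : α} {m m' : Multiset α} (h : Walk r k u v m)
    (h' : Walk r l v x m') : Walk r (k + l) u x (m + m') := by
  induction h' with
  | nil => simpa using h
  | snoc _ hr ih => rw [Multiset.add_cons]; exact (ih h).snoc hr

theorem Walk.single {u v : α} (h : r u v) : Walk r 1 u v {v} := (Walk.nil u).snoc h

variable [Fintype α] [DecidableEq α]

/-- The list runs against the direction of the arcs, because walks are extended at the head of the
list. Its cyclic permutation therefore covers the reversed relation, which is then flipped. -/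
theorem covers_of_closed_chain (hirr : ∀ v, ¬ r v v) {l : List α} {x : α} (hd : (l ++ [x]).Nodup)
    (hc : List.IsChain (fun a b => r b a) (l ++ [x])) (hr : ∀ y ∈ (l ++ [x]).head?, r y x) :
    Covers r (l ++ [x]).toFinset := by
  set c := l ++ [x] with hcdef
  have hlen : 2 ≤ c.length := by
    cases l with
    | nil => exact absurd (hr x (by simp [hcdef])) (hirr x)
    | cons => simp [hcdef]
  have : Covers (fun a b => r b a) c.toFinset := by
    refine ⟨c.formPerm, c.formPerm.injective, fun v => ?_, fun v hv => ?_⟩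
    · rw [List.mem_toFinset]
      by_cases hv : v ∈ c
      · simp only [hv, iff_true]
        exact (List.formPerm_apply_mem_ne_self_iff _ hd _ hv).2 hlen
      · simp [hv, List.formPerm_apply_of_notMem hv]
    · rw [List.mem_toFinset] at hv
      obtain ⟨i, hi, rfl⟩ := List.getElem_of_mem hv
      rw [List.formPerm_apply_getElem _ hd]
      by_cases hi' : i + 1 < c.length
      · simp only [Nat.mod_eq_of_lt hi']
        exact List.isChain_iff_getElem.1 hc i hi'
      · have : i + 1 = c.length := by omega
        simp only [this, Nat.mod_self]
        have e1 : c.getLast? = some x := by simp [hcdef]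
        rw [List.getLast?_eq_getElem?, show c.length - 1 = i by omega,
          List.getElem?_eq_getElem hi, Option.some.injEq] at e1
        rw [e1]
        apply hr
        rw [List.head?_eq_getElem?, List.getElem?_eq_getElem (by omega)]
        rfl
  exact this.flip

/-- Loop erasure: `p` is the current simple path, written backwards, and `L` collects the cycles cut
off so far. The start vertex is added on the left because `m` records only the vertices that are
entered. -/
theorem Walk.exists_path (hirr : ∀ v, ¬ r v v) {k : ℕ} {u v : α} {m : Multiset α}
    (h : Walk r k u v m) :
    ∃ (p : List α) (L : Multiset (Finset α)), p.Nodup ∧ p.head? = some v ∧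
      p.getLast? = some u ∧ List.IsChain (fun a b => r b a) p ∧ (∀ S ∈ L, Covers r S) ∧
      u ::ₘ m = (p : Multiset α) + (L.map Finset.val).sum := by
  induction h with
  | nil u => exact ⟨[u], 0, by simp, by simp, by simp, by simp, by simp, by simp⟩
  | @snoc k u x v m h hr ih =>
    obtain ⟨p, L, hd, hh, hl, hc, hL, hm⟩ := ih
    by_cases hv : v ∈ p
    · obtain ⟨l1, l2, rfl⟩ := List.append_of_mem hv
      have hd' : (l1 ++ [v]).Nodup := hd.sublist
        ((List.singleton_sublist.2 (List.mem_cons_self (a := v) (l := l2))).append_left l1)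
      refine ⟨v :: l2, (l1 ++ [v]).toFinset ::ₘ L, (List.nodup_append.1 hd).2.1, by simp, ?_,
        (List.isChain_split.1 hc).2, ?_, ?_⟩
      · rw [← hl, List.getLast?_append]; simp [List.getLast?_cons]
      · intro S hS
        rw [Multiset.mem_cons] at hS
        rcases hS with rfl | hS
        · refine covers_of_closed_chain hirr hd' (List.isChain_split.1 hc).1 ?_
          intro y hy
          have : y = x := by
            cases l1 with
            | nil => simp at hh hy; exact hy.symm.trans hh
            | cons => simp at hh hy; exact hy.symm.trans hh
          rw [this]; exact hr
        · exact hL S hS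
      · have e : (l1 ++ [v]).toFinset.val = ((l1 ++ [v] : List α) : Multiset α) := by
          rw [List.toFinset_val, List.dedup_eq_self.2 hd']
        rw [Multiset.cons_swap, hm, Multiset.map_cons, Multiset.sum_cons, e, ← add_assoc,
          ← Multiset.cons_add]
        congr 1
        simp only [Multiset.coe_add, Multiset.cons_coe, Multiset.coe_eq_coe]
        rw [List.perm_iff_count]
        intro a
        simp only [List.count_append, List.count_cons, List.count_nil]
        omega
    · refine ⟨v :: p, L, List.nodup_cons.2 ⟨hv, hd⟩, by simp, ?_, ?_, hL, ?_⟩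
      · cases p with
        | nil => simp at hh
        | cons a p => rw [← hl, List.getLast?_cons_cons]
      · cases p with
        | nil => simp at hh
        | cons a p =>
          simp at hh
          subst hh
          exact List.isChain_cons_cons.2 ⟨hr, hc⟩
      · rw [Multiset.cons_swap, hm, ← Multiset.cons_add]; rfl

/-- A closed walk decomposes into cycles. -/
theorem Walk.decompose (hirr : ∀ v, ¬ r v v) {k : ℕ} {u : α} {m : Multiset α}
    (h : Walk r k u u m) :
    ∃ L : Multiset (Finset α), (∀ S ∈ L, Covers r S) ∧ m = (L.map Finset.val).sum := by
  obtain ⟨p, L, hd, hh, hl, -, hL, hm⟩ := h.exists_path hirr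
  refine ⟨L, hL, ?_⟩
  have : p = [u] := by
    cases p with
    | nil => simp at hh
    | cons a p =>
      simp only [List.head?_cons, Option.some.injEq] at hh
      subst hh
      cases p with
      | nil => rfl
      | cons b p =>
        rw [List.getLast?_cons_cons] at hl
        exact absurd (List.mem_of_getLast? hl) (List.nodup_cons.1 hd).1
  subst this
  rw [← Multiset.cons_inj_right u, hm]
  rfl

omit [Fintype α] [DecidableEq α] in
theorem sum_map_sum_val {M : Type*} [AddCommMonoid M] (L : Multiset (Finset α)) (c : α → M) :
    (((L.map Finset.val).sum).map c).sum = (L.map fun S => ∑ v ∈ S, c v).sum := by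
  induction L using Multiset.induction with
  | empty => simp
  | cons S L ih => simp [Multiset.map_add, ih]

/-- All cycles in a decomposition of the walk have non-negative cost, so any single one of them
costs no more than the walk. The property `P` only has to hold for one cycle of each decomposition.
-/
theorem Walk.exists_covers (hirr : ∀ v, ¬ r v v) {c : α → ℝ}
    (hc : ∀ S, Covers r S → 0 ≤ ∑ v ∈ S, c v) {k : ℕ} {u : α} {m : Multiset α}
    (h : Walk r k u u m) {P : Finset α → Prop}
    (hP : ∀ L : Multiset (Finset α), m = (L.map Finset.val).sum → ∃ S ∈ L, P S) :
    ∃ S, Covers r S ∧ P S ∧ ∑ v ∈ S, c v ≤ (m.map c).sum := by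
  obtain ⟨L, hL, hm⟩ := h.decompose hirr
  obtain ⟨S, hS, hPS⟩ := hP L hm
  refine ⟨S, hL S hS, hPS, ?_⟩
  rw [hm, sum_map_sum_val]
  refine Multiset.single_le_sum (fun x hx => ?_) _ (Multiset.mem_map_of_mem _ hS)
  obtain ⟨S, hS, rfl⟩ := Multiset.mem_map.1 hx
  exact hc S (hL S hS)

theorem Walk.exists_covers_mem (hirr : ∀ v, ¬ r v v) {c : α → ℝ}
    (hc : ∀ S, Covers r S → 0 ≤ ∑ v ∈ S, c v) {k : ℕ} {u e : α} {m : Multiset α}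
    (h : Walk r k u u m) (he : e ∈ m) :
    ∃ S, Covers r S ∧ e ∈ S ∧ ∑ v ∈ S, c v ≤ (m.map c).sum := by
  refine h.exists_covers hirr hc fun L hL => ?_
  by_contra! hz
  subst hL
  have := Multiset.count_pos.2 he
  rw [← Multiset.coe_countAddMonoidHom, map_multiset_sum, Multiset.map_map] at this
  refine this.ne' (Multiset.sum_eq_zero fun x hx => ?_)
  obtain ⟨S, hS, rfl⟩ := Multiset.mem_map.1 hx
  simpa using hz S hS

theorem Walk.exists_covers_nonzero {Γ : Type*} [AddCommGroup Γ] (hirr : ∀ v, ¬ r v v) {c : α → ℝ}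
    (hc : ∀ S, Covers r S → 0 ≤ ∑ v ∈ S, c v) {k : ℕ} {u : α} {m : Multiset α} {g : α → Γ}
    (h : Walk r k u u m) (he : (m.map g).sum ≠ 0) :
    ∃ S, Covers r S ∧ ∑ v ∈ S, g v ≠ 0 ∧ ∑ v ∈ S, c v ≤ (m.map c).sum := by
  refine h.exists_covers hirr hc fun L hL => ?_
  by_contra! hz
  rw [hL, sum_map_sum_val] at he
  refine he (Multiset.sum_eq_zero fun x hx => ?_)
  obtain ⟨S, hS, rfl⟩ := Multiset.mem_map.1 hx
  exact hz S hS

/-- A disjoint union of cycles contains a cycle through any of its vertices. -/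
theorem Covers.exists_cycle {S : Finset α} (h : Covers r S) {e : α} (he : e ∈ S) :
    ∃ (T : Finset α) (k : ℕ), T ⊆ S ∧ e ∈ T ∧ k ≤ Fintype.card α ∧ k ≠ 0 ∧ Walk r k e e T.val ∧
      Covers r T ∧ Covers r (S \ T) := by
  obtain ⟨f, hf, hS, hr⟩ := h
  have hit : ∀ k, f^[k] e ∈ S := by
    intro k
    induction k with
    | zero => exact he
    | succ k ih =>
      rw [Function.iterate_succ_apply']
      exact (hS _).1 fun h => (hS _).2 ih (hf h)
  have hper : e ∈ Function.periodicPts f := hf.mem_periodicPts e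
  have hpos : 0 < Function.minimalPeriod f e := Function.minimalPeriod_pos_of_mem_periodicPts hper
  set k := Function.minimalPeriod f e with hk
  have hfk : f^[k] e = e := Function.iterate_minimalPeriod
  let T : Finset α := (range k).image fun i => f^[i + 1] e
  have hinj : Set.InjOn (fun i => f^[i + 1] e) (range k : Finset ℕ) := by
    intro i hi j hj hij
    simp only [Function.iterate_succ_apply'] at hij
    rw [coe_range, Set.mem_Iio] at hi hj
    exact Function.iterate_injOn_Iio_minimalPeriod hi hj (hf hij)
  have hwalk : ∀ i, Walk r i e (f^[i] e) ((range i).val.map fun i => f^[i + 1] e) := by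
    intro i
    induction i with
    | zero => exact Walk.nil e
    | succ i ih =>
      rw [Finset.range_val, Multiset.range_succ, Multiset.map_cons]
      refine ih.snoc ?_
      rw [Function.iterate_succ_apply']
      exact hr _ (hit i)
  have hTv : T.val = (range k).val.map fun i => f^[i + 1] e := Finset.image_val_of_injOn hinj
  have hTinv : ∀ v, f v ∈ T ↔ v ∈ T := by
    intro v
    simp only [T, mem_image, mem_range]
    constructor
    · rintro ⟨i, hi, h⟩
      rw [Function.iterate_succ_apply'] at h
      have := hf h
      rcases i with _ | i
      · exact ⟨k - 1, by omega, by rw [Nat.sub_add_cancel hpos, hfk]; exact this⟩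
      · exact ⟨i, by omega, this⟩
    · rintro ⟨i, hi, rfl⟩
      rcases Nat.lt_or_ge (i + 1) k with h | h
      · exact ⟨i + 1, h, Function.iterate_succ_apply' f (i + 1) e⟩
      · have : i + 1 = k := by omega
        refine ⟨0, hpos, ?_⟩
        rw [this, hfk]; rfl
  have hTS : T ⊆ S := by
    intro v hv
    obtain ⟨i, -, rfl⟩ := mem_image.1 hv
    exact hit _
  refine ⟨T, k, hTS, ?_, ?_, hpos.ne', ?_, ⟨fun v => if v ∈ T then f v else v, ?_, ?_, ?_⟩,
    fun v => if v ∈ T then v else f v, ?_, ?_, ?_⟩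
  · exact mem_image.2 ⟨k - 1, mem_range.2 (by omega), by rw [Nat.sub_add_cancel hpos, hfk]⟩
  · have : T.card = k := by rw [card_image_of_injOn hinj, card_range]
    rw [← this]; exact card_le_univ T
  · have := hwalk k
    rwa [hfk, ← hTv] at this
  · intro u v huv
    dsimp only at huv
    split_ifs at huv with h1 h2 h2
    · exact hf huv
    · exact absurd ((hTinv u).2 h1) (huv ▸ h2)
    · exact absurd ((hTinv v).2 h2) (huv ▸ h1)
    · exact huv
  · intro v
    by_cases h : v ∈ T
    · simpa [h, hS] using hTS h
    · simp [h]
  · intro v hv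
    simp only [if_pos hv]
    exact hr v (hTS hv)
  · intro u v huv
    dsimp only at huv
    split_ifs at huv with h1 h2 h2
    · exact huv
    · exact absurd ((hTinv v).1 (huv ▸ h1)) h2
    · exact absurd ((hTinv u).1 (huv ▸ h2)) h1
    · exact hf huv
  · intro v
    by_cases h : v ∈ T <;> simp [h, hS]
  · intro v hv
    rw [mem_sdiff] at hv
    simp only [if_neg hv.2]
    exact hr v hv.1

/-- Peel off single cycles: one of them has non-zero label because the labels add up, and discarding
the others does not raise the cost. A single cycle is needed since it is a closed walk of bounded
length. -/
theorem Covers.exists_nonzero_cycle {Γ : Type*} [AddCommGroup Γ] {c : α → ℝ} {g : α → Γ}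
    (hc : ∀ S, Covers r S → 0 ≤ ∑ v ∈ S, c v) {S : Finset α} (h : Covers r S)
    (hg : ∑ v ∈ S, g v ≠ 0) :
    ∃ (T : Finset α) (e : α) (k : ℕ), k ≤ Fintype.card α ∧ Walk r k e e T.val ∧
      ∑ v ∈ T, g v ≠ 0 ∧ ∑ v ∈ T, c v ≤ ∑ v ∈ S, c v := by
  induction S using Finset.strongInduction with
  | H S ih =>
    obtain ⟨e, he⟩ : S.Nonempty := by
      rw [nonempty_iff_ne_empty]; rintro rfl; simp at hg
    obtain ⟨T, k, hTS, heT, hk, hk0, hw, hTc, hcov⟩ := h.exists_cycle he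
    have h1 := sum_sdiff (f := c) hTS
    by_cases hgT : ∑ v ∈ T, g v = 0
    · obtain ⟨T', e', k', h2, h3, h4, h5⟩ := ih (S \ T)
        (sdiff_ssubset hTS ⟨e, heT⟩) hcov (by
          rw [← sum_sdiff hTS, hgT, add_zero] at hg; exact hg)
      exact ⟨T', e', k', h2, h3, h4, by linarith [hc T hTc]⟩
    · exact ⟨T, e, k, hk, hw, hgT, by linarith [hc _ hcov]⟩

omit [Fintype α] [DecidableEq α] in
/-- If all closed walks `W(s, u) + (u, v) + W(v, s)` composed of an arc (or nothing) and of
selected shortest walks `W` have label zero, as far as they are not longer than a given closed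
walk, then so has the latter. -/
theorem Walk.label_eq_zero {Γ : Type*} [AddCommGroup Γ] {c : α → ℝ} {g : α → Γ} {K : ℕ}
    {ok : α → α → Prop} {d : α → α → ℝ} {l : α → α → Γ}
    (hd : ∀ k u v m, k ≤ K → Walk r k u v m → ok u v ∧ d u v ≤ (m.map c).sum) {s : α} {b : ℝ}
    (hz : ∀ u v, r u v → ok s u → ok v s → d s u + c v + d v s ≤ b → l s u + g v + l v s = 0)
    (hz' : ∀ v, ok s v → ok v s → d s v + d v s ≤ b → l s v + l v s = 0)
    {k : ℕ} {m : Multiset α} (hk : k ≤ K) (h : Walk r k s s m) (hb : (m.map c).sum ≤ b) :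
    (m.map g).sum = 0 := by
  -- Along the given walk, the label of the selected walk from `s` grows exactly by the labels of
  -- the vertices entered. At the end of the walk this compares `l s s` with itself, which need not
  -- be zero.
  have key : ∀ i u m₁, Walk r i s u m₁ → ∀ j m₂, Walk r j u s m₂ → i + j ≤ K →
      ((m₁ + m₂).map c).sum ≤ b → l s u = l s s + (m₁.map g).sum := by
    intro i u m₁ h1
    generalize hs : s = s' at h1
    induction h1 with
    | nil u => subst hs; intros; simp
    | @snoc i u x v m₁ h1 hr ih =>
      intro j m₂ h2 hij hle
      subst hs
      have e := ih rfl (1 + j) ({v} + m₂) ((Walk.single hr).append h2) (by omega) (by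
        rw [← Multiset.singleton_add] at hle
        rwa [← add_assoc, add_comm m₁])
      simp only [Multiset.map_add, Multiset.map_cons, Multiset.sum_add, Multiset.sum_cons] at hle ⊢
      have d1 := hd i s x m₁ (by omega) h1
      have d2 := hd j v s m₂ (by omega) h2
      have d3 := hd (i + 1) s v _ (by omega) (h1.snoc hr)
      simp only [Multiset.map_cons, Multiset.sum_cons] at d3
      -- Both closed walks through `v` return by the same selected walk, so cancelling `l v s` gives
      -- `l s v = l s x + g v`. Neither is longer than the given walk, as prefixes and suffix are
      -- replaced by selected walks.
      have z1 := hz x v hr d1.1 d2.1 (by linarith)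
      have z2 := hz' v d3.1 d2.1 (by linarith)
      rw [add_right_cancel (z2.trans z1.symm), e]; abel
  have := key k s m h 0 0 (Walk.nil s) (by omega) (by simpa using hb)
  simpa using this

end Walks

/-! ### A structured programming language, its compilation and its proof rules. -/

section Commands

/-- Structured programs: all loops run over `0, …, 2n - 1`, with the counter in a cell of its
own. -/
inductive Cmd where
  | skip
  | setNat (a : ℕ) (i j : NatExpr) (x : NatExpr)
  | setGrp (a : ℕ) (i j : NatExpr) (x : GrpExpr)
  | setReal (a : ℕ) (i j : NatExpr) (x : RealExpr)
  | seq (P Q : Cmd)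
  | cond (b : Test) (P Q : Cmd)
  | forLoop (a : ℕ) (P : Cmd)

namespace Cmd

/-- Read a scalar variable. -/
def rd (a : ℕ) : NatExpr := .get a (.const 0) (.const 0)

/-- Read an entry of a one-dimensional array. -/
def rd1 (a : ℕ) (x : NatExpr) : NatExpr := .get a (.const 0) x

/-- The non-strict comparison of the successor of the counter with `2n` expresses that the counter
is less than `2n`. -/
def loopTest (a : ℕ) : Test := .natLe (.add (rd a) (.const 1)) (.add .size .size)

def compile : Cmd → Program
  | skip => .skip
  | setNat a i j x => .setNat a i j x
  | setGrp a i j x => .setGrp a i j x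
  | setReal a i j x => .setReal a i j x
  | seq P Q => .seq P.compile Q.compile
  | cond b P Q => .cond b P.compile Q.compile
  | forLoop a P => .seq (.setNat a (.const 0) (.const 0) (.const 0))
      (.loop (loopTest a)
        (.seq P.compile (.setNat a (.const 0) (.const 0) (.add (rd a) (.const 1)))))

/-- The running time, as a polynomial in `n`. -/
noncomputable def time : Cmd → Polynomial ℕ
  | skip => .C 1
  | setNat _ i j x => .C (i.cost + j.cost + x.cost + 1)
  | setGrp _ i j x => .C (i.cost + j.cost + x.cost + 1)
  | setReal _ i j x => .C (i.cost + j.cost + x.cost + 1)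
  | seq P Q => P.time + Q.time
  | cond b P Q => .C (b.cost + 1) + P.time + Q.time
  | forLoop _ P => .C 20 + (.X + .X) * (P.time + .C 20)

def writesNat : Cmd → ℕ → Bool
  | skip, _ => false
  | setNat a _ _ _, b => a == b
  | setGrp _ _ _ _, _ => false
  | setReal _ _ _ _, _ => false
  | seq P Q, b => P.writesNat b || Q.writesNat b
  | cond _ P Q, b => P.writesNat b || Q.writesNat b
  | forLoop a P, b => a == b || P.writesNat b

def writesGrp : Cmd → ℕ → Bool
  | skip, _ => false
  | setNat _ _ _ _, _ => false
  | setGrp a _ _ _, b => a == b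
  | setReal _ _ _ _, _ => false
  | seq P Q, b => P.writesGrp b || Q.writesGrp b
  | cond _ P Q, b => P.writesGrp b || Q.writesGrp b
  | forLoop _ P, b => P.writesGrp b

def writesReal : Cmd → ℕ → Bool
  | skip, _ => false
  | setNat _ _ _ _, _ => false
  | setGrp _ _ _ _, _ => false
  | setReal a _ _ _, b => a == b
  | seq P Q, b => P.writesReal b || Q.writesReal b
  | cond _ P Q, b => P.writesReal b || Q.writesReal b
  | forLoop _ P, b => P.writesReal b

/-- Loop bodies do not write to their counter. -/
def wf : Cmd → Bool
  | seq P Q => P.wf && Q.wf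
  | cond _ P Q => P.wf && Q.wf
  | forLoop a P => !P.writesNat a && P.wf
  | _ => true

variable {Γ : Type*} [AddCommGroup Γ] {n : ℕ}

/-- Set a scalar variable. -/
def _root_.GroupLabeledMatroid.Store.put (s : Store Γ) (a k : ℕ) : Store Γ :=
  { s with nat := writeCell s.nat a 0 0 k }

open Classical in
/-- The effect of a structured program on the memory. -/
noncomputable def run (I : Input Γ n) : Cmd → Store Γ → Store Γ
  | skip, s => s
  | setNat a i j x, s =>
      { s with nat := writeCell s.nat a (i.eval n s.nat) (j.eval n s.nat) (x.eval n s.nat) }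
  | setGrp a i j x, s =>
      { s with grp := writeCell s.grp a (i.eval n s.nat) (j.eval n s.nat) (x.eval I s) }
  | setReal a i j x, s =>
      { s with real := writeCell s.real a (i.eval n s.nat) (j.eval n s.nat) (x.eval I s) }
  | seq P Q, s => Q.run I (P.run I s)
  | cond b P Q, s => if b.Holds I s then P.run I s else Q.run I s
  | forLoop a P, s => Nat.rec (s.put a 0) (fun k t => (P.run I t).put a (k + 1)) (n + n)

/-- The arrays that `c` does not write to agree in `s` and `t`. -/
structure Frame (c : Cmd) (s t : Store Γ) : Prop where
  nat : ∀ b, c.writesNat b = false → t.nat b = s.nat b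
  grp : ∀ b, c.writesGrp b = false → t.grp b = s.grp b
  real : ∀ b, c.writesReal b = false → t.real b = s.real b

theorem writeCell_of_ne {α : Type*} {m : ℕ → ℕ → ℕ → α} {a b i j : ℕ} {v : α} (h : b ≠ a) :
    writeCell m a i j v b = m b := by
  funext i' j'
  simp [writeCell, h]

theorem iterate_frame {I : Input Γ n} {a : ℕ} {P : Cmd}
    (hP : ∀ s : Store Γ, Frame P s (P.run I s)) (s : Store Γ) (k : ℕ) :
    Frame (forLoop a P) s
      (Nat.rec (motive := fun _ => Store Γ) (s.put a 0) (fun k t => (P.run I t).put a (k + 1)) k) := by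
  induction k with
  | zero =>
    refine ⟨fun b hb => ?_, fun _ _ => rfl, fun _ _ => rfl⟩
    simp only [writesNat, Bool.or_eq_false_iff, beq_eq_false_iff_ne] at hb
    exact writeCell_of_ne (Ne.symm hb.1)
  | succ k ih =>
    refine ⟨fun b hb => ?_, fun b hb => ?_, fun b hb => ?_⟩
    · have hb' := hb
      simp only [writesNat, Bool.or_eq_false_iff, beq_eq_false_iff_ne] at hb
      refine (writeCell_of_ne (Ne.symm hb.1)).trans (((hP _).nat b hb.2).trans (ih.nat b hb'))
    · exact ((hP _).grp b hb).trans (ih.grp b hb)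
    · exact ((hP _).real b hb).trans (ih.real b hb)

theorem run_frame (I : Input Γ n) (c : Cmd) (s : Store Γ) : Frame c s (c.run I s) := by
  induction c generalizing s with
  | skip => exact ⟨fun _ _ => rfl, fun _ _ => rfl, fun _ _ => rfl⟩
  | setNat a i j x =>
    refine ⟨fun b hb => ?_, fun _ _ => rfl, fun _ _ => rfl⟩
    exact writeCell_of_ne (Ne.symm (by simpa [writesNat] using hb))
  | setGrp a i j x =>
    refine ⟨fun _ _ => rfl, fun b hb => ?_, fun _ _ => rfl⟩
    exact writeCell_of_ne (Ne.symm (by simpa [writesGrp] using hb))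
  | setReal a i j x =>
    refine ⟨fun _ _ => rfl, fun _ _ => rfl, fun b hb => ?_⟩
    exact writeCell_of_ne (Ne.symm (by simpa [writesReal] using hb))
  | seq P Q ihP ihQ =>
    refine ⟨fun b hb => ?_, fun b hb => ?_, fun b hb => ?_⟩
    · simp only [writesNat, Bool.or_eq_false_iff] at hb
      exact ((ihQ _).nat b hb.2).trans ((ihP s).nat b hb.1)
    · simp only [writesGrp, Bool.or_eq_false_iff] at hb
      exact ((ihQ _).grp b hb.2).trans ((ihP s).grp b hb.1)
    · simp only [writesReal, Bool.or_eq_false_iff] at hb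
      exact ((ihQ _).real b hb.2).trans ((ihP s).real b hb.1)
  | cond b P Q ihP ihQ =>
    refine ⟨fun b hb => ?_, fun b hb => ?_, fun b hb => ?_⟩
    · simp only [writesNat, Bool.or_eq_false_iff] at hb
      simp only [run]
      split_ifs
      exacts [(ihP s).nat b hb.1, (ihQ s).nat b hb.2]
    · simp only [writesGrp, Bool.or_eq_false_iff] at hb
      simp only [run]
      split_ifs
      exacts [(ihP s).grp b hb.1, (ihQ s).grp b hb.2]
    · simp only [writesReal, Bool.or_eq_false_iff] at hb
      simp only [run]
      split_ifs
      exacts [(ihP s).real b hb.1, (ihQ s).real b hb.2]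
  | forLoop a P ih => exact iterate_frame ih s (n + n)

/-- Induction over the iterations. Each step is supplied with the counter value and with the frame
relative to the initial state, so that invariants need to mention only what the loop changes. -/
theorem run_forLoop {I : Input Γ n} {a : ℕ} {P : Cmd} {s : Store Γ} (Inv : ℕ → Store Γ → Prop)
    (h0 : Inv 0 (s.put a 0))
    (hstep : ∀ k < n + n, ∀ t, t.nat a 0 0 = k → Frame (forLoop a P) s t → Inv k t →
      Inv (k + 1) ((P.run I t).put a (k + 1))) :
    Inv (n + n) ((forLoop a P).run I s) := by
  have : ∀ k ≤ n + n, Inv k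
      (Nat.rec (motive := fun _ => Store Γ) (s.put a 0) (fun k t => (P.run I t).put a (k + 1)) k) := by
    intro k
    induction k with
    | zero => exact fun _ => h0
    | succ k ih =>
      intro hk
      refine hstep k (by omega) _ ?_ (iterate_frame (run_frame I P) s k) (ih (by omega))
      cases k <;> simp [Store.put, writeCell]
  exact this _ le_rfl

/-- Rule for loops that make progress with respect to a preorder on the memory states. -/
theorem run_forLoop_mono {I : Input Γ n} {a : ℕ} {P : Cmd} {s : Store Γ} (Q : Store Γ → Prop)
    (R : Store Γ → Store Γ → Prop) (G : ℕ → Store Γ → Prop)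
    (hQ : ∀ t k, Q t → Q (t.put a k)) (hR : ∀ t k, R t (t.put a k))
    (htr : ∀ t t' t'', R t t' → R t' t'' → R t t'')
    (hG : ∀ k t t', G k t → R t t' → G k t') (h0 : Q s)
    (hstep : ∀ k < n + n, ∀ t, t.nat a 0 0 = k → Frame (forLoop a P) s t → R s t → Q t →
      Q (P.run I t) ∧ R t (P.run I t) ∧ G k (P.run I t)) :
    Q ((forLoop a P).run I s) ∧ R s ((forLoop a P).run I s) ∧
      ∀ k < n + n, G k ((forLoop a P).run I s) := by
  refine run_forLoop (fun j t => Q t ∧ R s t ∧ ∀ k < j, G k t) ⟨hQ _ _ h0, hR _ _, by simp⟩ ?_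
  rintro k hk t htk hfr ⟨h1, h2, h3⟩
  obtain ⟨h4, h5, h6⟩ := hstep k hk t htk hfr h2 h1
  have h7 : R t ((P.run I t).put a (k + 1)) := htr _ _ _ h5 (hR _ _)
  refine ⟨hQ _ _ h4, htr _ _ _ h2 h7, fun j hj => ?_⟩
  rcases Nat.lt_succ_iff_lt_or_eq.1 hj with h | rfl
  · exact hG _ _ _ (h3 j h) h7
  · exact hG _ _ _ h6 (hR _ _)

/-- In `run` the counter is set to `k + 1` after each iteration, whereas the compiled loop
increments the cell. The two agree because well-formed bodies leave their counter alone. -/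
theorem compile_runs (I : Input Γ n) (c : Cmd) (hc : c.wf = true) (s : Store Γ) :
    ∃ t ≤ c.time.eval n, Runs I c.compile s t (c.run I s) := by
  induction c generalizing s with
  | skip => exact ⟨_, by simp [time], Runs.skip s⟩
  | setNat a i j x => exact ⟨_, by simp [time], Runs.setNat a i j x s⟩
  | setGrp a i j x => exact ⟨_, by simp [time], Runs.setGrp a i j x s⟩
  | setReal a i j x => exact ⟨_, by simp [time], Runs.setReal a i j x s⟩
  | seq P Q ihP ihQ =>
    simp only [wf, Bool.and_eq_true] at hc
    obtain ⟨t, ht, h⟩ := ihP hc.1 s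
    obtain ⟨t', ht', h'⟩ := ihQ hc.2 (P.run I s)
    exact ⟨t + t', by simp only [time, Polynomial.eval_add]; omega, h.seq h'⟩
  | cond b P Q ihP ihQ =>
    simp only [wf, Bool.and_eq_true] at hc
    simp only [compile, run, time, Polynomial.eval_add, Polynomial.eval_C]
    split_ifs with hb
    · obtain ⟨t, ht, h⟩ := ihP hc.1 s
      exact ⟨_, by omega, Runs.condTrue hb h⟩
    · obtain ⟨t, ht, h⟩ := ihQ hc.2 s
      exact ⟨_, by omega, Runs.condFalse hb h⟩
  | forLoop a P ih =>
    simp only [wf, Bool.and_eq_true, Bool.not_eq_true'] at hc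
    let it : ℕ → Store Γ := fun k =>
      Nat.rec (motive := fun _ => Store Γ) (s.put a 0) (fun k t => (P.run I t).put a (k + 1)) k
    have hit : ∀ k, (it k).nat a 0 0 = k := by
      intro k
      cases k <;> simp [it, Store.put, writeCell]
    -- Here `j` counts the iterations still to be made. The failing last test costs `10`; an
    -- iteration costs `10` for the test, `8` for the increment, and the body.
    have key : ∀ j ≤ n + n, ∃ t ≤ 10 + j * (P.time.eval n + 20),
        Runs I (.loop (loopTest a)
          (.seq P.compile (.setNat a (.const 0) (.const 0) (.add (rd a) (.const 1)))))
          (it (n + n - j)) t (it (n + n)) := by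
      intro j
      induction j with
      | zero =>
        intro _
        refine ⟨_, ?_, Runs.loopFalse ?_⟩
        · simp [loopTest, Test.cost, NatExpr.cost, rd]
        · simp [loopTest, Test.Holds, NatExpr.eval, rd, hit]
      | succ j ihj =>
        intro hj
        obtain ⟨t', ht', h'⟩ := ihj (by omega)
        obtain ⟨t, ht, h⟩ := ih hc.2 (it (n + n - (j + 1)))
        have hcount : (P.run I (it (n + n - (j + 1)))).nat a 0 0 = n + n - (j + 1) := by
          rw [(run_frame I P _).nat a hc.1, hit]
        have hnext : it (n + n - j) =
            { P.run I (it (n + n - (j + 1))) with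
              nat := writeCell (P.run I (it (n + n - (j + 1)))).nat a
                ((NatExpr.const 0).eval n (P.run I (it (n + n - (j + 1)))).nat)
                ((NatExpr.const 0).eval n (P.run I (it (n + n - (j + 1)))).nat)
                ((NatExpr.add (rd a) (.const 1)).eval n (P.run I (it (n + n - (j + 1)))).nat) } := by
          rw [show n + n - j = (n + n - (j + 1)) + 1 by omega]
          simp only [NatExpr.eval, rd, hcount]
          rfl
        rw [hnext] at h'
        refine ⟨_, ?_, Runs.loopTrue ?_ (h.seq (Runs.setNat a (.const 0) (.const 0) _ _)) h'⟩
        · simp only [loopTest, Test.cost, NatExpr.cost, rd]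
          rw [add_mul]
          omega
        · simp only [loopTest, Test.Holds, NatExpr.eval, rd, hit]
          omega
    obtain ⟨t, ht, h⟩ := key (n + n) le_rfl
    rw [Nat.sub_self] at h
    refine ⟨_, ?_, (Runs.setNat a (.const 0) (.const 0) (.const 0) s).seq h⟩
    simp only [time, Polynomial.eval_add, Polynomial.eval_mul, Polynomial.eval_C,
      Polynomial.eval_X, NatExpr.cost]
    omega

end Cmd

end Commands

/-! ### Independence in a pulled back matroid by one oracle call. -/

section IndependenceTest

namespace Cmd

/-- Assign to a scalar variable. -/
def assign (a : ℕ) (x : NatExpr) : Cmd := .setNat a (.const 0) (.const 0) x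

/-- Assign to an entry of a one-dimensional array. -/
def assign1 (a : ℕ) (i x : NatExpr) : Cmd := .setNat a (.const 0) i x

def isOne (x : NatExpr) : Test := .natEq x (.const 1)

variable {Γ : Type*} [AddCommGroup Γ] {n : ℕ} {I : Input Γ n}

@[simp] theorem eval_rd (a : ℕ) (m : ℕ → ℕ → ℕ → ℕ) : (rd a).eval n m = m a 0 0 := rfl

@[simp] theorem eval_rd1 (a : ℕ) (x : NatExpr) (m : ℕ → ℕ → ℕ → ℕ) :
    (rd1 a x).eval n m = m a 0 (x.eval n m) := rfl

@[simp] theorem holds_isOne (x : NatExpr) (s : Store Γ) :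
    (isOne x).Holds I s ↔ x.eval n s.nat = 1 := Iff.rfl

theorem run_seq (P Q : Cmd) (s : Store Γ) : (seq P Q).run I s = Q.run I (P.run I s) := rfl

theorem run_cond_pos {b : Test} {P Q : Cmd} {s : Store Γ} (h : b.Holds I s) :
    (cond b P Q).run I s = P.run I s := if_pos h

theorem run_cond_neg {b : Test} {P Q : Cmd} {s : Store Γ} (h : ¬ b.Holds I s) :
    (cond b P Q).run I s = Q.run I s := if_neg h

@[simp] theorem run_skip (s : Store Γ) : skip.run I s = s := rfl

theorem run_assign_nat (a : ℕ) (x : NatExpr) (s : Store Γ) (b i j : ℕ) :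
    ((assign a x).run I s).nat b i j =
      if b = a ∧ i = 0 ∧ j = 0 then x.eval n s.nat else s.nat b i j := rfl

theorem run_assign1_nat (a : ℕ) (y x : NatExpr) (s : Store Γ) (b i j : ℕ) :
    ((assign1 a y x).run I s).nat b i j =
      if b = a ∧ i = 0 ∧ j = y.eval n s.nat then x.eval n s.nat else s.nat b i j := rfl

omit [AddCommGroup Γ] in
theorem put_nat (s : Store Γ) (a k b i j : ℕ) :
    (s.put a k).nat b i j = if b = a ∧ i = 0 ∧ j = 0 then k else s.nat b i j := rfl

/-- Test whether the set with indicator vector in array `13`, mapped by array `f`, is independent: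
the result in variable `3` is one if the map is injective on the set and the oracle `o` accepts
the image, which is computed in array `2`. -/
def indepTest (f : ℕ) (o : Test) : Cmd :=
  seq (forLoop 20 (assign1 2 (rd 20) (.const 0))) <|
  seq (assign 3 (.const 1)) <|
  seq (forLoop 20 (cond (isOne (rd1 13 (rd 20)))
    (cond (isOne (rd1 2 (rd1 f (rd 20)))) (assign 3 (.const 0))
      (assign1 2 (rd1 f (rd 20)) (.const 1))) skip)) <|
  cond o skip (assign 3 (.const 0))

/-- A set is independent in `M.comap φ` when `φ` is injective on it and maps it to an independent
set. The loop marks images in array `2` and rejects when an image is already marked; the bound on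
`f` keeps the map disjoint from the working arrays. -/
theorem run_indepTest {M : Matroid (Fin n)} {φ : Fin (n + n) → Fin n}
    {S : Finset (Fin (n + n))} {s : Store Γ} {f : ℕ} {o : Test}
    (ho : ∀ t : Store Γ, o.Holds I t ↔ M.Indep (t.row n 2 0)) (hf2 : 21 ≤ f)
    (hf : ∀ x : Fin (n + n), s.nat f 0 x = φ x)
    (hS : ∀ x : Fin (n + n), s.nat 13 0 x = 1 ↔ x ∈ S) :
    ((indepTest f o).run I s).nat 3 0 0 = 1 ↔ (M.comap φ).Indep S := by
  rw [indepTest, run_seq, run_seq, run_seq]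
  set s₁ := (forLoop 20 (assign1 2 (rd 20) (.const 0))).run I s with hs₁
  have h1 : ∀ y < n + n, s₁.nat 2 0 y = 0 := by
    refine run_forLoop (I := I) (fun k t => ∀ y < k, t.nat 2 0 y = 0) (by simp) ?_
    intro k hk t htk _ hI y hy
    simp only [put_nat, run_assign1_nat, eval_rd, htk, NatExpr.eval]
    by_cases h : y = k
    · simp [h]
    · simp [h, hI y (by omega)]
  have hfr1 : Frame _ s s₁ := run_frame I _ s
  set s₂ := (assign 3 (.const 1)).run I s₁ with hs₂
  set s₃ := (forLoop 20 (cond (isOne (rd1 13 (rd 20)))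
    (cond (isOne (rd1 2 (rd1 f (rd 20)))) (assign 3 (.const 0))
      (assign1 2 (rd1 f (rd 20)) (.const 1))) skip)).run I s₂ with hs₃
  have hs2f : s₂.nat f = s.nat f := by
    have : s₂.nat f = s₁.nat f := (run_frame I (assign 3 (.const 1)) s₁).nat f (by
      simp [assign, writesNat]; omega)
    rw [this]
    exact hfr1.nat f (by simp [assign1, writesNat]; omega)
  have hs213 : s₂.nat 13 = s.nat 13 := by
    have : s₂.nat 13 = s₁.nat 13 := (run_frame I (assign 3 (.const 1)) s₁).nat 13 rfl
    rw [this]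
    exact hfr1.nat 13 rfl
  -- The marks have to be exactly `0` or `1`: the program compares them with `1`, while the oracle
  -- reads every non-zero entry as membership.
  have h3 : (s₃.nat 3 0 0 = 1 ↔ Set.InjOn φ {x | x ∈ S ∧ (x : ℕ) < n + n}) ∧
      ∀ y : Fin n, s₃.nat 2 0 y = 1 ∧ (∃ x ∈ S, (x : ℕ) < n + n ∧ φ x = y) ∨
        s₃.nat 2 0 y = 0 ∧ ¬ ∃ x ∈ S, (x : ℕ) < n + n ∧ φ x = y := by
    refine run_forLoop (I := I) (fun k t =>
      (t.nat 3 0 0 = 1 ↔ Set.InjOn φ {x | x ∈ S ∧ (x : ℕ) < k}) ∧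
      ∀ y : Fin n, t.nat 2 0 y = 1 ∧ (∃ x ∈ S, (x : ℕ) < k ∧ φ x = y) ∨
        t.nat 2 0 y = 0 ∧ ¬ ∃ x ∈ S, (x : ℕ) < k ∧ φ x = y) ?_ ?_
    · refine ⟨?_, fun y => Or.inr ⟨?_, by simp⟩⟩
      · simp [put_nat, hs₂, run_assign_nat, NatExpr.eval]
      · simp only [put_nat, hs₂, run_assign_nat]
        simpa using h1 y (by omega)
    · rintro k hk t htk hfr ⟨hinj, himg⟩
      have ht13 : t.nat 13 0 k = s.nat 13 0 k := by
        rw [hfr.nat 13 rfl, hs213]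
      have htf : t.nat f 0 k = φ ⟨k, hk⟩ := by
        rw [hfr.nat f (by simp [assign1, assign, writesNat]; omega), hs2f]
        exact hf ⟨k, hk⟩
      have hkS := hS ⟨k, hk⟩
      have hlt : ∀ x : Fin (n + n), (x : ℕ) < k + 1 ↔ (x : ℕ) < k ∨ x = ⟨k, hk⟩ := by
        intro x
        rw [Fin.ext_iff]
        simp only []
        omega
      by_cases hk1 : s.nat 13 0 k = 1
      · have hkS' : (⟨k, hk⟩ : Fin (n + n)) ∈ S := hkS.1 hk1
        rw [run_cond_pos (by simp [htk, ht13, hk1])]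
        have hset : {x | x ∈ S ∧ (x : ℕ) < k + 1} =
            insert ⟨k, hk⟩ {x | x ∈ S ∧ (x : ℕ) < k} := by
          ext x
          simp only [Set.mem_ofPred_eq, hlt, Set.mem_insert_iff]
          constructor
          · rintro ⟨h, h' | h'⟩ <;> tauto
          · rintro (rfl | h)
            · exact ⟨hkS', Or.inr rfl⟩
            · exact ⟨h.1, Or.inl h.2⟩
        have hnot : (⟨k, hk⟩ : Fin (n + n)) ∉ {x | x ∈ S ∧ (x : ℕ) < k} := by simp
        have hex : ∀ y, (∃ x ∈ S, (x : ℕ) < k + 1 ∧ φ x = y) ↔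
            ((∃ x ∈ S, (x : ℕ) < k ∧ φ x = y) ∨ φ ⟨k, hk⟩ = y) := by
          intro y
          simp only [hlt]
          constructor
          · rintro ⟨x, hx, h | rfl, h'⟩
            · exact Or.inl ⟨x, hx, h, h'⟩
            · exact Or.inr h'
          · rintro (⟨x, hx, h, h'⟩ | h)
            · exact ⟨x, hx, Or.inl h, h'⟩
            · exact ⟨_, hkS', Or.inr rfl, h⟩
        have himem : φ ⟨k, hk⟩ ∈ φ '' {x | x ∈ S ∧ (x : ℕ) < k} ↔
            ∃ x ∈ S, (x : ℕ) < k ∧ φ x = φ ⟨k, hk⟩ := by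
          simp only [Set.mem_image, Set.mem_ofPred_eq, and_assoc]
        rcases himg (φ ⟨k, hk⟩) with ⟨hT, hTe⟩ | ⟨hT, hTe⟩
        · rw [run_cond_pos (by simp [htk, htf, hT])]
          refine ⟨?_, fun y => ?_⟩
          · rw [hset, Set.injOn_insert hnot, himem]
            simp only [put_nat, run_assign_nat, NatExpr.eval]
            simpa using fun _ => hTe
          · have e : (((assign 3 (.const 0)).run I t).put 20 (k + 1)).nat 2 0 y = t.nat 2 0 y := by
              simp [put_nat, run_assign_nat]
            rw [e, hex]
            rcases himg y with h | h
            · exact Or.inl ⟨h.1, Or.inl h.2⟩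
            · refine Or.inr ⟨h.1, ?_⟩
              rintro (h' | rfl)
              exacts [h.2 h', h.2 hTe]
        · rw [run_cond_neg (by simp [htk, htf, hT])]
          refine ⟨?_, fun y => ?_⟩
          · rw [hset, Set.injOn_insert hnot, himem]
            simp only [put_nat, run_assign1_nat]
            simpa [hTe] using hinj
          · have e : (((assign1 2 (rd1 f (rd 20)) (.const 1)).run I t).put 20 (k + 1)).nat 2 0 y =
                if y = φ ⟨k, hk⟩ then 1 else t.nat 2 0 y := by
              simp [put_nat, run_assign1_nat, NatExpr.eval, htk, htf, Fin.ext_iff]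
            rw [e, hex]
            by_cases hy : y = φ ⟨k, hk⟩
            · left; simp [hy]
            · rw [if_neg hy]
              rcases himg y with h | h
              · exact Or.inl ⟨h.1, Or.inl h.2⟩
              · refine Or.inr ⟨h.1, ?_⟩
                rintro (h' | h')
                exacts [h.2 h', hy h'.symm]
      · have hkS' : (⟨k, hk⟩ : Fin (n + n)) ∉ S := fun h => hk1 (hkS.2 h)
        rw [run_cond_neg (by simp [htk, ht13, hk1]), run_skip]
        have hlt' : ∀ x ∈ S, (x : ℕ) < k + 1 ↔ (x : ℕ) < k := by
          intro x hx
          rw [hlt]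
          refine or_iff_left ?_
          rintro rfl
          exact hkS' hx
        have hset : {x | x ∈ S ∧ (x : ℕ) < k + 1} = {x | x ∈ S ∧ (x : ℕ) < k} := by
          ext x
          exact and_congr_right (hlt' x)
        have hex : ∀ y, (∃ x ∈ S, (x : ℕ) < k + 1 ∧ φ x = y) ↔ ∃ x ∈ S, (x : ℕ) < k ∧ φ x = y := by
          intro y
          refine exists_congr fun x => and_congr_right fun hx => ?_
          rw [hlt' x hx]
        refine ⟨?_, fun y => ?_⟩
        · rw [hset]
          simpa [put_nat] using hinj
        · rw [hex]
          simpa [put_nat] using himg y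
  have hrow : (s₃.row n 2 0 : Set (Fin n)) = φ '' S := by
    ext y
    simp only [Store.row, Finset.coe_filter, Finset.mem_univ, true_and, Set.mem_ofPred_eq,
      Set.mem_image, Finset.mem_coe]
    rcases h3.2 y with ⟨h, x, hx, -, h'⟩ | ⟨h, h'⟩
    · simp only [h, ne_eq, one_ne_zero, not_false_eq_true, true_iff]
      exact ⟨x, hx, h'⟩
    · simp only [h, ne_eq, not_true_eq_false, false_iff]
      rintro ⟨x, hx, hxy⟩
      exact h' ⟨x, hx, x.2, hxy⟩
  have hSset : {x | x ∈ S ∧ (x : ℕ) < n + n} = (S : Set (Fin (n + n))) := by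
    ext x
    simp only [Set.mem_ofPred_eq, Finset.mem_coe]
    exact and_iff_left x.2
  rw [hSset] at h3
  rw [Matroid.comap_indep_iff, ← h3.1, ← hrow]
  by_cases h : o.Holds I s₃
  · rw [run_cond_pos h, run_skip]
    exact (and_iff_right ((ho s₃).1 h)).symm
  · rw [run_cond_neg h]
    have := mt (ho s₃).2 h
    simp [run_assign_nat, NatExpr.eval, this]

end Cmd

end IndependenceTest

/-! ### Computing the arcs of the exchange digraph. -/

section ArcMatrix

/-- The exchange digraph restricted to the vertex set `U`. -/
def arcIn {α : Type*} [DecidableEq α] (N₁ N₂ : Matroid α) (A U : Finset α) (u v : α) : Prop :=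
  u ∈ U ∧ v ∈ U ∧ exchangeArc N₁ N₂ A u v

theorem covers_arcIn_iff {α : Type*} [DecidableEq α] {N₁ N₂ : Matroid α} {A U S : Finset α} :
    Covers (arcIn N₁ N₂ A U) S ↔ S ⊆ U ∧ Covers (exchangeArc N₁ N₂ A) S := by
  constructor
  · intro h
    refine ⟨?_, h.mono fun u _ v _ h => h.2.2⟩
    obtain ⟨f, -, -, h⟩ := h
    exact fun v hv => (h v hv).1
  · rintro ⟨h1, h2⟩
    exact h2.mono fun u hu v hv h => ⟨h1 hu, h1 hv, h⟩

namespace Cmd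

/-- Read an entry of a matrix. -/
def rd2 (a i j : ℕ) : NatExpr := .get a (rd i) (rd j)

/-- The set `A - out + inn` is written to array `13`. -/
def loadExchange (out inn : NatExpr) : Cmd :=
  seq (forLoop 20 (assign1 13 (rd 20) (rd1 6 (rd 20)))) <|
  seq (assign1 13 out (.const 0)) (assign1 13 inn (.const 1))

/-- Test whether there is an arc between the vertices in the variables `21` and `22`. -/
def arcTest : Cmd :=
  cond (.and (isOne (rd1 7 (rd 21))) (isOne (rd1 7 (rd 22))))
    (cond (.and (isOne (rd1 6 (rd 21))) (.not (isOne (rd1 6 (rd 22)))))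
      (seq (loadExchange (rd 21) (rd 22)) (indepTest 31 (.indep₁ 2 (.const 0))))
      (cond (.and (.not (isOne (rd1 6 (rd 21)))) (isOne (rd1 6 (rd 22))))
        (seq (loadExchange (rd 22) (rd 21)) (indepTest 32 (.indep₂ 2 (.const 0))))
        (assign 3 (.const 0))))
    (assign 3 (.const 0))

/-- Initialize the entry of the matrices at the vertices in the variables `21` and `22`. -/
def initCell : Cmd :=
  seq (cond (.natEq (rd 21) (rd 22))
    (seq (.setNat 8 (rd 21) (rd 22) (.const 1)) <|
      seq (.setReal 1 (rd 21) (rd 22) .zero) (.setGrp 1 (rd 21) (rd 22) .zero))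
    (seq arcTest <| seq (.setNat 8 (rd 21) (rd 22) (rd 3)) <|
      seq (.setReal 1 (rd 21) (rd 22) (.get 0 (.const 0) (rd 22)))
        (.setGrp 1 (rd 21) (rd 22) (.get 0 (.const 0) (rd 22))))) <|
  seq (.setNat 9 (rd 21) (rd 22) (rd2 8 21 22)) <|
  seq (.setReal 2 (rd 21) (rd 22) (.get 1 (rd 21) (rd 22)))
    (.setGrp 2 (rd 21) (rd 22) (.get 1 (rd 21) (rd 22)))

def initMatrix : Cmd := forLoop 21 (forLoop 22 initCell)

variable {Γ : Type*} [AddCommGroup Γ] {n : ℕ} {I : Input Γ n}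

@[simp] theorem eval_rd2 (a i j : ℕ) (m : ℕ → ℕ → ℕ → ℕ) :
    (rd2 a i j).eval n m = m a (m i 0 0) (m j 0 0) := rfl

@[simp] theorem eval_const (k : ℕ) (m : ℕ → ℕ → ℕ → ℕ) : (NatExpr.const k).eval n m = k := rfl

theorem run_setNat_nat (a : ℕ) (y z x : NatExpr) (s : Store Γ) (b i j : ℕ) :
    ((setNat a y z x).run I s).nat b i j =
      if b = a ∧ i = y.eval n s.nat ∧ j = z.eval n s.nat then x.eval n s.nat
      else s.nat b i j := rfl

theorem run_setReal_real (a : ℕ) (y z : NatExpr) (x : RealExpr) (s : Store Γ) (b i j : ℕ) :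
    ((setReal a y z x).run I s).real b i j =
      if b = a ∧ i = y.eval n s.nat ∧ j = z.eval n s.nat then x.eval I s
      else s.real b i j := rfl

theorem run_setGrp_grp (a : ℕ) (y z : NatExpr) (x : GrpExpr) (s : Store Γ) (b i j : ℕ) :
    ((setGrp a y z x).run I s).grp b i j =
      if b = a ∧ i = y.eval n s.nat ∧ j = z.eval n s.nat then x.eval I s
      else s.grp b i j := rfl

@[simp] theorem run_setNat_real (a : ℕ) (y z x : NatExpr) (s : Store Γ) :
    ((setNat a y z x).run I s).real = s.real := rfl

@[simp] theorem run_setNat_grp (a : ℕ) (y z x : NatExpr) (s : Store Γ) :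
    ((setNat a y z x).run I s).grp = s.grp := rfl

@[simp] theorem run_setReal_nat (a : ℕ) (y z : NatExpr) (x : RealExpr) (s : Store Γ) :
    ((setReal a y z x).run I s).nat = s.nat := rfl

@[simp] theorem run_setReal_grp (a : ℕ) (y z : NatExpr) (x : RealExpr) (s : Store Γ) :
    ((setReal a y z x).run I s).grp = s.grp := rfl

@[simp] theorem run_setGrp_nat (a : ℕ) (y z : NatExpr) (x : GrpExpr) (s : Store Γ) :
    ((setGrp a y z x).run I s).nat = s.nat := rfl

@[simp] theorem run_setGrp_real (a : ℕ) (y z : NatExpr) (x : GrpExpr) (s : Store Γ) :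
    ((setGrp a y z x).run I s).real = s.real := rfl

omit [AddCommGroup Γ] in
@[simp] theorem put_real (s : Store Γ) (a k : ℕ) : (s.put a k).real = s.real := rfl

omit [AddCommGroup Γ] in
@[simp] theorem put_grp (s : Store Γ) (a k : ℕ) : (s.put a k).grp = s.grp := rfl

/-- The memory holds the data of an exchange digraph: the maps of the two matroids, the basis,
costs, and labels. -/
structure Setup (φ₁ φ₂ : Fin (n + n) → Fin n) (A : Finset (Fin (n + n))) (c : Fin (n + n) → ℝ)
    (g : Fin (n + n) → Γ) (s : Store Γ) : Prop where
  map₁ : ∀ x : Fin (n + n), s.nat 31 0 x = φ₁ x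
  map₂ : ∀ x : Fin (n + n), s.nat 32 0 x = φ₂ x
  mask : ∀ x : Fin (n + n), s.nat 6 0 x = 1 ↔ x ∈ A
  cost : ∀ x : Fin (n + n), s.real 0 0 x = c x
  label : ∀ x : Fin (n + n), s.grp 0 0 x = g x

variable {φ₁ φ₂ : Fin (n + n) → Fin n} {A U : Finset (Fin (n + n))} {c : Fin (n + n) → ℝ}
  {g : Fin (n + n) → Γ} {s : Store Γ}

omit [AddCommGroup Γ] in
theorem Setup.congr {t : Store Γ} (h : Setup φ₁ φ₂ A c g s) (h1 : t.nat 31 = s.nat 31)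
    (h2 : t.nat 32 = s.nat 32) (h3 : t.nat 6 = s.nat 6) (h4 : t.real 0 = s.real 0)
    (h5 : t.grp 0 = s.grp 0) : Setup φ₁ φ₂ A c g t :=
  ⟨by rw [h1]; exact h.map₁, by rw [h2]; exact h.map₂, by rw [h3]; exact h.mask,
    by rw [h4]; exact h.cost, by rw [h5]; exact h.label⟩

theorem run_loadExchange {out inn : NatExpr} {u v : Fin (n + n)} (hne : u ≠ v)
    (hA : ∀ x : Fin (n + n), s.nat 6 0 x = 1 ↔ x ∈ A)
    (ho : ∀ t : Store Γ, t.nat 21 = s.nat 21 → t.nat 22 = s.nat 22 → out.eval n t.nat = u)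
    (hi : ∀ t : Store Γ, t.nat 21 = s.nat 21 → t.nat 22 = s.nat 22 → inn.eval n t.nat = v)
    (x : Fin (n + n)) :
    ((loadExchange out inn).run I s).nat 13 0 x = 1 ↔ x ∈ insert v (A.erase u) := by
  rw [loadExchange, run_seq, run_seq]
  set s₁ := (forLoop 20 (assign1 13 (rd 20) (rd1 6 (rd 20)))).run I s with hs₁
  have hfr : Frame _ s s₁ := run_frame I _ s
  have h1 : ∀ x < n + n, s₁.nat 13 0 x = s.nat 6 0 x := by
    refine run_forLoop (I := I) (fun k t => ∀ x < k, t.nat 13 0 x = s.nat 6 0 x) (by simp) ?_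
    intro k hk t htk hfr hI y hy
    simp only [put_nat, run_assign1_nat, eval_rd, htk, eval_rd1]
    by_cases h : y = k
    · simp [h, hfr.nat 6 rfl]
    · simp [h, hI y (by omega)]
  have e1 := ho s₁ (hfr.nat 21 rfl) (hfr.nat 22 rfl)
  have e2 := hi ((assign1 13 out (.const 0)).run I s₁)
    ((run_frame I (assign1 13 out (.const 0)) s₁).nat 21 rfl |>.trans (hfr.nat 21 rfl))
    ((run_frame I (assign1 13 out (.const 0)) s₁).nat 22 rfl |>.trans (hfr.nat 22 rfl))
  simp only [run_assign1_nat (n := n), e2, e1, eval_const, h1 x x.2, true_and, ← Fin.ext_iff]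
  by_cases hxv : x = v
  · simp [hxv]
  · by_cases hxu : x = u
    · simp [hxu, hne]
    · simp [hxv, hxu, hA]

theorem run_arcTest (hs : Setup φ₁ φ₂ A c g s) (hU : ∀ x : Fin (n + n), s.nat 7 0 x = 1 ↔ x ∈ U)
    (hA : IsCommonBase (I.M₁.comap φ₁) (I.M₂.comap φ₂) A) {u v : Fin (n + n)}
    (hu : s.nat 21 0 0 = u) (hv : s.nat 22 0 0 = v) :
    (arcTest.run I s).nat 3 0 0 = 1 ↔ arcIn (I.M₁.comap φ₁) (I.M₂.comap φ₂) A U u v := by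
  -- A single exchange preserves the cardinality, so independence already makes the result a basis
  -- and the oracle suffices.
  have key : ∀ {N : Matroid (Fin (n + n))} (a b : Fin (n + n)), N.IsBase A → a ∈ A → b ∉ A →
      (N.Indep (insert b (A.erase a) : Finset _) ↔ N.IsBase (insert b (A.erase a) : Finset _)) := by
    intro N a b hN ha hb
    refine ⟨fun h => ?_, fun h => h.indep⟩
    push_cast at h ⊢
    exact hN.exchange_isBase_of_indep (by simpa using hb) h
  unfold arcIn exchangeArc
  by_cases h0 : u ∈ U ∧ v ∈ U
  · rw [arcTest, run_cond_pos (by simpa [Test.Holds, hu, hv, hU] using h0)]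
    by_cases h1 : u ∈ A ∧ v ∉ A
    · rw [run_cond_pos (by simpa [Test.Holds, hu, hv, hs.mask] using h1), run_seq]
      have hne : u ≠ v := fun h => h1.2 (h ▸ h1.1)
      have hfr := run_frame I (loadExchange (rd 21) (rd 22)) s
      rw [run_indepTest (M := I.M₁) (φ := φ₁) (S := insert v (A.erase u))
        (fun t => by simp [Test.Holds]) (by norm_num)
        (fun x => by rw [hfr.nat 31 rfl]; exact hs.map₁ x)
        (run_loadExchange hne hs.mask (fun t h _ => by rw [eval_rd, h, hu])
          (fun t _ h => by rw [eval_rd, h, hv])), key u v hA.1 h1.1 h1.2]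
      simp [h0, h1]
    · rw [run_cond_neg (by simpa [Test.Holds, hu, hv, hs.mask] using h1)]
      by_cases h2 : u ∉ A ∧ v ∈ A
      · rw [run_cond_pos (by simpa [Test.Holds, hu, hv, hs.mask] using h2), run_seq]
        have hne : v ≠ u := fun h => h2.1 (h ▸ h2.2)
        have hfr := run_frame I (loadExchange (rd 22) (rd 21)) s
        rw [run_indepTest (M := I.M₂) (φ := φ₂) (S := insert u (A.erase v))
          (fun t => by simp [Test.Holds]) (by norm_num)
          (fun x => by rw [hfr.nat 32 rfl]; exact hs.map₂ x)
          (run_loadExchange hne hs.mask (fun t _ h => by rw [eval_rd, h, hv])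
            (fun t h _ => by rw [eval_rd, h, hu])), key v u hA.2 h2.2 h2.1]
        simp [h0, h2]
      · rw [run_cond_neg (by simpa [Test.Holds, hu, hv, hs.mask] using h2)]
        simp only [run_assign_nat, eval_const]
        simp only [and_self, if_true, zero_ne_one, false_iff]
        tauto
  · rw [arcTest, run_cond_neg (by simpa [Test.Holds, hu, hv, hU] using h0)]
    simp only [run_assign_nat, eval_const]
    simp only [and_self, if_true, zero_ne_one, false_iff]
    tauto

/-- The entries of the six matrices. -/
def entry (t : Store Γ) (i j : ℕ) : ℕ × ℕ × ℝ × ℝ × Γ × Γ :=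
  (t.nat 8 i j, t.nat 9 i j, t.real 1 i j, t.real 2 i j, t.grp 1 i j, t.grp 2 i j)

/-- The entry of the matrices at `u`, `v` describes the arc from `u` to `v`. -/
structure GoodEntry (r : Fin (n + n) → Fin (n + n) → Prop) (c : Fin (n + n) → ℝ)
    (g : Fin (n + n) → Γ) (u v : Fin (n + n)) (e : ℕ × ℕ × ℝ × ℝ × Γ × Γ) : Prop where
  adj : e.1 = 1 ↔ u = v ∨ r u v
  adj_eq : e.2.1 = e.1
  cost : e.2.2.1 = if u = v then 0 else c v
  cost_eq : e.2.2.2.1 = e.2.2.1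
  label : e.2.2.2.2.1 = if u = v then 0 else g v
  label_eq : e.2.2.2.2.2 = e.2.2.2.2.1

theorem run_initCell (hs : Setup φ₁ φ₂ A c g s) (hU : ∀ x : Fin (n + n), s.nat 7 0 x = 1 ↔ x ∈ U)
    (hA : IsCommonBase (I.M₁.comap φ₁) (I.M₂.comap φ₂) A) {u v : Fin (n + n)}
    (hu : s.nat 21 0 0 = u) (hv : s.nat 22 0 0 = v) :
    GoodEntry (arcIn (I.M₁.comap φ₁) (I.M₂.comap φ₂) A U) c g u v
      (entry (initCell.run I s) u v) ∧
    ∀ i j : ℕ, ¬ (i = u ∧ j = v) → entry (initCell.run I s) i j = entry s i j := by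
  rw [initCell, run_seq]
  have hsplit : ∀ s₁ : Store Γ, s₁.nat 21 0 0 = u → s₁.nat 22 0 0 = v → ∀ i j : ℕ,
      entry ((seq (.setNat 9 (rd 21) (rd 22) (rd2 8 21 22)) <|
        seq (.setReal 2 (rd 21) (rd 22) (.get 1 (rd 21) (rd 22)))
          (.setGrp 2 (rd 21) (rd 22) (.get 1 (rd 21) (rd 22)))).run I s₁) i j =
      if i = u ∧ j = v then (s₁.nat 8 i j, s₁.nat 8 i j, s₁.real 1 i j, s₁.real 1 i j,
        s₁.grp 1 i j, s₁.grp 1 i j) else entry s₁ i j := by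
    intro s₁ h1 h2 i j
    simp only [entry, run_seq, run_setGrp_grp, run_setReal_real, run_setNat_nat, run_setNat_real,
      run_setNat_grp, run_setReal_nat, run_setReal_grp, run_setGrp_nat, run_setGrp_real, eval_rd,
      eval_rd2, RealExpr.eval, GrpExpr.eval, h1, h2]
    by_cases h : i = u ∧ j = v
    · simp [h]
    · simp [h]
  -- The diagonal counts as an empty step with cost and label zero. It lets the scan treat closed
  -- walks made of two selected walks, without an arc in between, as a special case.
  by_cases huv : u = v
  · rw [run_cond_pos (by simp [Test.Holds, hu, hv, huv])]
    set s₁ := (seq (.setNat 8 (rd 21) (rd 22) (.const 1)) <|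
      seq (.setReal 1 (rd 21) (rd 22) .zero) (.setGrp 1 (rd 21) (rd 22) .zero)).run I s with hs₁
    have hfr : Frame _ s s₁ := run_frame I _ s
    have h1 : s₁.nat 21 0 0 = u := by rw [hfr.nat 21 rfl, hu]
    have h2 : s₁.nat 22 0 0 = v := by rw [hfr.nat 22 rfl, hv]
    have hval : ∀ i j : ℕ, s₁.nat 8 i j = (if i = u ∧ j = v then 1 else s.nat 8 i j) ∧
        s₁.real 1 i j = (if i = u ∧ j = v then 0 else s.real 1 i j) ∧
        s₁.grp 1 i j = (if i = u ∧ j = v then 0 else s.grp 1 i j) := by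
      intro i j
      simp [hs₁, run_seq, run_setGrp_grp, run_setReal_real, run_setNat_nat, hu, hv,
        RealExpr.eval, GrpExpr.eval]
    refine ⟨?_, fun i j hij => ?_⟩
    · rw [hsplit s₁ h1 h2, if_pos ⟨rfl, rfl⟩]
      obtain ⟨e1, e2, e3⟩ := hval u v
      rw [if_pos ⟨rfl, rfl⟩] at e1 e2 e3
      subst huv
      constructor <;> simp [e1, e2, e3]
    · rw [hsplit s₁ h1 h2, if_neg hij]
      obtain ⟨e1, e2, e3⟩ := hval i j
      rw [if_neg hij] at e1 e2 e3
      simp only [entry, e1, e2, e3, hfr.nat 9 rfl, hfr.real 2 rfl, hfr.grp 2 rfl]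
  · rw [run_cond_neg (by simpa [Test.Holds, hu, hv, ← Fin.ext_iff] using huv)]
    set s₁ := (seq arcTest <| seq (.setNat 8 (rd 21) (rd 22) (rd 3)) <|
      seq (.setReal 1 (rd 21) (rd 22) (.get 0 (.const 0) (rd 22)))
        (.setGrp 1 (rd 21) (rd 22) (.get 0 (.const 0) (rd 22)))).run I s with hs₁
    have hfr : Frame _ s s₁ := run_frame I _ s
    have h1 : s₁.nat 21 0 0 = u := by rw [hfr.nat 21 rfl, hu]
    have h2 : s₁.nat 22 0 0 = v := by rw [hfr.nat 22 rfl, hv]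
    have harc := run_arcTest hs hU hA hu hv
    set s₂ := arcTest.run I s with hs₂
    have hfr2 : Frame arcTest s s₂ := run_frame I _ s
    have hval : ∀ i j : ℕ, s₁.nat 8 i j = (if i = u ∧ j = v then s₂.nat 3 0 0 else s.nat 8 i j) ∧
        s₁.real 1 i j = (if i = u ∧ j = v then c v else s.real 1 i j) ∧
        s₁.grp 1 i j = (if i = u ∧ j = v then g v else s.grp 1 i j) := by
      intro i j
      have a1 : s₂.nat 21 0 0 = u := by rw [hfr2.nat 21 rfl, hu]
      have a2 : s₂.nat 22 0 0 = v := by rw [hfr2.nat 22 rfl, hv]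
      simp [hs₁, run_seq, run_setGrp_grp, run_setReal_real, run_setNat_nat,
        RealExpr.eval, GrpExpr.eval, ← hs₂, a1, a2, hfr2.nat 8 rfl, hfr2.real 1 rfl,
        hfr2.grp 1 rfl, hfr2.real 0 rfl, hfr2.grp 0 rfl, hs.cost, hs.label]
    refine ⟨?_, fun i j hij => ?_⟩
    · rw [hsplit s₁ h1 h2, if_pos ⟨rfl, rfl⟩]
      obtain ⟨e1, e2, e3⟩ := hval u v
      rw [if_pos ⟨rfl, rfl⟩] at e1 e2 e3
      constructor <;> simp [e1, e2, e3, huv, harc]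
    · rw [hsplit s₁ h1 h2, if_neg hij]
      obtain ⟨e1, e2, e3⟩ := hval i j
      rw [if_neg hij] at e1 e2 e3
      simp only [entry, e1, e2, e3, hfr.nat 9 rfl, hfr.real 2 rfl, hfr.grp 2 rfl]

omit [AddCommGroup Γ] in
theorem entry_put {t : Store Γ} {a k : ℕ} (ha : 10 ≤ a) : entry (t.put a k) = entry t := by
  funext i j
  simp only [entry, put_nat, put_real, put_grp]
  rw [if_neg (by omega), if_neg (by omega)]

theorem run_initMatrix (hs : Setup φ₁ φ₂ A c g s)
    (hU : ∀ x : Fin (n + n), s.nat 7 0 x = 1 ↔ x ∈ U)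
    (hA : IsCommonBase (I.M₁.comap φ₁) (I.M₂.comap φ₂) A) (u v : Fin (n + n)) :
    GoodEntry (arcIn (I.M₁.comap φ₁) (I.M₂.comap φ₂) A U) c g u v
      (entry (initMatrix.run I s) u v) := by
  have main : ∀ u v : Fin (n + n), (u : ℕ) < n + n →
      GoodEntry (arcIn (I.M₁.comap φ₁) (I.M₂.comap φ₂) A U) c g u v
        (entry (initMatrix.run I s) u v) := by
    refine run_forLoop (I := I) (fun k t => ∀ u v : Fin (n + n), (u : ℕ) < k →
      GoodEntry (arcIn (I.M₁.comap φ₁) (I.M₂.comap φ₂) A U) c g u v (entry t u v)) (by simp) ?_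
    intro k hk t htk hfr hI
    have hst : Setup φ₁ φ₂ A c g t := hs.congr (hfr.nat 31 rfl) (hfr.nat 32 rfl) (hfr.nat 6 rfl)
      (hfr.real 0 rfl) (hfr.grp 0 rfl)
    have inner : (∀ v : Fin (n + n), (v : ℕ) < n + n →
        GoodEntry (arcIn (I.M₁.comap φ₁) (I.M₂.comap φ₂) A U) c g ⟨k, hk⟩ v
          (entry ((forLoop 22 initCell).run I t) k v)) ∧
        ∀ i j : ℕ, i ≠ k → entry ((forLoop 22 initCell).run I t) i j = entry t i j := by
      refine run_forLoop (I := I) (fun l t' => (∀ v : Fin (n + n), (v : ℕ) < l →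
        GoodEntry (arcIn (I.M₁.comap φ₁) (I.M₂.comap φ₂) A U) c g ⟨k, hk⟩ v
          (entry t' k v)) ∧ ∀ i j : ℕ, i ≠ k → entry t' i j = entry t i j) ?_ ?_
      · rw [entry_put (by norm_num)]; simp
      · rintro l hl t' htl hfr' ⟨hI1, hI2⟩
        have hst' : Setup φ₁ φ₂ A c g t' := hst.congr (hfr'.nat 31 rfl) (hfr'.nat 32 rfl)
          (hfr'.nat 6 rfl) (hfr'.real 0 rfl) (hfr'.grp 0 rfl)
        obtain ⟨h1, h2⟩ := run_initCell (I := I) (u := ⟨k, hk⟩) (v := ⟨l, hl⟩) hst'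
          (fun x => by rw [hfr'.nat 7 rfl, hfr.nat 7 rfl]; exact hU x) hA
          (by rw [hfr'.nat 21 rfl, htk]) htl
        rw [entry_put (by norm_num)]
        refine ⟨fun v hv => ?_, fun i j hij => ?_⟩
        · rcases Nat.lt_succ_iff_lt_or_eq.1 hv with h | h
          · rw [h2 k v (by simp only [not_and]; omega)]
            exact hI1 v h
          · have : v = ⟨l, hl⟩ := Fin.ext h
            rw [this]; exact h1
        · rw [h2 i j (fun h => hij h.1)]
          exact hI2 i j hij
    intro u v hu
    rw [entry_put (by norm_num)]
    rcases Nat.lt_succ_iff_lt_or_eq.1 hu with h | h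
    · rw [inner.2 u v (by omega)]
      exact hI u v h
    · have : u = ⟨k, hk⟩ := Fin.ext h
      rw [this]; exact inner.1 v v.2
  exact main u v u.2

end Cmd

end ArcMatrix

/-! ### Shortest walks between all pairs, and cheapest closed walks. -/

section ShortestWalks

namespace Cmd

/-- Try to shorten the walk between the vertices in the variables `21` and `22` by a walk whose
last arc leaves the vertex in variable `23`. -/
def relaxCell : Cmd :=
  cond (.and (isOne (rd2 9 21 23)) (.and (isOne (rd2 8 23 22)) (.not (.and (isOne (rd2 9 21 22))
      (.realLe (.get 2 (rd 21) (rd 22))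
        (.add (.get 2 (rd 21) (rd 23)) (.get 1 (rd 23) (rd 22))))))))
    (seq (.setNat 9 (rd 21) (rd 22) (.const 1)) <|
      seq (.setGrp 2 (rd 21) (rd 22) (.add (.get 2 (rd 21) (rd 23)) (.get 1 (rd 23) (rd 22))))
        (.setReal 2 (rd 21) (rd 22) (.add (.get 2 (rd 21) (rd 23)) (.get 1 (rd 23) (rd 22)))))
    skip

def relaxRound : Cmd := forLoop 21 (forLoop 22 (forLoop 23 relaxCell))

/-- Compute shortest walks between all pairs of vertices. -/
def relax : Cmd := forLoop 24 relaxRound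

/-- The weight of the closed walk that passes from the vertex in variable `25` via the vertices in
the variables `21` and `22`. -/
def closedWeight : RealExpr :=
  .add (.add (.get 2 (rd 25) (rd 21)) (.get 1 (rd 21) (rd 22))) (.get 2 (rd 22) (rd 25))

def closedLabel : GrpExpr :=
  .add (.add (.get 2 (rd 25) (rd 21)) (.get 1 (rd 21) (rd 22))) (.get 2 (rd 22) (rd 25))

def scanCell (F : Test) : Cmd :=
  cond (.and (isOne (rd2 9 25 21)) (.and (isOne (rd2 8 21 22)) (.and (isOne (rd2 9 22 25)) (.and F
      (.not (.and (isOne (rd 10)) (.realLe (.get 3 (.const 0) (.const 0)) closedWeight)))))))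
    (seq (assign 10 (.const 1)) (.setReal 3 (.const 0) (.const 0) closedWeight)) skip

/-- Find the cheapest closed walk that passes the filter `F`. -/
def scan (F : Test) : Cmd :=
  seq (assign 10 (.const 0)) (forLoop 25 (forLoop 21 (forLoop 22 (scanCell F))))

variable {Γ : Type*} [AddCommGroup Γ] {n : ℕ} {I : Input Γ n}
  {r : Fin (n + n) → Fin (n + n) → Prop} {c : Fin (n + n) → ℝ} {g : Fin (n + n) → Γ}

/-- The entries of the matrices describe the arcs of `r`, and walks of `r`. -/
structure WalkMatrix (r : Fin (n + n) → Fin (n + n) → Prop) (c : Fin (n + n) → ℝ)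
    (g : Fin (n + n) → Γ) (t : Store Γ) : Prop where
  adj : ∀ u v : Fin (n + n), t.nat 8 u v = 1 ↔ u = v ∨ r u v
  cost : ∀ u v : Fin (n + n), t.real 1 u v = if u = v then 0 else c v
  label : ∀ u v : Fin (n + n), t.grp 1 u v = if u = v then 0 else g v
  walk : ∀ u v : Fin (n + n), t.nat 9 u v = 1 → ∃ k m, Walk r k u v m ∧
    t.real 2 u v = (m.map c).sum ∧ t.grp 2 u v = (m.map g).sum

theorem WalkMatrix.put {t : Store Γ} (h : WalkMatrix r c g t) {a k : ℕ} (ha : 10 ≤ a) :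
    WalkMatrix r c g (t.put a k) := by
  have e : ∀ b i j, b < 10 → (t.put a k).nat b i j = t.nat b i j := by
    intro b i j hb
    rw [put_nat, if_neg (by omega)]
  refine ⟨fun u v => ?_, h.cost, h.label, fun u v => ?_⟩
  · rw [e _ _ _ (by norm_num)]; exact h.adj u v
  · rw [e _ _ _ (by norm_num)]; exact h.walk u v

/-- The walks in `t'` are at least as short as those in `t`. -/
def Shorter (t t' : Store Γ) : Prop :=
  ∀ u v : Fin (n + n), t.nat 9 u v = 1 → t'.nat 9 u v = 1 ∧ t'.real 2 u v ≤ t.real 2 u v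

omit [AddCommGroup Γ] in
theorem shorter_put (t : Store Γ) {a : ℕ} (k : ℕ) (ha : 10 ≤ a) :
    Shorter (n := n) t (t.put a k) := by
  intro u v h
  rw [put_nat, if_neg (by omega)]
  exact ⟨h, le_rfl⟩

omit [AddCommGroup Γ] in
theorem Shorter.trans {t t' t'' : Store Γ} (h : Shorter (n := n) t t')
    (h' : Shorter (n := n) t' t'') : Shorter (n := n) t t'' := fun u v huv =>
  ⟨(h' u v (h u v huv).1).1, (h' u v (h u v huv).1).2.trans (h u v huv).2⟩

/-- The walk from `u` to `v` in `t` is at least as short as the walk to `x` in `s`, followed by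
the arc to `v`. -/
def Relaxed (s : Store Γ) (c : Fin (n + n) → ℝ) (u v x : Fin (n + n)) (t : Store Γ) : Prop :=
  s.nat 9 u x = 1 → s.nat 8 x v = 1 → x ≠ v → t.nat 9 u v = 1 ∧ t.real 2 u v ≤ s.real 2 u x + c v

omit [AddCommGroup Γ] in
theorem Relaxed.mono {s t t' : Store Γ} {u v x : Fin (n + n)} (h : Relaxed s c u v x t)
    (h' : Shorter (n := n) t t') : Relaxed s c u v x t' := fun h1 h2 h3 =>
  ⟨(h' u v (h h1 h2 h3).1).1, (h' u v (h h1 h2 h3).1).2.trans (h h1 h2 h3).2⟩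

/-- The state `s` is that at the beginning of the round, `t` the current one. Updates happen in
place, but entries only improve, so relaxing with the current entries is at least as good as with
those of `s`. Cost and label are updated together and always belong to one and the same walk. -/
theorem run_relaxCell {s t : Store Γ} (h8 : t.nat 8 = s.nat 8) (hst : Shorter (n := n) s t)
    (ht : WalkMatrix r c g t) {u v x : Fin (n + n)} (hu : t.nat 21 0 0 = u)
    (hv : t.nat 22 0 0 = v) (hx : t.nat 23 0 0 = x) :
    WalkMatrix r c g (relaxCell.run I t) ∧ Shorter (n := n) t (relaxCell.run I t) ∧
      Relaxed s c u v x (relaxCell.run I t) := by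
  by_cases hc : t.nat 9 u x = 1 ∧ t.nat 8 x v = 1 ∧
      ¬ (t.nat 9 u v = 1 ∧ t.real 2 u v ≤ t.real 2 u x + t.real 1 x v)
  · rw [relaxCell, run_cond_pos (by simpa [Test.Holds, RealExpr.eval, hu, hv, hx] using hc)]
    set t' := (seq (.setNat 9 (rd 21) (rd 22) (.const 1)) <|
      seq (.setGrp 2 (rd 21) (rd 22) (.add (.get 2 (rd 21) (rd 23)) (.get 1 (rd 23) (rd 22))))
        (.setReal 2 (rd 21) (rd 22)
          (.add (.get 2 (rd 21) (rd 23)) (.get 1 (rd 23) (rd 22))))).run I t with ht'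
    have hfr : Frame _ t t' := run_frame I _ t
    have e1 : ∀ i j : ℕ, t'.nat 9 i j = if i = u ∧ j = v then 1 else t.nat 9 i j := by
      intro i j
      simp [ht', run_seq, run_setNat_nat, hu, hv]
    have e2 : ∀ i j : ℕ, t'.real 2 i j =
        if i = u ∧ j = v then t.real 2 u x + t.real 1 x v else t.real 2 i j := by
      intro i j
      simp [ht', run_seq, run_setNat_nat, run_setReal_real, RealExpr.eval, hu, hv, hx]
    have e3 : ∀ i j : ℕ, t'.grp 2 i j =
        if i = u ∧ j = v then t.grp 2 u x + t.grp 1 x v else t.grp 2 i j := by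
      intro i j
      simp [ht', run_seq, run_setNat_nat, run_setGrp_grp, GrpExpr.eval, hu, hv, hx]
    refine ⟨⟨?_, ?_, ?_, ?_⟩, ?_, ?_⟩
    · rw [hfr.nat 8 rfl]; exact ht.adj
    · rw [hfr.real 1 rfl]; exact ht.cost
    · rw [hfr.grp 1 rfl]; exact ht.label
    · intro i j hij
      rw [e2, e3]
      by_cases h : (i : ℕ) = u ∧ (j : ℕ) = v
      · rw [if_pos h, if_pos h]
        obtain ⟨k, m, hw, hc', hl⟩ := ht.walk u x hc.1
        have hi : i = u := Fin.ext h.1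
        have hj : j = v := Fin.ext h.2
        subst hi hj
        -- A diagonal entry appends nothing, so the old walk itself is the witness.
        by_cases hxv : x = j
        · subst hxv
          exact ⟨k, m, hw, by simp [ht.cost, hc'], by simp [ht.label, hl]⟩
        · refine ⟨k + 1, _, hw.snoc (((ht.adj x j).1 hc.2.1).resolve_left hxv), ?_, ?_⟩
          · simp [ht.cost, hxv, hc', add_comm]
          · simp [ht.label, hxv, hl, add_comm]
      · rw [if_neg h, if_neg h]
        rw [e1, if_neg h] at hij
        exact ht.walk i j hij
    · intro i j hij
      rw [e1, e2]
      by_cases h : (i : ℕ) = u ∧ (j : ℕ) = v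
      · rw [if_pos h, if_pos h]
        rw [h.1, h.2] at hij ⊢
        have := hc.2.2
        push Not at this
        exact ⟨rfl, (this hij).le⟩
      · rw [if_neg h, if_neg h]
        exact ⟨hij, le_rfl⟩
    · intro h1 h2 h3
      rw [e1, e2, if_pos ⟨rfl, rfl⟩, if_pos ⟨rfl, rfl⟩, ht.cost, if_neg h3]
      exact ⟨rfl, by linarith [(hst u x h1).2]⟩
  · rw [relaxCell, run_cond_neg (by simpa [Test.Holds, RealExpr.eval, hu, hv, hx] using hc)]
    refine ⟨ht, fun i j h => ⟨h, le_rfl⟩, fun h1 h2 h3 => ?_⟩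
    obtain ⟨h4, h5⟩ := hst u x h1
    rw [run_skip]
    have : t.nat 9 u v = 1 ∧ t.real 2 u v ≤ t.real 2 u x + t.real 1 x v := by
      by_contra h
      exact hc ⟨h4, by rwa [h8], h⟩
    rw [ht.cost, if_neg h3] at this
    exact ⟨this.1, by linarith⟩

theorem run_relaxRound {s : Store Γ} (hs : WalkMatrix r c g s) :
    WalkMatrix r c g (relaxRound.run I s) ∧ Shorter (n := n) s (relaxRound.run I s) ∧
      ∀ u v x, Relaxed s c u v x (relaxRound.run I s) := by
  have h1 := run_forLoop_mono (I := I) (a := 21) (P := forLoop 22 (forLoop 23 relaxCell)) (s := s)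
    (WalkMatrix r c g) (Shorter (n := n))
    (fun k t => ∀ u v x : Fin (n + n), (u : ℕ) = k → Relaxed s c u v x t)
    (fun t k h => h.put (by norm_num)) (fun t k => shorter_put t k (by norm_num))
    (fun _ _ _ => Shorter.trans) (fun k t t' h h' u v x hu => (h u v x hu).mono h') hs ?_
  · exact ⟨h1.1, h1.2.1, fun u v x => h1.2.2 u u.2 u v x rfl⟩
  intro k hk t htk hfr hst ht
  have h2 := run_forLoop_mono (I := I) (a := 22) (P := forLoop 23 relaxCell) (s := t)
    (WalkMatrix r c g) (Shorter (n := n))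
    (fun l t => ∀ u v x : Fin (n + n), (u : ℕ) = k → (v : ℕ) = l → Relaxed s c u v x t)
    (fun t k h => h.put (by norm_num)) (fun t k => shorter_put t k (by norm_num))
    (fun _ _ _ => Shorter.trans) (fun k t t' h h' u v x hu hv => (h u v x hu hv).mono h') ht ?_
  · exact ⟨h2.1, h2.2.1, fun u v x hu => h2.2.2 v v.2 u v x hu rfl⟩
  intro l hl t' htl hfr' hst' ht'
  have h3 := run_forLoop_mono (I := I) (a := 23) (P := relaxCell) (s := t')
    (WalkMatrix r c g) (Shorter (n := n))
    (fun j t => ∀ u v x : Fin (n + n), (u : ℕ) = k → (v : ℕ) = l → (x : ℕ) = j →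
      Relaxed s c u v x t)
    (fun t k h => h.put (by norm_num)) (fun t k => shorter_put t k (by norm_num))
    (fun _ _ _ => Shorter.trans)
    (fun k t t' h h' u v x hu hv hx => (h u v x hu hv hx).mono h') ht' ?_
  · exact ⟨h3.1, h3.2.1, fun u v x hu hv => h3.2.2 x x.2 u v x hu hv rfl⟩
  intro j hj t'' htj hfr'' hst'' ht''
  have h4 := run_relaxCell (I := I) (s := s) (t := t'') (r := r) (c := c) (g := g)
    (u := ⟨k, hk⟩) (v := ⟨l, hl⟩) (x := ⟨j, hj⟩)
    (by rw [hfr''.nat 8 rfl, hfr'.nat 8 rfl, hfr.nat 8 rfl]) ((hst.trans hst').trans hst'') ht''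
    (by rw [hfr''.nat 21 rfl, hfr'.nat 21 rfl, htk]) (by rw [hfr''.nat 22 rfl, htl]) htj
  refine ⟨h4.1, h4.2.1, fun u v x hu hv hx => ?_⟩
  have e1 : u = ⟨k, hk⟩ := Fin.ext hu
  have e2 : v = ⟨l, hl⟩ := Fin.ext hv
  have e3 : x = ⟨j, hj⟩ := Fin.ext hx
  rw [e1, e2, e3]
  exact h4.2.2

/-- After `K` rounds the entries are at least as good as all walks with at most `K + 1` arcs; the
initial matrices already account for one arc. No assumption on the signs of cycles is needed, since
the number of arcs is bounded. -/
theorem run_relax (hirr : ∀ v, ¬ r v v) {s : Store Γ} (hs : WalkMatrix r c g s)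
    (h9 : ∀ u v : Fin (n + n), s.nat 9 u v = s.nat 8 u v)
    (h2 : ∀ u v : Fin (n + n), s.real 2 u v = s.real 1 u v) :
    WalkMatrix r c g (relax.run I s) ∧
      ∀ k u v m, k ≤ n + n → Walk r k u v m →
        (relax.run I s).nat 9 u v = 1 ∧ (relax.run I s).real 2 u v ≤ (m.map c).sum := by
  have main : WalkMatrix r c g (relax.run I s) ∧ ∀ k u v m, k ≤ n + n + 1 → Walk r k u v m →
      (relax.run I s).nat 9 u v = 1 ∧ (relax.run I s).real 2 u v ≤ (m.map c).sum := by
    refine run_forLoop (I := I) (fun K t => WalkMatrix r c g t ∧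
      ∀ k u v m, k ≤ K + 1 → Walk r k u v m →
        t.nat 9 u v = 1 ∧ t.real 2 u v ≤ (m.map c).sum) ⟨hs.put (by norm_num), ?_⟩ ?_
    · intro k u v m hk hw
      rw [put_nat, if_neg (by omega), put_real, h9, h2, hs.adj, hs.cost]
      cases hw with
      | nil => simp
      | @snoc k _ x _ m hw hr =>
        have : k = 0 := by omega
        subst this
        cases hw
        have hne : u ≠ v := fun h => hirr v (h ▸ hr)
        simp [hne, hr]
    · rintro K hK t htK hfr ⟨hwm, hI⟩
      obtain ⟨a1, a2, a3⟩ := run_relaxRound (I := I) hwm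
      refine ⟨a1.put (by norm_num), fun k u v m hk hw => ?_⟩
      rw [put_nat, if_neg (by omega), put_real]
      rcases Nat.lt_or_ge k (K + 2) with h | h
      · obtain ⟨b1, b2⟩ := hI k u v m (by omega) hw
        exact ⟨(a2 u v b1).1, (a2 u v b1).2.trans b2⟩
      · cases hw with
        | nil => omega
        | @snoc k _ x _ m hw hr =>
          obtain ⟨b1, b2⟩ := hI k u x m (by omega) hw
          have hne : x ≠ v := fun h => hirr v (h ▸ hr)
          obtain ⟨b3, b4⟩ := a3 u v x b1 ((hwm.adj x v).2 (Or.inr hr)) hne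
          refine ⟨b3, b4.trans ?_⟩
          rw [Multiset.map_cons, Multiset.sum_cons]
          linarith
  exact ⟨main.1, fun k u v m hk => main.2 k u v m (by omega)⟩

/-- The filter `F` selects the triples of vertices in `P`, if the arrays it looks at are as
in `s`. -/
def Selects (I : Input Γ n) (F : Test) (P : Fin (n + n) → Fin (n + n) → Fin (n + n) → Prop)
    (s : Store Γ) : Prop :=
  ∀ (t : Store Γ) (x u v : Fin (n + n)), t.nat 12 = s.nat 12 → t.grp = s.grp →
    t.nat 25 0 0 = x → t.nat 21 0 0 = u → t.nat 22 0 0 = v → (F.Holds I t ↔ P x u v)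

/-- The variables `10` and `3` hold the best value so far. `Inv` says that it is attained by a
selected triple, `R` that it never gets worse, and `G` that a given triple has been taken into
account. -/
theorem run_scan {F : Test} {P : Fin (n + n) → Fin (n + n) → Fin (n + n) → Prop} {s : Store Γ}
    (hF : Selects I F P s) :
    let s' := (scan F).run I s
    let Q := fun x u v : Fin (n + n) =>
      s.nat 9 x u = 1 ∧ s.nat 8 u v = 1 ∧ s.nat 9 v x = 1 ∧ P x u v
    let val := fun x u v : Fin (n + n) => s.real 2 x u + s.real 1 u v + s.real 2 v x
    (s'.nat 10 0 0 = 0 ∨ s'.nat 10 0 0 = 1 ∧ ∃ x u v, Q x u v ∧ s'.real 3 0 0 = val x u v) ∧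
    ∀ x u v, Q x u v → s'.nat 10 0 0 = 1 ∧ s'.real 3 0 0 ≤ val x u v := by
  intro s' Q val
  let Inv : Store Γ → Prop := fun t =>
    (t.nat 8 = s.nat 8 ∧ t.nat 9 = s.nat 9 ∧ t.nat 12 = s.nat 12 ∧ t.grp = s.grp ∧
      t.real 1 = s.real 1 ∧ t.real 2 = s.real 2) ∧
    (t.nat 10 0 0 = 0 ∨ t.nat 10 0 0 = 1 ∧ ∃ x u v, Q x u v ∧ t.real 3 0 0 = val x u v)
  let R : Store Γ → Store Γ → Prop := fun t t' =>
    t.nat 10 0 0 = 1 → t'.nat 10 0 0 = 1 ∧ t'.real 3 0 0 ≤ t.real 3 0 0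
  let G : Fin (n + n) → Fin (n + n) → Fin (n + n) → Store Γ → Prop := fun x u v t =>
    Q x u v → t.nat 10 0 0 = 1 ∧ t.real 3 0 0 ≤ val x u v
  have hput : ∀ (t : Store Γ) (a k : ℕ), 20 ≤ a → Inv t → Inv (t.put a k) := by
    intro t a k ha h
    have e : ∀ b, b < 20 → (t.put a k).nat b = t.nat b := by
      intro b hb
      funext i j
      rw [put_nat, if_neg (by omega)]
    simp only [Inv, put_real, put_grp]
    rw [e 8 (by norm_num), e 9 (by norm_num), e 12 (by norm_num), e 10 (by norm_num)]
    exact h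
  have hRput : ∀ (t : Store Γ) (a k : ℕ), 20 ≤ a → R t (t.put a k) := by
    intro t a k ha h
    rw [put_nat, if_neg (by omega)]
    exact ⟨h, le_rfl⟩
  have hRtr : ∀ t t' t'' : Store Γ, R t t' → R t' t'' → R t t'' := fun t t' t'' h h' h1 =>
    ⟨(h' (h h1).1).1, (h' (h h1).1).2.trans (h h1).2⟩
  have hGmono : ∀ x u v (t t' : Store Γ), G x u v t → R t t' → G x u v t' :=
    fun x u v t t' h h' h1 => ⟨(h' (h h1).1).1, (h' (h h1).1).2.trans (h h1).2⟩
  have hcell : ∀ (t : Store Γ) (x u v : Fin (n + n)), Inv t → t.nat 25 0 0 = x →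
      t.nat 21 0 0 = u → t.nat 22 0 0 = v → Inv ((scanCell F).run I t) ∧
        R t ((scanCell F).run I t) ∧ G x u v ((scanCell F).run I t) := by
    rintro t x u v ⟨⟨i1, i2, i3, i4, i5, i6⟩, i7⟩ hx hu hv
    have hP := hF t x u v i3 i4 hx hu hv
    have hw : closedWeight.eval I t = val x u v := by
      simp [closedWeight, RealExpr.eval, hx, hu, hv, i5, i6, val]
    have hcond : (Test.and (isOne (rd2 9 25 21)) (.and (isOne (rd2 8 21 22))
        (.and (isOne (rd2 9 22 25)) (.and F (.not (.and (isOne (rd 10))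
          (.realLe (.get 3 (.const 0) (.const 0)) closedWeight))))))).Holds I t ↔
        Q x u v ∧ ¬ (t.nat 10 0 0 = 1 ∧ t.real 3 0 0 ≤ val x u v) := by
      simp only [Test.Holds, hP, hw, holds_isOne, eval_rd2, eval_rd, hx, hu, hv, i1, i2, Q,
        RealExpr.eval, eval_const]
      tauto
    by_cases hc : Q x u v ∧ ¬ (t.nat 10 0 0 = 1 ∧ t.real 3 0 0 ≤ val x u v)
    · rw [scanCell, run_cond_pos (hcond.2 hc)]
      set t' := (seq (assign 10 (.const 1))
        (.setReal 3 (.const 0) (.const 0) closedWeight)).run I t with ht'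
      have hfr : Frame _ t t' := run_frame I _ t
      have e1 : t'.nat 10 0 0 = 1 := by simp [ht', run_seq, run_assign_nat]
      have e2 : t'.real 3 0 0 = val x u v := by
        have hw' : closedWeight.eval I ((assign 10 (.const 1)).run I t) = val x u v := by
          rw [← hw]
          simp [closedWeight, RealExpr.eval, assign]
          simp [run_setNat_nat]
        simp [ht', run_seq, run_setReal_real, hw']
      refine ⟨⟨⟨?_, ?_, ?_, ?_, ?_, ?_⟩, Or.inr ⟨e1, x, u, v, hc.1, e2⟩⟩, fun h => ?_,
        fun _ => ⟨e1, e2.le⟩⟩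
      · rw [hfr.nat 8 rfl, i1]
      · rw [hfr.nat 9 rfl, i2]
      · rw [hfr.nat 12 rfl, i3]
      · rw [← i4]; rfl
      · rw [hfr.real 1 rfl, i5]
      · rw [hfr.real 2 rfl, i6]
      · have := hc.2
        push Not at this
        exact ⟨e1, by rw [e2]; exact (this h).le⟩
    · rw [scanCell, run_cond_neg (mt hcond.1 hc), run_skip]
      refine ⟨⟨⟨i1, i2, i3, i4, i5, i6⟩, i7⟩, fun h => ⟨h, le_rfl⟩, fun hQ => ?_⟩
      by_contra h
      exact hc ⟨hQ, h⟩
  have h1 := run_forLoop_mono (I := I) (a := 25) (P := forLoop 21 (forLoop 22 (scanCell F)))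
    (s := (assign 10 (.const 0)).run I s) Inv R (fun k t => ∀ x u v : Fin (n + n), (x : ℕ) = k → G x u v t)
    (fun t k h => hput t _ k (by norm_num) h) (fun t k => hRput t _ k (by norm_num)) hRtr
    (fun k t t' h h' x u v hx => hGmono x u v t t' (h x u v hx) h') ?_ ?_
  · exact ⟨h1.1.2, fun x u v => h1.2.2 x x.2 x u v rfl⟩
  · have hfr := run_frame I (assign 10 (.const 0)) s
    exact ⟨⟨hfr.nat 8 rfl, hfr.nat 9 rfl, hfr.nat 12 rfl, rfl, rfl, rfl⟩,
      Or.inl (by simp [run_assign_nat])⟩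
  intro k hk t htk hfr hst ht
  have h2 := run_forLoop_mono (I := I) (a := 21) (P := forLoop 22 (scanCell F)) (s := t) Inv R
    (fun l t => ∀ x u v : Fin (n + n), (x : ℕ) = k → (u : ℕ) = l → G x u v t)
    (fun t k h => hput t _ k (by norm_num) h) (fun t k => hRput t _ k (by norm_num)) hRtr
    (fun k t t' h h' x u v hx hu => hGmono x u v t t' (h x u v hx hu) h') ht ?_
  · exact ⟨h2.1, h2.2.1, fun x u v hx => h2.2.2 u u.2 x u v hx rfl⟩
  intro l hl t' htl hfr' hst' ht'
  have h3 := run_forLoop_mono (I := I) (a := 22) (P := scanCell F) (s := t') Inv R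
    (fun j t => ∀ x u v : Fin (n + n), (x : ℕ) = k → (u : ℕ) = l → (v : ℕ) = j → G x u v t)
    (fun t k h => hput t _ k (by norm_num) h) (fun t k => hRput t _ k (by norm_num)) hRtr
    (fun k t t' h h' x u v hx hu hv => hGmono x u v t t' (h x u v hx hu hv) h') ht' ?_
  · exact ⟨h3.1, h3.2.1, fun x u v hx hu => h3.2.2 v v.2 x u v hx hu rfl⟩
  intro j hj t'' htj hfr'' hst'' ht''
  obtain ⟨h4, h5, h6⟩ := hcell t'' ⟨k, hk⟩ ⟨l, hl⟩ ⟨j, hj⟩ ht''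
    (by rw [hfr''.nat 25 rfl, hfr'.nat 25 rfl, htk]) (by rw [hfr''.nat 21 rfl, htl]) htj
  refine ⟨h4, h5, fun x u v hx hu hv => ?_⟩
  have e1 : x = ⟨k, hk⟩ := Fin.ext hx
  have e2 : u = ⟨l, hl⟩ := Fin.ext hu
  have e3 : v = ⟨j, hj⟩ := Fin.ext hv
  rw [e1, e2, e3]
  exact h6

end Cmd

end ShortestWalks

/-! ### Optimal cycle families from shortest walks. -/

section Engine

namespace Cmd

/-- Find the cheapest closed walk that passes the filter `F` in the exchange digraph restricted to
the set in array `7`; variable `10` tells whether there is one, and its cost is in variable `3`. -/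
def engine (F : Test) : Cmd := seq initMatrix (seq relax (scan F))

/-- Select walks through the vertex in variable `12`. -/
def throughFilter : Test :=
  .and (.natEq (rd 25) (rd 12)) (.and (.natEq (rd 22) (rd 12)) (.not (.natEq (rd 21) (rd 12))))

/-- Select walks with non-zero label. -/
def nonzeroFilter : Test := .not (.isZero closedLabel)

variable {Γ : Type*} [AddCommGroup Γ] {n : ℕ} {I : Input Γ n}
  {φ₁ φ₂ : Fin (n + n) → Fin n} {A U : Finset (Fin (n + n))} {c : Fin (n + n) → ℝ}
  {g : Fin (n + n) → Γ} {s : Store Γ} {r : Fin (n + n) → Fin (n + n) → Prop}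

/-- The variables `10` and `3` describe the minimum cost of a set with property `P` that is
covered by disjoint cycles of `r`. -/
def IsMinimum (r : Fin (n + n) → Fin (n + n) → Prop) (P : Finset (Fin (n + n)) → Prop)
    (c : Fin (n + n) → ℝ) (s : Store Γ) : Prop :=
  (s.nat 10 0 0 = 0 ∧ ∀ S, Covers r S → ¬ P S) ∨
  (s.nat 10 0 0 = 1 ∧ (∃ S, Covers r S ∧ P S ∧ ∑ v ∈ S, c v ≤ s.real 3 0 0) ∧
    ∀ S, Covers r S → P S → s.real 3 0 0 ≤ ∑ v ∈ S, c v)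

theorem run_matrices (hs : Setup φ₁ φ₂ A c g s)
    (hU : ∀ x : Fin (n + n), s.nat 7 0 x = 1 ↔ x ∈ U)
    (hA : IsCommonBase (I.M₁.comap φ₁) (I.M₂.comap φ₂) A) :
    WalkMatrix (arcIn (I.M₁.comap φ₁) (I.M₂.comap φ₂) A U) c g
        (relax.run I (initMatrix.run I s)) ∧
      ∀ k u v m, k ≤ n + n → Walk (arcIn (I.M₁.comap φ₁) (I.M₂.comap φ₂) A U) k u v m →
        (relax.run I (initMatrix.run I s)).nat 9 u v = 1 ∧
          (relax.run I (initMatrix.run I s)).real 2 u v ≤ (m.map c).sum := by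
  have hinit := run_initMatrix (I := I) hs hU hA
  set s₁ := initMatrix.run I s
  have hirr : ∀ v, ¬ arcIn (I.M₁.comap φ₁) (I.M₂.comap φ₂) A U v v := fun v h => h.2.2.ne rfl
  refine run_relax hirr ⟨fun u v => (hinit u v).adj, fun u v => (hinit u v).cost,
    fun u v => (hinit u v).label, fun u v h => ?_⟩ (fun u v => (hinit u v).adj_eq)
    (fun u v => (hinit u v).cost_eq)
  have h9 : s₁.nat 8 u v = 1 := by
    rw [← h]; exact (hinit u v).adj_eq.symm
  have h2 : s₁.real 2 u v = if u = v then 0 else c v :=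
    (hinit u v).cost_eq.trans (hinit u v).cost
  have h3 : s₁.grp 2 u v = if u = v then 0 else g v :=
    (hinit u v).label_eq.trans (hinit u v).label
  rw [h2, h3]
  by_cases huv : u = v
  · subst huv
    exact ⟨0, 0, Walk.nil u, by simp, by simp⟩
  · have hr := ((hinit u v).adj.1 h9).resolve_left huv
    exact ⟨1, _, Walk.single hr, by simp [huv], by simp [huv]⟩

theorem WalkMatrix.closed_walk {t : Store Γ} (h : WalkMatrix r c g t) {x u v : Fin (n + n)}
    (h1 : t.nat 9 x u = 1) (h2 : t.nat 8 u v = 1) (h3 : t.nat 9 v x = 1) :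
    ∃ k m, Walk r k x x m ∧ t.real 2 x u + t.real 1 u v + t.real 2 v x = (m.map c).sum ∧
      t.grp 2 x u + t.grp 1 u v + t.grp 2 v x = (m.map g).sum ∧ (u ≠ v → v ∈ m) := by
  obtain ⟨k, m, hw, hc, hg⟩ := h.walk x u h1
  obtain ⟨k', m', hw', hc', hg'⟩ := h.walk v x h3
  rw [hc, hc', hg, hg', h.cost, h.label]
  by_cases huv : u = v
  · subst huv
    exact ⟨_, _, hw.append hw', by simp, by simp, fun h => absurd rfl h⟩
  · have hr := ((h.adj u v).1 h2).resolve_left huv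
    refine ⟨_, _, (hw.snoc hr).append hw', ?_, ?_, fun _ => by simp⟩
    · simp only [if_neg huv, Multiset.map_add, Multiset.map_cons, Multiset.sum_add,
        Multiset.sum_cons]
      ring
    · simp only [if_neg huv, Multiset.map_add, Multiset.map_cons, Multiset.sum_add,
        Multiset.sum_cons]
      abel

/-- The scan minimizes over triples rather than covered sets. The two minima agree once each
selected triple dominates a suitable covered set and each suitable covered set is matched by a
selected triple that is no more expensive. -/
theorem isMinimum_scan {F : Test} {T : Fin (n + n) → Fin (n + n) → Fin (n + n) → Prop}
    {P : Finset (Fin (n + n)) → Prop} (hF : Selects I F T s)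
    (h1 : ∀ x u v : Fin (n + n), s.nat 9 x u = 1 → s.nat 8 u v = 1 → s.nat 9 v x = 1 → T x u v →
      ∃ S, Covers r S ∧ P S ∧ ∑ v ∈ S, c v ≤ s.real 2 x u + s.real 1 u v + s.real 2 v x)
    (h2 : ∀ S, Covers r S → P S → ∃ x u v : Fin (n + n), (s.nat 9 x u = 1 ∧ s.nat 8 u v = 1 ∧
      s.nat 9 v x = 1 ∧ T x u v) ∧
        s.real 2 x u + s.real 1 u v + s.real 2 v x ≤ ∑ v ∈ S, c v) :
    IsMinimum r P c ((scan F).run I s) := by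
  obtain ⟨h3, h4⟩ := run_scan (I := I) hF
  rcases h3 with h | ⟨h, x, u, v, hq, hv⟩
  · refine Or.inl ⟨h, fun S hS hP => ?_⟩
    obtain ⟨x, u, v, hq, -⟩ := h2 S hS hP
    have := (h4 x u v hq).1
    omega
  · refine Or.inr ⟨h, ?_, fun S hS hP => ?_⟩
    · rw [hv]
      exact h1 x u v hq.1 hq.2.1 hq.2.2.1 hq.2.2.2
    · obtain ⟨x, u, v, hq, hle⟩ := h2 S hS hP
      exact (h4 x u v hq).2.trans hle

/-- A selected triple describes a closed walk that enters `e` by a genuine arc from `u`, so `e` lies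
on one of the cycles of the walk. Conversely, a cycle through `e` is a walk from `e` to some `u`
followed by the arc back to `e`. -/
theorem run_engine_through (hs : Setup φ₁ φ₂ A c g s)
    (hU : ∀ x : Fin (n + n), s.nat 7 0 x = 1 ↔ x ∈ U)
    (hA : IsCommonBase (I.M₁.comap φ₁) (I.M₂.comap φ₂) A)
    (hnn : ∀ S, Covers (arcIn (I.M₁.comap φ₁) (I.M₂.comap φ₂) A U) S → 0 ≤ ∑ v ∈ S, c v)
    {e : Fin (n + n)} (he : s.nat 12 0 0 = e) :
    IsMinimum (arcIn (I.M₁.comap φ₁) (I.M₂.comap φ₂) A U) (fun S => e ∈ S) c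
      ((engine throughFilter).run I s) := by
  obtain ⟨hw, hd⟩ := run_matrices (I := I) hs hU hA
  have he' : (relax.run I (initMatrix.run I s)).nat 12 0 0 = e := by
    rw [(run_frame I relax _).nat 12 rfl, (run_frame I initMatrix _).nat 12 rfl, he]
  rw [engine, run_seq, run_seq]
  set t := relax.run I (initMatrix.run I s)
  set r := arcIn (I.M₁.comap φ₁) (I.M₂.comap φ₂) A U
  have hirr : ∀ v, ¬ r v v := fun v h => h.2.2.ne rfl
  refine isMinimum_scan (T := fun x u v => x = e ∧ v = e ∧ u ≠ e) ?_ ?_ ?_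
  · intro t' x u v h12 _ hx hu hv
    simp [throughFilter, Test.Holds, h12, he', hx, hu, hv, Fin.ext_iff]
  · rintro x u v h1 h2 h3 ⟨rfl, rfl, hne⟩
    obtain ⟨k, m, hwk, hc, -, hm⟩ := hw.closed_walk h1 h2 h3
    rw [hc]
    exact hwk.exists_covers_mem hirr hnn (hm hne)
  · intro S hS heS
    obtain ⟨T, k, hTS, heT, hk, hk0, hwk, -, hcov⟩ := hS.exists_cycle heS
    have hrest := hnn _ hcov
    have hsum := Finset.sum_sdiff (f := c) hTS
    rw [Fintype.card_fin] at hk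
    have hTc : ∑ v ∈ T, c v = (T.val.map c).sum := rfl
    generalize hTm : T.val = m at hwk hTc
    cases hwk with
    | nil => exact absurd rfl hk0
    | @snoc k _ u _ m hwk hr =>
      obtain ⟨a1, a2⟩ := hd k e u m (by omega) hwk
      -- The third part of the closed walk starts and ends at `e`; comparison with the empty walk
      -- shows that it adds no positive cost.
      obtain ⟨b1, b2⟩ := hd 0 e e 0 (by omega) (Walk.nil e)
      have hne : u ≠ e := fun h => hirr e (h ▸ hr)
      refine ⟨e, u, e, ⟨a1, (hw.adj u e).2 (Or.inr hr), b1, rfl, rfl, hne⟩, ?_⟩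
      rw [hw.cost, if_neg hne]
      simp only [Multiset.map_cons, Multiset.sum_cons, Multiset.map_zero, Multiset.sum_zero]
        at hTc b2
      linarith

/-- A closed walk with non-zero label contains a cycle with non-zero label. For the converse, take a
single non-zero cycle of the covered set: if all triples up to its cost had label zero,
`Walk.label_eq_zero` would give it label zero. -/
theorem run_engine_nonzero (hs : Setup φ₁ φ₂ A c g s)
    (hU : ∀ x : Fin (n + n), s.nat 7 0 x = 1 ↔ x ∈ U)
    (hA : IsCommonBase (I.M₁.comap φ₁) (I.M₂.comap φ₂) A)
    (hnn : ∀ S, Covers (arcIn (I.M₁.comap φ₁) (I.M₂.comap φ₂) A U) S → 0 ≤ ∑ v ∈ S, c v) :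
    IsMinimum (arcIn (I.M₁.comap φ₁) (I.M₂.comap φ₂) A U) (fun S => ∑ v ∈ S, g v ≠ 0) c
      ((engine nonzeroFilter).run I s) := by
  obtain ⟨hw, hd⟩ := run_matrices (I := I) hs hU hA
  rw [engine, run_seq, run_seq]
  set t := relax.run I (initMatrix.run I s)
  set r := arcIn (I.M₁.comap φ₁) (I.M₂.comap φ₂) A U
  have hirr : ∀ v, ¬ r v v := fun v h => h.2.2.ne rfl
  refine isMinimum_scan (T := fun x u v => t.grp 2 x u + t.grp 1 u v + t.grp 2 v x ≠ 0) ?_ ?_ ?_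
  · intro t' x u v _ hg hx hu hv
    simp [nonzeroFilter, closedLabel, Test.Holds, GrpExpr.eval, hg, hx, hu, hv]
  · intro x u v h1 h2 h3 hne
    obtain ⟨k, m, hwk, hc, hl, -⟩ := hw.closed_walk h1 h2 h3
    rw [hl] at hne
    rw [hc]
    exact hwk.exists_covers_nonzero hirr hnn hne
  · intro S hS hgS
    obtain ⟨T, e, k, hk, hwk, hgT, hcT⟩ := hS.exists_nonzero_cycle hnn hgS
    rw [Fintype.card_fin] at hk
    by_contra! hno
    refine hgT (Walk.label_eq_zero (r := r) (c := c) (g := g) (K := n + n)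
      (ok := fun u v => t.nat 9 u v = 1) (d := fun u v => t.real 2 u v)
      (l := fun u v => t.grp 2 u v) hd (s := e) (b := ∑ v ∈ S, c v) ?_ ?_ hk hwk hcT)
    · intro u v hr h1 h2 hle
      by_contra hne
      have huv : u ≠ v := fun h => hirr v (h ▸ hr)
      have := hno e u v ⟨h1, (hw.adj u v).2 (Or.inr hr), h2, by
        rwa [hw.label, if_neg huv]⟩
      rw [hw.cost, if_neg huv] at this
      linarith
    · intro v h1 h2 hle
      by_contra hne
      have := hno e v v ⟨h1, (hw.adj v v).2 (Or.inl rfl), h2, by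
        rwa [hw.label, if_pos rfl, add_zero]⟩
      rw [hw.cost, if_pos rfl] at this
      linarith

end Cmd

end Engine

/-! ### Shrinking to an inclusion-minimal optimal cycle family. -/

section Search

namespace Cmd

/-- The real variable `a`. -/
def rdR (a : ℕ) : RealExpr := .get a (.const 0) (.const 0)

/-- Remove the vertex in variable `26` from the set in array `7` if a closed walk of cost at most
the bound in variable `4` remains. -/
def shrinkCell (F : Test) : Cmd :=
  cond (isOne (rd1 7 (rd 26)))
    (seq (assign1 7 (rd 26) (.const 0)) <| seq (engine F) <|
      cond (.and (isOne (rd 10)) (.realLe (rdR 3) (rdR 4))) skip (assign1 7 (rd 26) (.const 1)))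
    skip

/-- Shrink the set in array `7` to the vertex set of a cheapest cycle that passes the filter `F`;
variable `11` tells whether there is one, and the real variable `4` holds its cost. -/
def search (F : Test) : Cmd :=
  seq (engine F) <| seq (assign 11 (rd 10)) <|
    cond (isOne (rd 11)) (seq (.setReal 4 (.const 0) (.const 0) (rdR 3)) (forLoop 26 (shrinkCell F)))
      skip

/-- Exchange the elements of the set in array `7` in the set in array `6`. -/
def exchange : Cmd :=
  forLoop 26 (cond (isOne (rd1 7 (rd 26)))
    (cond (isOne (rd1 6 (rd 26))) (assign1 6 (rd 26) (.const 0)) (assign1 6 (rd 26) (.const 1)))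
    skip)

variable {Γ : Type*} [AddCommGroup Γ] {n : ℕ} {I : Input Γ n}
  {A U : Finset (Fin (n + n))} {c : Fin (n + n) → ℝ} {s : Store Γ}

omit [AddCommGroup Γ] in
@[simp] theorem eval_rdR (a : ℕ) (s : Store Γ) : (rdR a).eval I s = s.real a 0 0 := rfl

theorem run_exchange (hA : ∀ x : Fin (n + n), s.nat 6 0 x = 1 ↔ x ∈ A)
    (hU : ∀ x : Fin (n + n), s.nat 7 0 x = 1 ↔ x ∈ U) (x : Fin (n + n)) :
    (exchange.run I s).nat 6 0 x = 1 ↔ x ∈ symmDiff A U := by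
  have main : ∀ x : Fin (n + n), ((x : ℕ) < n + n →
      ((exchange.run I s).nat 6 0 x = 1 ↔ x ∈ symmDiff A U)) ∧
      (n + n ≤ (x : ℕ) → (exchange.run I s).nat 6 0 x = s.nat 6 0 x) := by
    refine run_forLoop (I := I) (fun k t => ∀ x : Fin (n + n),
      ((x : ℕ) < k → (t.nat 6 0 x = 1 ↔ x ∈ symmDiff A U)) ∧
      (k ≤ (x : ℕ) → t.nat 6 0 x = s.nat 6 0 x)) (by simp [put_nat]) ?_
    intro k hk t htk hfr hI x
    rw [put_nat, if_neg (by simp)]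
    have h7 : t.nat 7 = s.nat 7 := hfr.nat 7 rfl
    have h6 : t.nat 6 0 k = s.nat 6 0 k := (hI ⟨k, hk⟩).2 le_rfl
    by_cases hx : (x : ℕ) = k
    · refine ⟨fun _ => ?_, fun h => by omega⟩
      have hAx := hA x
      have hUx := hU x
      rw [hx] at hAx hUx
      rw [Finset.mem_symmDiff, hx]
      by_cases h1 : s.nat 7 0 k = 1
      · rw [run_cond_pos (by simp [htk, h7, h1])]
        by_cases h2 : s.nat 6 0 k = 1
        · rw [run_cond_pos (by simp [htk, h6, h2])]
          simp [run_assign1_nat, htk, ← hAx, ← hUx, h1, h2]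
        · rw [run_cond_neg (by simp [htk, h6, h2])]
          simp [run_assign1_nat, htk, ← hAx, ← hUx, h1, h2]
      · rw [run_cond_neg (by simp [htk, h7, h1]), run_skip, h6]
        simp [← hAx, ← hUx, h1]
    · have e : ∀ y, ((assign1 6 (rd 26) y).run I t).nat 6 0 x = t.nat 6 0 x := by
        intro y
        simp [run_assign1_nat, htk, hx]
      have e2 : ((cond (isOne (rd1 7 (rd 26))) (cond (isOne (rd1 6 (rd 26)))
          (assign1 6 (rd 26) (.const 0)) (assign1 6 (rd 26) (.const 1))) skip).run I t).nat 6 0 x =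
          t.nat 6 0 x := by
        by_cases h1 : (isOne (rd1 7 (rd 26))).Holds I t
        · rw [run_cond_pos h1]
          by_cases h2 : (isOne (rd1 6 (rd 26))).Holds I t
          · rw [run_cond_pos h2, e]
          · rw [run_cond_neg h2, e]
        · rw [run_cond_neg h1, run_skip]
      rw [e2]
      exact ⟨fun h => (hI x).1 (by omega), fun h => (hI x).2 (by omega)⟩
  exact (main x).1 x.2

/-- Self-reduction: a vertex is deleted for good if the optimal cost is still attainable without it.
A vertex that was kept stays indispensable when the set shrinks further. The predicate `K` stands
for whatever the engine needs to know about arrays that the search leaves unchanged. -/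
theorem run_search {F : Test} {N₁ N₂ : Matroid (Fin (n + n))} {P : Finset (Fin (n + n)) → Prop}
    {K : Store Γ → Prop} (hK : ∀ t t' : Store Γ, K t → t'.nat 31 = t.nat 31 →
      t'.nat 32 = t.nat 32 → t'.nat 6 = t.nat 6 → t'.nat 12 = t.nat 12 → t'.real 0 = t.real 0 →
      t'.grp 0 = t.grp 0 → K t')
    (hE : ∀ (t : Store Γ) (U' : Finset (Fin (n + n))), K t → U' ⊆ U →
      (∀ x : Fin (n + n), t.nat 7 0 x = 1 ↔ x ∈ U') →
        IsMinimum (arcIn N₁ N₂ A U') P c ((engine F).run I t))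
    (hs : K s) (hU : ∀ x : Fin (n + n), s.nat 7 0 x = 1 ↔ x ∈ U) :
    let s' := (search F).run I s
    (s'.nat 11 0 0 = 0 ∧ ∀ S ⊆ U, Covers (exchangeArc N₁ N₂ A) S → ¬ P S) ∨
    (s'.nat 11 0 0 = 1 ∧ ∃ V ⊆ U, (∀ x : Fin (n + n), s'.nat 7 0 x = 1 ↔ x ∈ V) ∧
      Covers (exchangeArc N₁ N₂ A) V ∧ P V ∧ ∑ v ∈ V, c v ≤ s'.real 4 0 0 ∧
      (∀ S ⊆ U, Covers (exchangeArc N₁ N₂ A) S → P S → s'.real 4 0 0 ≤ ∑ v ∈ S, c v) ∧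
      ∀ S ⊂ V, Covers (exchangeArc N₁ N₂ A) S → P S → ¬ ∑ v ∈ S, c v ≤ s'.real 4 0 0) := by
  intro s'
  have hs' : s' = (cond (isOne (rd 11))
      (seq (.setReal 4 (.const 0) (.const 0) (rdR 3)) (forLoop 26 (shrinkCell F))) skip).run I
      ((assign 11 (rd 10)).run I ((engine F).run I s)) := rfl
  have hmin := hE s U hs subset_rfl hU
  have hfr1 := run_frame I (engine F) s
  set s₁ := (engine F).run I s with hs₁
  set s₂ := (assign 11 (rd 10)).run I s₁ with hs₂
  have hfr2 : Frame (assign 11 (rd 10)) s₁ s₂ := run_frame I _ _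
  have h11 : s₂.nat 11 0 0 = s₁.nat 10 0 0 := by simp [hs₂, run_assign_nat]
  rcases hmin with ⟨h10, hno⟩ | ⟨h10, hyes, hle⟩
  · left
    rw [hs', run_cond_neg (by simp [h11, h10]), run_skip, h11, h10]
    exact ⟨rfl, fun S hS hc => hno S (covers_arcIn_iff.2 ⟨hS, hc⟩)⟩
  · right
    rw [run_cond_pos (by simp [h11, h10]), run_seq] at hs'
    set s₃ := (Cmd.setReal 4 (.const 0) (.const 0) (rdR 3)).run I s₂ with hs₃
    have hfr3 : Frame (Cmd.setReal 4 (.const 0) (.const 0) (rdR 3)) s₂ s₃ := run_frame I _ _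
    set l := s₁.real 3 0 0 with hl
    have h4 : s₃.real 4 0 0 = l := by
      simp [hs₃, run_setReal_real, hfr2.real 3 rfl, hl]
    have hfr4 : Frame (forLoop 26 (shrinkCell F)) s₃ s' := by rw [hs']; exact run_frame I _ _
    have hs'4 : s'.real 4 0 0 = l := by rw [hfr4.real 4 rfl, h4]
    have hs'11 : s'.nat 11 0 0 = 1 := by rw [hfr4.nat 11 rfl, hfr3.nat 11 rfl, h11, h10]
    have hK3 : K s₃ := hK s s₃ hs
      (by rw [hfr3.nat 31 rfl, hfr2.nat 31 rfl, hfr1.nat 31 rfl])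
      (by rw [hfr3.nat 32 rfl, hfr2.nat 32 rfl, hfr1.nat 32 rfl])
      (by rw [hfr3.nat 6 rfl, hfr2.nat 6 rfl, hfr1.nat 6 rfl])
      (by rw [hfr3.nat 12 rfl, hfr2.nat 12 rfl, hfr1.nat 12 rfl])
      (by rw [hfr3.real 0 rfl, hfr2.real 0 rfl, hfr1.real 0 rfl])
      (by rw [hfr3.grp 0 rfl, hfr2.grp 0 rfl, hfr1.grp 0 rfl])
    have hU3 : s₃.nat 7 = s.nat 7 := by rw [hfr3.nat 7 rfl, hfr2.nat 7 rfl, hfr1.nat 7 rfl]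
    have hloop : ∃ V ⊆ U, (∀ x : Fin (n + n), s'.nat 7 0 x = 1 ↔ x ∈ V) ∧
        (∃ S, Covers (arcIn N₁ N₂ A V) S ∧ P S ∧ ∑ v ∈ S, c v ≤ l) ∧
        ∀ x ∈ V, (x : ℕ) < n + n → ∀ S, Covers (arcIn N₁ N₂ A (V.erase x)) S → P S →
          ¬ ∑ v ∈ S, c v ≤ l := by
      rw [hs']
      refine run_forLoop (I := I) (fun k t => ∃ V ⊆ U,
        (∀ x : Fin (n + n), t.nat 7 0 x = 1 ↔ x ∈ V) ∧
        (∃ S, Covers (arcIn N₁ N₂ A V) S ∧ P S ∧ ∑ v ∈ S, c v ≤ l) ∧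
        ∀ x ∈ V, (x : ℕ) < k → ∀ S, Covers (arcIn N₁ N₂ A (V.erase x)) S → P S →
          ¬ ∑ v ∈ S, c v ≤ l) ⟨U, subset_rfl, ?_, hyes, by simp⟩ ?_
      · simpa [put_nat, hU3] using hU
      · rintro k hk t htk hfr ⟨V, hVU, hV, hfeas, hinf⟩
        have hput : ∀ t' : Store Γ, (t'.put 26 (k + 1)).nat 7 = t'.nat 7 := by
          intro t'; funext i j; simp [put_nat]
        rw [hput]
        have hmono : ∀ x (W : Finset (Fin (n + n))), W ⊆ V → ∀ S,
            Covers (arcIn N₁ N₂ A (W.erase x)) S → Covers (arcIn N₁ N₂ A (V.erase x)) S := by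
          intro x W hW S hS
          rw [covers_arcIn_iff] at hS ⊢
          exact ⟨hS.1.trans (Finset.erase_subset_erase x hW), hS.2⟩
        by_cases hkV : (⟨k, hk⟩ : Fin (n + n)) ∈ V
        · rw [shrinkCell, run_cond_pos (by simpa [htk] using (hV ⟨k, hk⟩).2 hkV), run_seq, run_seq]
          set t₁ := (assign1 7 (rd 26) (.const 0)).run I t with ht₁
          have hg1 : Frame (assign1 7 (rd 26) (.const 0)) t t₁ := run_frame I _ _
          have hV1 : ∀ x : Fin (n + n), t₁.nat 7 0 x = 1 ↔ x ∈ V.erase ⟨k, hk⟩ := by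
            intro x
            rw [ht₁, run_assign1_nat]
            by_cases hx : (x : ℕ) = k
            · have : x = ⟨k, hk⟩ := Fin.ext hx
              simp [htk, this]
            · have : x ≠ ⟨k, hk⟩ := fun h => hx (congrArg Fin.val h)
              simp [htk, hx, this, hV]
          have hK1 : K t₁ := hK s₃ t₁ hK3
            (by rw [hg1.nat 31 rfl, hfr.nat 31 rfl])
            (by rw [hg1.nat 32 rfl, hfr.nat 32 rfl])
            (by rw [hg1.nat 6 rfl, hfr.nat 6 rfl])
            (by rw [hg1.nat 12 rfl, hfr.nat 12 rfl])
            (by rw [hg1.real 0 rfl, hfr.real 0 rfl])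
            (by rw [hg1.grp 0 rfl, hfr.grp 0 rfl])
          have hm := hE t₁ (V.erase ⟨k, hk⟩) hK1 ((Finset.erase_subset _ _).trans hVU) hV1
          set t₂ := (engine F).run I t₁ with ht₂
          have hg2 : Frame (engine F) t₁ t₂ := run_frame I _ _
          have h42 : t₂.real 4 0 0 = l := by
            rw [hg2.real 4 rfl, hg1.real 4 rfl, hfr.real 4 rfl, h4]
          by_cases hc : t₂.nat 10 0 0 = 1 ∧ t₂.real 3 0 0 ≤ l
          · rw [run_cond_pos (by simpa [Test.Holds, h42] using hc), run_skip]
            obtain ⟨hm1, -⟩ := (hm.resolve_left (by omega)).2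
            obtain ⟨S, hS1, hS2, hS3⟩ := hm1
            refine ⟨V.erase ⟨k, hk⟩, (Finset.erase_subset _ _).trans hVU, ?_,
              ⟨S, hS1, hS2, hS3.trans hc.2⟩, ?_⟩
            · rw [hg2.nat 7 rfl]; exact hV1
            · intro x hx hxk S' hS' hP'
              have hxk' : (x : ℕ) < k := by
                have : x ≠ ⟨k, hk⟩ := Finset.ne_of_mem_erase hx
                have : (x : ℕ) ≠ k := fun h => this (Fin.ext h)
                omega
              exact hinf x (Finset.mem_of_mem_erase hx) hxk' S'
                (hmono x _ (Finset.erase_subset _ _) S' hS') hP'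
          · rw [run_cond_neg (by simpa [Test.Holds, h42] using hc)]
            refine ⟨V, hVU, fun x => ?_, hfeas, fun x hx hxk S' hS' hP' => ?_⟩
            · rw [run_assign1_nat, eval_rd, hg2.nat 26 rfl, hg1.nat 26 rfl, htk, hg2.nat 7 rfl]
              by_cases hx : (x : ℕ) = k
              · have : x = ⟨k, hk⟩ := Fin.ext hx
                simp [this, hkV]
              · have : x ≠ ⟨k, hk⟩ := fun h => hx (congrArg Fin.val h)
                simp [hx, this, hV1]
            · rcases Nat.lt_succ_iff_lt_or_eq.1 hxk with h | h
              · exact hinf x hx h S' hS' hP'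
              · have : x = ⟨k, hk⟩ := Fin.ext h
                subst this
                intro hle'
                rcases hm with ⟨-, hm⟩ | ⟨hm1, -, hm2⟩
                · exact hm S' hS' hP'
                · exact hc ⟨hm1, (hm2 S' hS' hP').trans hle'⟩
        · rw [shrinkCell, run_cond_neg (by simpa [htk] using mt (hV ⟨k, hk⟩).1 hkV), run_skip]
          refine ⟨V, hVU, hV, hfeas, fun x hx hxk => ?_⟩
          have : x ≠ ⟨k, hk⟩ := fun h => hkV (h ▸ hx)
          have : (x : ℕ) ≠ k := fun h => this (Fin.ext h)
          exact hinf x hx (by omega)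
    obtain ⟨V, hVU, hV, ⟨S, hS1, hS2, hS3⟩, hinf⟩ := hloop
    rw [covers_arcIn_iff] at hS1
    have hinf' : ∀ S ⊂ V, Covers (exchangeArc N₁ N₂ A) S → P S → ¬ ∑ v ∈ S, c v ≤ l := by
      intro S hS hc hP
      obtain ⟨x, hx, hxS⟩ := Finset.exists_of_ssubset hS
      refine hinf x hx x.2 S (covers_arcIn_iff.2 ⟨fun y hy => ?_, hc⟩) hP
      exact Finset.mem_erase.2 ⟨fun h => hxS (h ▸ hy), hS.subset hy⟩
    -- A covered set within the bound that lies inside the final `V` cannot miss any vertex of `V`,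
    -- so `V` itself is covered.
    have hSV : S = V := by
      by_contra hne
      exact hinf' S (Finset.ssubset_iff_subset_ne.2 ⟨hS1.1, hne⟩) hS1.2 hS2 hS3
    subst hSV
    rw [hs'4, hs'11]
    exact ⟨rfl, S, hVU, hV, hS1.2, hS2, hS3,
      fun S' hS' hc hP => hle S' (covers_arcIn_iff.2 ⟨hS', hc⟩) hP, hinf'⟩

end Cmd

end Search

/-! ### The two kinds of optimal exchanges. -/

section ExchangeSteps

namespace Cmd

def copyActive : Cmd := forLoop 26 (assign1 7 (rd 26) (rd1 14 (rd 26)))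

/-- The costs of an exchange with respect to the weights in array `5`. -/
def exchangeCosts : Cmd :=
  forLoop 26 (cond (isOne (rd1 6 (rd 26)))
    (.setReal 0 (.const 0) (rd 26) (.sub .zero (.get 5 (.const 0) (rd 26))))
    (.setReal 0 (.const 0) (rd 26) (.get 5 (.const 0) (rd 26))))

/-- The weights of the elements outside of the basis, and the change of the label. -/
def insertionCosts : Cmd :=
  forLoop 26 (cond (isOne (rd1 6 (rd 26)))
    (seq (.setReal 0 (.const 0) (rd 26) .zero) (.setGrp 0 (.const 0) (rd 26) (.neg (.label (rd 26)))))
    (seq (.setReal 0 (.const 0) (rd 26) (.get 5 (.const 0) (rd 26)))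
      (.setGrp 0 (.const 0) (rd 26) (.label (rd 26)))))

/-- Find a cheapest exchange that removes the element in variable `12`. -/
def removalStep : Cmd := seq exchangeCosts (seq copyActive (search throughFilter))

/-- Find a cheap exchange that changes the label. -/
def nonzeroStep : Cmd := seq insertionCosts (seq copyActive (search nonzeroFilter))

variable {Γ : Type*} [AddCommGroup Γ] {n : ℕ} {I : Input Γ n}
  {φ₁ φ₂ : Fin (n + n) → Fin n} {A U : Finset (Fin (n + n))} {w : Fin (n + n) → ℝ} {s : Store Γ}

/-- The memory holds the maps of the two matroids, a common basis `A`, the set `U` of active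
elements, and weights. -/
structure State (φ₁ φ₂ : Fin (n + n) → Fin n) (A U : Finset (Fin (n + n))) (w : Fin (n + n) → ℝ)
    (s : Store Γ) : Prop where
  map₁ : ∀ x : Fin (n + n), s.nat 31 0 x = φ₁ x
  map₂ : ∀ x : Fin (n + n), s.nat 32 0 x = φ₂ x
  mask : ∀ x : Fin (n + n), s.nat 6 0 x = 1 ↔ x ∈ A
  active : ∀ x : Fin (n + n), s.nat 14 0 x = 1 ↔ x ∈ U
  weight : ∀ x : Fin (n + n), s.real 5 0 x = w x

theorem run_copyActive (hU : ∀ x : Fin (n + n), s.nat 14 0 x = 1 ↔ x ∈ U) (x : Fin (n + n)) :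
    (copyActive.run I s).nat 7 0 x = 1 ↔ x ∈ U := by
  have main : ∀ x < n + n, (copyActive.run I s).nat 7 0 x = s.nat 14 0 x := by
    refine run_forLoop (I := I) (fun k t => ∀ x < k, t.nat 7 0 x = s.nat 14 0 x) (by simp) ?_
    intro k hk t htk hfr hI y hy
    simp only [put_nat, run_assign1_nat, eval_rd, htk, eval_rd1, hfr.nat 14 rfl]
    by_cases h : y = k
    · simp [h]
    · simp [h, hI y (by omega)]
  rw [main x x.2, hU]

theorem run_exchangeCosts (hA : ∀ x : Fin (n + n), s.nat 6 0 x = 1 ↔ x ∈ A)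
    (hw : ∀ x : Fin (n + n), s.real 5 0 x = w x) (x : Fin (n + n)) :
    (exchangeCosts.run I s).real 0 0 x = exchangeCost w A x := by
  have main : ∀ x : Fin (n + n), (x : ℕ) < n + n →
      (exchangeCosts.run I s).real 0 0 x = exchangeCost w A x := by
    refine run_forLoop (I := I) (fun k t => ∀ x : Fin (n + n), (x : ℕ) < k →
      t.real 0 0 x = exchangeCost w A x) (by simp) ?_
    intro k hk t htk hfr hI x hx
    have h6 : t.nat 6 0 k = 1 ↔ (⟨k, hk⟩ : Fin (n + n)) ∈ A := by
      rw [hfr.nat 6 rfl]; exact hA ⟨k, hk⟩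
    have h5 : t.real 5 0 k = w ⟨k, hk⟩ := by rw [hfr.real 5 rfl]; exact hw ⟨k, hk⟩
    rw [put_real]
    by_cases hxk : (x : ℕ) = k
    · have hx' : x = ⟨k, hk⟩ := Fin.ext hxk
      subst hx'
      by_cases hkA : (⟨k, hk⟩ : Fin (n + n)) ∈ A
      · rw [run_cond_pos (by simpa [htk] using h6.2 hkA)]
        simp [run_setReal_real, RealExpr.eval, htk, exchangeCost, hkA, h5]
      · rw [run_cond_neg (by simpa [htk] using mt h6.1 hkA)]
        simp [run_setReal_real, RealExpr.eval, htk, exchangeCost, hkA, h5]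
    · have := hI x (by omega)
      by_cases hkA : (⟨k, hk⟩ : Fin (n + n)) ∈ A
      · rw [run_cond_pos (by simpa [htk] using h6.2 hkA)]
        simp [run_setReal_real, htk, hxk, this]
      · rw [run_cond_neg (by simpa [htk] using mt h6.1 hkA)]
        simp [run_setReal_real, htk, hxk, this]
  exact main x x.2

/-- The label of an element, zero for the auxiliary elements. -/
def elementLabel (I : Input Γ n) (x : Fin (n + n)) : Γ :=
  if h : (x : ℕ) < n then I.ψ ⟨x, h⟩ else 0

/-- The weight of an element, zero for the auxiliary elements. -/
def elementWeight (I : Input Γ n) (x : Fin (n + n)) : ℝ :=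
  if h : (x : ℕ) < n then I.w ⟨x, h⟩ else 0

theorem run_insertionCosts (hA : ∀ x : Fin (n + n), s.nat 6 0 x = 1 ↔ x ∈ A)
    (hw : ∀ x : Fin (n + n), s.real 5 0 x = w x) (x : Fin (n + n)) :
    (insertionCosts.run I s).real 0 0 x = (if x ∈ A then 0 else w x) ∧
      (insertionCosts.run I s).grp 0 0 x = exchangeCost (elementLabel I) A x := by
  have main : ∀ x : Fin (n + n), (x : ℕ) < n + n →
      (insertionCosts.run I s).real 0 0 x = (if x ∈ A then 0 else w x) ∧
      (insertionCosts.run I s).grp 0 0 x = exchangeCost (elementLabel I) A x := by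
    refine run_forLoop (I := I) (fun k t => ∀ x : Fin (n + n), (x : ℕ) < k →
      t.real 0 0 x = (if x ∈ A then 0 else w x) ∧
      t.grp 0 0 x = exchangeCost (elementLabel I) A x) (by simp) ?_
    intro k hk t htk hfr hI x hx
    have h6 : t.nat 6 0 k = 1 ↔ (⟨k, hk⟩ : Fin (n + n)) ∈ A := by
      rw [hfr.nat 6 rfl]; exact hA ⟨k, hk⟩
    have h5 : t.real 5 0 k = w ⟨k, hk⟩ := by rw [hfr.real 5 rfl]; exact hw ⟨k, hk⟩
    have hlab : ∀ t' : Store Γ, t'.nat 26 0 0 = k →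
        (GrpExpr.label (rd 26)).eval I t' = elementLabel I ⟨k, hk⟩ := by
      intro t' h
      simp [GrpExpr.eval, h, elementLabel]
    rw [put_real, put_grp]
    by_cases hxk : (x : ℕ) = k
    · have hx' : x = ⟨k, hk⟩ := Fin.ext hxk
      subst hx'
      by_cases hkA : (⟨k, hk⟩ : Fin (n + n)) ∈ A
      · rw [run_cond_pos (by simpa [htk] using h6.2 hkA)]
        simp [run_seq, run_setReal_real, run_setGrp_grp, RealExpr.eval, htk, exchangeCost, hkA,
          GrpExpr.eval, elementLabel]
      · rw [run_cond_neg (by simpa [htk] using mt h6.1 hkA)]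
        simp [run_seq, run_setReal_real, run_setGrp_grp, RealExpr.eval, htk, exchangeCost, hkA, h5,
          GrpExpr.eval, elementLabel]
    · have := hI x (by omega)
      by_cases hkA : (⟨k, hk⟩ : Fin (n + n)) ∈ A
      · rw [run_cond_pos (by simpa [htk] using h6.2 hkA)]
        simp [run_seq, run_setReal_real, run_setGrp_grp, htk, hxk, this]
      · rw [run_cond_neg (by simpa [htk] using mt h6.1 hkA)]
        simp [run_seq, run_setReal_real, run_setGrp_grp, htk, hxk, this]
  exact main x x.2

/-- Every active common basis `B` avoiding `e` gives the covered set `symmDiff A B` through `e`, so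
the optimal cost bounds all such `B` from below. The minimal optimal set found by the search can be
exchanged, so the bound is attained. That `A` is lightest excludes negative cycles, as the engine
requires. -/
theorem run_removalStep (hE₁ : I.M₁.E = Set.univ) (hE₂ : I.M₂.E = Set.univ)
    (hS : State φ₁ φ₂ A U w s) (hA : IsCommonBase (I.M₁.comap φ₁) (I.M₂.comap φ₂) A) (hAU : A ⊆ U)
    (hmin : ∀ B ⊆ U, IsCommonBase (I.M₁.comap φ₁) (I.M₂.comap φ₂) B →
      ∑ v ∈ A, w v ≤ ∑ v ∈ B, w v)
    {e : Fin (n + n)} (heA : e ∈ A) (he : s.nat 12 0 0 = e) :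
    let s' := removalStep.run I s
    (s'.nat 11 0 0 = 0 ∧
      ∀ B ⊆ U, IsCommonBase (I.M₁.comap φ₁) (I.M₂.comap φ₂) B → e ∈ B) ∨
    (s'.nat 11 0 0 = 1 ∧ ∃ V : Finset (Fin (n + n)), (∀ x : Fin (n + n), s'.nat 7 0 x = 1 ↔ x ∈ V) ∧
      symmDiff A V ⊆ U ∧ e ∉ symmDiff A V ∧
      IsCommonBase (I.M₁.comap φ₁) (I.M₂.comap φ₂) (symmDiff A V) ∧
      ∑ v ∈ symmDiff A V, w v = ∑ v ∈ A, w v + s'.real 4 0 0 ∧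
      ∀ B ⊆ U, IsCommonBase (I.M₁.comap φ₁) (I.M₂.comap φ₂) B → e ∉ B →
        ∑ v ∈ A, w v + s'.real 4 0 0 ≤ ∑ v ∈ B, w v) := by
  intro s'
  have hE₁' : (I.M₁.comap φ₁).E = Set.univ := by simp [hE₁]
  have hE₂' : (I.M₂.comap φ₂).E = Set.univ := by simp [hE₂]
  have hs' : s' = (search throughFilter).run I (copyActive.run I (exchangeCosts.run I s)) := rfl
  have hcost := run_exchangeCosts (I := I) hS.mask hS.weight
  have hfr1 := run_frame I exchangeCosts s
  set s₁ := exchangeCosts.run I s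
  have hact := run_copyActive (I := I) (s := s₁) (U := U)
    (by rw [hfr1.nat 14 rfl]; exact hS.active)
  have hfr2 := run_frame I copyActive s₁
  set s₂ := copyActive.run I s₁
  have hnn : ∀ S ⊆ U, Covers (exchangeArc (I.M₁.comap φ₁) (I.M₂.comap φ₂) A) S →
      0 ≤ ∑ v ∈ S, exchangeCost w A v := fun S hSU hc =>
    exchangeCost_nonneg hE₁' hE₂' w hA hAU hmin hSU hc
  have hdiff : ∀ B ⊆ U, IsCommonBase (I.M₁.comap φ₁) (I.M₂.comap φ₂) B → e ∉ B →
      symmDiff A B ⊆ U ∧ Covers (exchangeArc (I.M₁.comap φ₁) (I.M₂.comap φ₂) A) (symmDiff A B) ∧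
        e ∈ symmDiff A B := fun B hB hBc heB =>
    ⟨Finset.symmDiff_subset_union.trans (Finset.union_subset hAU hB),
      covers_symmDiff hE₁' hE₂' hA hBc, Finset.mem_symmDiff.2 (Or.inl ⟨heA, heB⟩)⟩
  have hres := run_search (I := I) (F := throughFilter) (A := A) (U := U)
    (N₁ := I.M₁.comap φ₁) (N₂ := I.M₂.comap φ₂) (P := fun S => e ∈ S) (c := exchangeCost w A)
    (s := s₂)
    -- Labels are irrelevant here, so the current contents of the memory serve as labelling.
    (K := fun t => Setup φ₁ φ₂ A (exchangeCost w A) (fun x => s₂.grp 0 0 x) t ∧ t.nat 12 0 0 = e)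
    (fun t t' h h1 h2 h3 h4 h5 h6 => ⟨h.1.congr h1 h2 h3 h5 h6, by rw [h4]; exact h.2⟩)
    (fun t U' hK hU' hmask => run_engine_through hK.1 hmask hA (fun S hc => by
      rw [covers_arcIn_iff] at hc
      exact hnn S (hc.1.trans hU') hc.2) hK.2)
    ⟨⟨by rw [hfr2.nat 31 rfl, hfr1.nat 31 rfl]; exact hS.map₁,
      by rw [hfr2.nat 32 rfl, hfr1.nat 32 rfl]; exact hS.map₂,
      by rw [hfr2.nat 6 rfl, hfr1.nat 6 rfl]; exact hS.mask,
      by rw [hfr2.real 0 rfl]; exact hcost, fun _ => rfl⟩,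
      by rw [hfr2.nat 12 rfl, hfr1.nat 12 rfl, he]⟩ hact
  rw [← hs'] at hres
  rcases hres with ⟨h11, hno⟩ | ⟨h11, V, hVU, hV, hcov, heV, hle, hge, hVmin⟩
  · refine Or.inl ⟨h11, fun B hB hBc => ?_⟩
    by_contra heB
    obtain ⟨h1, h2, h3⟩ := hdiff B hB hBc heB
    exact hno _ h1 h2 h3
  · refine Or.inr ⟨h11, V, hV, Finset.symmDiff_subset_union.trans (Finset.union_subset hAU hVU),
      by simp [Finset.mem_symmDiff, heA, heV], ?_, ?_, fun B hB hBc heB => ?_⟩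
    · exact isCommonBase_of_minimal_through hE₁' hE₂' hA (fun S hS => hnn S (hS.trans hVU))
        (fun S hS => hge S (hS.trans hVU)) hcov heV hle hVmin
    · rw [sum_symmDiff, le_antisymm hle (hge V hVU hcov heV)]
    · obtain ⟨h1, h2, h3⟩ := hdiff B hB hBc heB
      have h4 := hge _ h1 h2 h3
      have h5 := sum_symmDiff w A (symmDiff A B)
      rw [symmDiff_symmDiff_cancel_left] at h5
      rw [h5]
      linarith

/-- The cost `c` drops the gain from leaving elements of `A`. This makes it non-negative on each
vertex, hence monotone in the set, at the price of overestimating the change of weight; the additive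
`w(A)` in the bound comes from there. -/
theorem run_nonzeroStep (hΓ : ∀ x : Γ, x + x = 0 → x = 0) (hE₁ : I.M₁.E = Set.univ)
    (hE₂ : I.M₂.E = Set.univ) (hS : State φ₁ φ₂ A U w s)
    (hA : IsCommonBase (I.M₁.comap φ₁) (I.M₂.comap φ₂) A) (hAU : A ⊆ U) (hw : ∀ v, 0 ≤ w v)
    (hA0 : ∑ v ∈ A, elementLabel I v = 0) :
    let s' := nonzeroStep.run I s
    (s'.nat 11 0 0 = 0 ∧ ∀ B ⊆ U, IsCommonBase (I.M₁.comap φ₁) (I.M₂.comap φ₂) B →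
      ∑ v ∈ B, elementLabel I v = 0) ∨
    (s'.nat 11 0 0 = 1 ∧ ∃ V : Finset (Fin (n + n)), (∀ x : Fin (n + n), s'.nat 7 0 x = 1 ↔ x ∈ V) ∧
      symmDiff A V ⊆ U ∧ IsCommonBase (I.M₁.comap φ₁) (I.M₂.comap φ₂) (symmDiff A V) ∧
      ∑ v ∈ symmDiff A V, elementLabel I v ≠ 0 ∧
      ∀ B ⊆ U, IsCommonBase (I.M₁.comap φ₁) (I.M₂.comap φ₂) B →
        ∑ v ∈ B, elementLabel I v ≠ 0 →
          ∑ v ∈ symmDiff A V, w v ≤ ∑ v ∈ A, w v + ∑ v ∈ B, w v) := by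
  intro s'
  have hE₁' : (I.M₁.comap φ₁).E = Set.univ := by simp [hE₁]
  have hE₂' : (I.M₂.comap φ₂).E = Set.univ := by simp [hE₂]
  have hs' : s' = (search nonzeroFilter).run I (copyActive.run I (insertionCosts.run I s)) := rfl
  have hcost := run_insertionCosts (I := I) hS.mask hS.weight
  have hfr1 := run_frame I insertionCosts s
  set s₁ := insertionCosts.run I s
  have hact := run_copyActive (I := I) (s := s₁) (U := U)
    (by rw [hfr1.nat 14 rfl]; exact hS.active)
  have hfr2 := run_frame I copyActive s₁
  set s₂ := copyActive.run I s₁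
  set c : Fin (n + n) → ℝ := fun x => if x ∈ A then 0 else w x with hc
  set g := exchangeCost (elementLabel I) A with hg
  have hc0 : ∀ v, 0 ≤ c v := fun v => by
    simp only [hc]
    split_ifs
    exacts [le_rfl, hw v]
  have hlabel : ∀ V, ∑ v ∈ symmDiff A V, elementLabel I v = ∑ v ∈ V, g v := by
    intro V
    rw [sum_symmDiff, hA0, zero_add]
  have hres := run_search (I := I) (F := nonzeroFilter) (A := A) (U := U)
    (N₁ := I.M₁.comap φ₁) (N₂ := I.M₂.comap φ₂) (P := fun S => ∑ v ∈ S, g v ≠ 0) (c := c)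
    (s := s₂) (K := fun t => Setup φ₁ φ₂ A c g t)
    (fun t t' h h1 h2 h3 h4 h5 h6 => h.congr h1 h2 h3 h5 h6)
    (fun t U' hK hU' hmask => run_engine_nonzero hK hmask hA
      (fun S _ => Finset.sum_nonneg fun v _ => hc0 v))
    ⟨by rw [hfr2.nat 31 rfl, hfr1.nat 31 rfl]; exact hS.map₁,
      by rw [hfr2.nat 32 rfl, hfr1.nat 32 rfl]; exact hS.map₂,
      by rw [hfr2.nat 6 rfl, hfr1.nat 6 rfl]; exact hS.mask,
      by rw [hfr2.real 0 rfl]; exact fun x => (hcost x).1,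
      by rw [hfr2.grp 0 rfl]; exact fun x => (hcost x).2⟩ hact
  rw [← hs'] at hres
  have hdiff : ∀ B ⊆ U, IsCommonBase (I.M₁.comap φ₁) (I.M₂.comap φ₂) B →
      symmDiff A B ⊆ U ∧ Covers (exchangeArc (I.M₁.comap φ₁) (I.M₂.comap φ₂) A) (symmDiff A B) ∧
        ∑ v ∈ B, elementLabel I v = ∑ v ∈ symmDiff A B, g v := fun B hB hBc =>
    ⟨Finset.symmDiff_subset_union.trans (Finset.union_subset hAU hB),
      covers_symmDiff hE₁' hE₂' hA hBc, by
        rw [← hlabel, symmDiff_symmDiff_cancel_left]⟩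
  rcases hres with ⟨h11, hno⟩ | ⟨h11, V, hVU, hV, hcov, hgV, hle, hge, hVmin⟩
  · refine Or.inl ⟨h11, fun B hB hBc => ?_⟩
    obtain ⟨h1, h2, h3⟩ := hdiff B hB hBc
    rw [h3]
    by_contra hne
    exact hno _ h1 h2 hne
  · refine Or.inr ⟨h11, V, hV, Finset.symmDiff_subset_union.trans (Finset.union_subset hAU hVU),
      ?_, ?_, fun B hB hBc hne => ?_⟩
    · refine isCommonBase_of_minimal_nonzero hΓ hE₁' hE₂' hA hcov hgV fun S hSV hScov => ?_
      by_contra hne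
      -- By monotonicity, subsets of `V` respect the cost bound automatically. So minimality under
      -- the bound is minimality among all non-zero covered sets.
      exact hVmin S hSV hScov hne ((Finset.sum_le_sum_of_subset_of_nonneg hSV.subset
        fun v _ _ => hc0 v).trans hle)
    · rw [hlabel]; exact hgV
    · obtain ⟨h1, h2, h3⟩ := hdiff B hB hBc
      rw [h3] at hne
      have h4 := hge _ h1 h2 hne
      have h5 : ∑ v ∈ V, exchangeCost w A v ≤ ∑ v ∈ V, c v := by
        refine Finset.sum_le_sum fun v _ => ?_
        simp only [exchangeCost, hc]
        split_ifs
        exacts [neg_nonpos.2 (hw v), le_rfl]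
      -- Only the elements of `B \ A` carry cost in the symmetric difference.
      have h6 : ∑ v ∈ symmDiff A B, c v ≤ ∑ v ∈ B, w v := by
        have e1 : ∑ v ∈ symmDiff A B, c v ≤ ∑ v ∈ A ∪ B, c v :=
          Finset.sum_le_sum_of_subset_of_nonneg Finset.symmDiff_subset_union fun v _ _ => hc0 v
        have e2 : ∑ v ∈ B, c v = ∑ v ∈ A ∪ B, c v := by
          refine Finset.sum_subset Finset.subset_union_right fun v hv hvB => ?_
          have : v ∈ A := by simpa [hvB] using hv
          simp [hc, this]
        have e3 : ∑ v ∈ B, c v ≤ ∑ v ∈ B, w v := by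
          refine Finset.sum_le_sum fun v _ => ?_
          simp only [hc]
          split_ifs
          exacts [hw v, le_rfl]
        linarith
      rw [sum_symmDiff]
      linarith

end Cmd

end ExchangeSteps

/-! ### Greedy bases and auxiliary parallel copies. -/

section GreedyBasis

namespace Cmd

/-- Greedily compute a basis of the matroid with oracle `o`, which reads the row `0` of the array
`m`; the variable `c` counts its elements. The array `f` maps each element to itself, and the
auxiliary elements from `n` on to the elements of the basis. -/
def greedy (o : Test) (m c f : ℕ) : Cmd :=
  forLoop 26 (cond (.natLe (.add (rd 26) (.const 1)) .size)
    (seq (assign1 f (rd 26) (rd 26)) <| seq (assign1 m (rd 26) (.const 1)) <|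
      cond o
        (seq (assign1 f (.add .size (rd c)) (rd 26)) (assign c (.add (rd c) (.const 1))))
        (assign1 m (rd 26) (.const 0)))
    skip)

variable {Γ : Type*} [AddCommGroup Γ] {n : ℕ} {I : Input Γ n}

/-- The first `k` elements have been processed, and `l` lists the elements that were selected. -/
structure GreedyState (M : Matroid (Fin n)) (m c f k : ℕ) (l : List (Fin n)) (t : Store Γ) :
    Prop where
  nodup : l.Nodup
  indep : M.Indep {e | e ∈ l}
  lt : ∀ e ∈ l, (e : ℕ) < k
  maximal : ∀ e : Fin n, (e : ℕ) < k → e ∉ l → ¬ M.Indep (insert e {e | e ∈ l})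
  mask : ∀ e : Fin n, t.nat m 0 e ≠ 0 ↔ e ∈ l
  count : t.nat c 0 0 = l.length
  self : ∀ v < n, v < k → t.nat f 0 v = v
  copy : ∀ j, t.nat f 0 (n + j) = (l.map Fin.val).getD j 0

theorem run_greedy_step {M : Matroid (Fin n)} {o : Test} {m c f k : ℕ} {l : List (Fin n)}
    {t : Store Γ} (ho : ∀ t : Store Γ, o.Holds I t ↔ M.Indep (t.row n m 0)) (hmc : m ≠ c)
    (hmf : m ≠ f) (hcf : c ≠ f) (hm : m ≠ 26) (hc : c ≠ 26) (hf : f ≠ 26) (hk : k < n)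
    (htk : t.nat 26 0 0 = k) (h : GreedyState M m c f k l t) :
    ∃ l', GreedyState M m c f (k + 1) l'
      (((seq (assign1 f (rd 26) (rd 26)) <| seq (assign1 m (rd 26) (.const 1)) <|
        cond o
          (seq (assign1 f (.add .size (rd c)) (rd 26)) (assign c (.add (rd c) (.const 1))))
          (assign1 m (rd 26) (.const 0))).run I t).put 26 (k + 1)) := by
  rw [run_seq, run_seq]
  set t₁ := (assign1 f (rd 26) (rd 26)).run I t with ht₁
  set t₂ := (assign1 m (rd 26) (.const 1)).run I t₁ with ht₂
  have hkl : (⟨k, hk⟩ : Fin n) ∉ l := fun h' => (h.lt _ h').ne rfl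
  have h26 : t₂.nat 26 0 0 = k := by
    simp [ht₁, ht₂, run_assign1_nat, hm.symm, hf.symm, htk]
  have h26' : t₁.nat 26 0 0 = k := by
    simp [ht₁, run_assign1_nat, hf.symm, htk]
  have hc2 : t₂.nat c 0 0 = l.length := by
    simp [ht₁, ht₂, run_assign1_nat, hmc.symm, hcf, h.count]
  have hm2 : ∀ e : Fin n, t₂.nat m 0 e ≠ 0 ↔ e ∈ l ∨ e = ⟨k, hk⟩ := by
    intro e
    simp only [ht₂, run_assign1_nat, ht₁, hmf, eval_rd, eval_const]
    by_cases he : (e : ℕ) = k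
    · simp [he, Fin.ext_iff, htk, hf.symm]
    · simp [he, Fin.ext_iff, htk, hf.symm, ← h.mask e]
  have hf2 : ∀ v, t₂.nat f 0 v = if v = k then k else t.nat f 0 v := by
    intro v
    simp [ht₂, ht₁, run_assign1_nat, hmf.symm, htk]
  have hset : (t₂.row n m 0 : Set (Fin n)) = insert ⟨k, hk⟩ {e | e ∈ l} := by
    ext e
    simp [Store.row, hm2, or_comm]
  have hlt : ∀ e : Fin n, (e : ℕ) < k + 1 ↔ (e : ℕ) < k ∨ e = ⟨k, hk⟩ := fun e => by
    rw [Fin.ext_iff]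
    simp only []
    omega
  by_cases hi : M.Indep (insert ⟨k, hk⟩ {e | e ∈ l})
  · rw [run_cond_pos ((ho t₂).2 (by rwa [hset])), run_seq]
    have hset' : {e | e ∈ l ++ [⟨k, hk⟩]} = insert ⟨k, hk⟩ {e | e ∈ l} := by
      ext e
      simp [or_comm]
    refine ⟨l ++ [⟨k, hk⟩], ?_, ?_, ?_, ?_, ?_, ?_, ?_, ?_⟩
    · refine List.nodup_append.2 ⟨h.nodup, by simp, fun a ha b hb hab => ?_⟩
      rw [List.mem_singleton.1 hb] at hab
      exact hkl (hab ▸ ha)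
    · rwa [hset']
    · intro e he
      rw [List.mem_append, List.mem_singleton] at he
      exact (hlt e).2 (he.imp_left (h.lt e))
    · intro e he hel hins
      rw [List.mem_append, List.mem_singleton, not_or] at hel
      refine h.maximal e (((hlt e).1 he).resolve_right hel.2) hel.1 (hins.subset ?_)
      rw [hset']
      exact Set.insert_subset_insert (Set.subset_insert _ _)
    · intro e
      rw [List.mem_append, List.mem_singleton, ← hm2]
      simp [put_nat, run_assign_nat, run_assign1_nat, hm, hmc, hmf]
    · simp [put_nat, run_assign_nat, run_assign1_nat, hc, hcf, hc2, NatExpr.eval]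
    · intro v hv hvk
      have hne : v ≠ n + l.length := by omega
      simp only [put_nat, run_assign_nat, run_assign1_nat, hf, hcf.symm, NatExpr.eval, eval_rd, hc2,
        hne, hf2]
      split_ifs with h1 <;> simp_all
      exact h.self v hv (by omega)
    · intro j
      have hne : n + j ≠ k := by omega
      simp only [put_nat, run_assign_nat, run_assign1_nat, hf, hcf.symm, NatExpr.eval, eval_rd, hc2,
        hf2, h26, hne, h.copy, List.map_append, List.map_cons, List.map_nil]
      rcases lt_trichotomy j l.length with hj | rfl | hj
      · rw [List.getD_append _ _ _ _ (by simpa using hj)]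
        simp [hj.ne]
      · rw [List.getD_append_right _ _ _ _ (by simp)]
        simp
      · rw [List.getD_append_right _ _ _ _ (by simpa using hj.le), List.getD_eq_default _ _ (by simpa using hj.le),
          List.getD_eq_default _ _ (by simp; omega)]
        simp [hj.ne']
  · rw [run_cond_neg (mt (ho t₂).1 (by rwa [hset]))]
    refine ⟨l, h.nodup, h.indep, fun e he => (h.lt e he).trans (Nat.lt_succ_self k), ?_, ?_, ?_, ?_,
      ?_⟩
    · intro e he hel
      rcases (hlt e).1 he with h' | rfl
      exacts [h.maximal e h' hel, hi]
    · intro e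
      simp only [put_nat, run_assign1_nat, hm, eval_rd, h26, eval_const]
      by_cases he : (e : ℕ) = k
      · have : e = ⟨k, hk⟩ := Fin.ext he
        simp [this, hkl]
      · have : e ≠ ⟨k, hk⟩ := fun h' => he (congrArg Fin.val h')
        have := hm2 e
        simp_all
    · simp [put_nat, run_assign1_nat, hc, hmc.symm, hc2]
    · intro v hv hvk
      simp only [put_nat, run_assign1_nat, hf, hmf.symm, hf2]
      split_ifs with h1 <;> simp_all
      exact h.self v hv (by omega)
    · intro j
      have hne : n + j ≠ k := by omega
      simp [put_nat, run_assign1_nat, hf, hmf.symm, hf2, hne, h.copy]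

theorem run_greedy {M : Matroid (Fin n)} {o : Test} {m c f : ℕ} {s : Store Γ}
    (ho : ∀ t : Store Γ, o.Holds I t ↔ M.Indep (t.row n m 0)) (hmc : m ≠ c)
    (hmf : m ≠ f) (hcf : c ≠ f) (hm : m ≠ 26) (hc : c ≠ 26) (hf : f ≠ 26)
    (hsm : ∀ j, s.nat m 0 j = 0) (hsc : s.nat c 0 0 = 0) (hsf : ∀ j, s.nat f 0 j = 0) :
    ∃ l, GreedyState M m c f (n + n) l ((greedy o m c f).run I s) := by
  refine run_forLoop (I := I) (fun k t => ∃ l, GreedyState M m c f k l t) ⟨[], ?_⟩ ?_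
  · refine ⟨by simp, by simp, by simp, by simp, ?_, ?_, by simp, ?_⟩
    · simp [put_nat, hm, hsm]
    · simp [put_nat, hc, hsc]
    · simp [put_nat, hf, hsf]
  · rintro k hk t htk hfr ⟨l, hl⟩
    by_cases hkn : k < n
    · rw [run_cond_pos (by simp [Test.Holds, NatExpr.eval, htk]; omega)]
      exact run_greedy_step ho hmc hmf hcf hm hc hf hkn htk hl
    · rw [run_cond_neg (by simp [Test.Holds, NatExpr.eval, htk]; omega), run_skip]
      refine ⟨l, hl.nodup, hl.indep, fun e he => by omega, fun e he => hl.maximal e (by omega), ?_,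
        ?_, fun v hv hvk => ?_, ?_⟩
      · simpa [put_nat, hm] using hl.mask
      · simpa [put_nat, hc] using hl.count
      · simpa [put_nat, hf] using hl.self v hv (by omega)
      · simpa [put_nat, hf] using hl.copy

/-- The copies of the elements of a basis of size `c`. -/
def auxiliary (n c : ℕ) : Finset (Fin (n + n)) :=
  Finset.univ.filter fun v => n ≤ (v : ℕ) ∧ (v : ℕ) < n + c

@[simp] theorem mem_auxiliary {c : ℕ} {v : Fin (n + n)} :
    v ∈ auxiliary n c ↔ n ≤ (v : ℕ) ∧ (v : ℕ) < n + c := by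
  simp [auxiliary]

omit [AddCommGroup Γ] in
-- The map is the identity on proper elements and enumerates the greedy basis on the first auxiliary
-- ones. These are thus mapped bijectively to a basis of `M`, so they form a basis of the pulled
-- back matroid. Surplus auxiliary elements are sent to `0`.
theorem GreedyState.exists_map {M : Matroid (Fin n)} {m c f : ℕ} {l : List (Fin n)} {t : Store Γ}
    (hE : M.E = Set.univ) (h : GreedyState M m c f (n + n) l t) :
    ∃ φ : Fin (n + n) → Fin n, (∀ x : Fin (n + n), t.nat f 0 x = φ x) ∧
      (∀ v : Fin n, φ (Fin.castAdd n v) = v) ∧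
      (M.comap φ).IsBase (auxiliary n (t.nat c 0 0) : Set (Fin (n + n))) ∧
      M.IsBase {e | e ∈ l} := by
  have hlen : l.length ≤ n := by simpa using h.nodup.length_le_card
  have hcopy : ∀ j (hj : j < l.length), t.nat f 0 (n + j) = l[j] := by
    intro j hj
    rw [h.copy, List.getD_eq_getElem _ _ (by simpa using hj), List.getElem_map]
  have hlt : ∀ x : Fin (n + n), t.nat f 0 x < n := by
    intro x
    by_cases hx : (x : ℕ) < n
    · rw [h.self x hx x.2]; exact hx
    · obtain ⟨j, hj⟩ := Nat.exists_eq_add_of_le (not_lt.1 hx)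
      rw [hj]
      by_cases hjl : j < l.length
      · rw [hcopy j hjl]; exact Fin.is_lt _
      · rw [h.copy, List.getD_eq_default _ _ (by simpa using hjl)]
        -- The existence of `x` forces `n` to be positive, so the default value `0` is a valid
        -- element.
        have := x.2
        omega
  let φ : Fin (n + n) → Fin n := fun x => ⟨t.nat f 0 x, hlt x⟩
  have hself : ∀ v : Fin n, φ (Fin.castAdd n v) = v := fun v =>
    Fin.ext (h.self v v.2 (by omega))
  have hbase : M.IsBase {e | e ∈ l} :=
    h.indep.isBase_of_forall_insert fun e he => h.maximal e (by omega) he.2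
  have himage : φ '' (auxiliary n (t.nat c 0 0) : Set (Fin (n + n))) = {e | e ∈ l} := by
    ext e
    simp only [Set.mem_image, Finset.mem_coe, mem_auxiliary, h.count, Set.mem_ofPred_eq]
    constructor
    · rintro ⟨x, ⟨hx1, hx2⟩, rfl⟩
      obtain ⟨j, hj⟩ := Nat.exists_eq_add_of_le hx1
      have hjl : j < l.length := by omega
      have : φ x = l[j] := Fin.ext (by simp only [φ]; rw [hj, hcopy j hjl])
      rw [this]
      exact List.getElem_mem _
    · intro he
      obtain ⟨j, hj, rfl⟩ := List.getElem_of_mem he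
      exact ⟨⟨n + j, by omega⟩, by simpa using hj, Fin.ext (hcopy j hj)⟩
  refine ⟨φ, fun _ => rfl, hself, ?_, hbase⟩
  rw [Matroid.comap_isBase_iff, himage, hE, Set.preimage_univ, Set.image_univ,
    (Function.LeftInverse.surjective hself).range_eq, ← hE, Matroid.isBasis_ground_iff]
  refine ⟨hbase, fun x hx y hy hxy => ?_, by simp⟩
  simp only [Finset.mem_coe, mem_auxiliary, h.count] at hx hy
  obtain ⟨i, hi⟩ := Nat.exists_eq_add_of_le hx.1
  obtain ⟨j, hj⟩ := Nat.exists_eq_add_of_le hy.1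
  have hxy' : t.nat f 0 x = t.nat f 0 y := congrArg Fin.val hxy
  rw [hi, hj, hcopy i (by omega), hcopy j (by omega)] at hxy'
  have := (h.nodup.getElem_inj_iff).1 (Fin.ext hxy')
  exact Fin.ext (by omega)

end Cmd

end GreedyBasis

/-! ### A lightest common basis by successive exchanges. -/

section WeightedIntersection

namespace Cmd

/-- Write the indicator vector of the elements `x` with the property `b`, where `x` is the
variable `26`, to the array `a`. -/
def fillMask (a : ℕ) (b : Test) : Cmd :=
  forLoop 26 (cond b (assign1 a (rd 26) (.const 1)) (assign1 a (rd 26) (.const 0)))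

/-- Start with the common basis of auxiliary elements; the flag in variable `15` is raised when
there is no common basis of proper elements. -/
def initMasks : Cmd :=
  seq (fillMask 6 (.and (.natLe .size (rd 26)) (.natLe (.add (rd 26) (.const 1)) (.add .size (rd 17)))))
    (fillMask 14 (.natLe (.add (rd 26) (.const 1)) (.add .size (rd 17))))

/-- Remove the element in variable `27` for good if it is auxiliary. -/
def clearCell : Cmd :=
  cond (.natLe .size (rd 27))
    (cond (isOne (rd1 6 (rd 27)))
      (cond (isOne (rd 15)) skip
        (seq (assign 12 (rd 27)) <| seq removalStep <|
          cond (isOne (rd 11)) (seq exchange (assign1 14 (rd 27) (.const 0)))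
            (assign 15 (.const 1))))
      (assign1 14 (rd 27) (.const 0)))
    skip

/-- Take the weight of the element in variable `28` into account. -/
def improveCell : Cmd :=
  seq
    (cond (isOne (rd1 6 (rd 28)))
      (seq (assign 12 (rd 28)) <| seq removalStep <|
        cond (.and (isOne (rd 11)) (.not (.realLe (.weight (rd 28)) (rdR 4)))) exchange skip)
      skip)
    (.setReal 5 (.const 0) (rd 28) (.weight (rd 28)))

variable {Γ : Type*} [AddCommGroup Γ] {n : ℕ} {I : Input Γ n}
  {φ₁ φ₂ : Fin (n + n) → Fin n} {A U : Finset (Fin (n + n))} {w : Fin (n + n) → ℝ} {s : Store Γ}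

open Classical in
theorem run_fillMask {a : ℕ} {b : Test} {P : Fin (n + n) → Prop} (ha : a ≠ 26)
    (hb : ∀ (k : Fin (n + n)) (t : Store Γ), t.nat 26 0 0 = k → Frame (fillMask a b) s t →
      (b.Holds I t ↔ P k)) (x : Fin (n + n)) :
    ((fillMask a b).run I s).nat a 0 x = if P x then 1 else 0 := by
  have main : ∀ x : Fin (n + n), (x : ℕ) < n + n →
      ((fillMask a b).run I s).nat a 0 x = if P x then 1 else 0 := by
    refine run_forLoop (I := I) (fun k t => ∀ x : Fin (n + n), (x : ℕ) < k →
      t.nat a 0 x = if P x then 1 else 0) (by simp) ?_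
    intro k hk t htk hfr hI x hx
    have hP := hb ⟨k, hk⟩ t htk hfr
    rw [put_nat, if_neg (fun h => ha h.1)]
    by_cases hxk : (x : ℕ) = k
    · have hx' : x = ⟨k, hk⟩ := Fin.ext hxk
      subst hx'
      by_cases h : b.Holds I t
      · rw [run_cond_pos h]
        simp [run_assign1_nat, htk, hP.1 h]
      · rw [run_cond_neg h]
        simp [run_assign1_nat, htk, mt hP.2 h]
    · have := hI x (by omega)
      by_cases h : b.Holds I t
      · rw [run_cond_pos h]
        simp [run_assign1_nat, htk, hxk, this]
      · rw [run_cond_neg h]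
        simp [run_assign1_nat, htk, hxk, this]
  exact main x x.2

omit [AddCommGroup Γ] in
theorem State.congr {t : Store Γ} (h : State φ₁ φ₂ A U w s) (h31 : t.nat 31 = s.nat 31)
    (h32 : t.nat 32 = s.nat 32) (h6 : t.nat 6 = s.nat 6) (h14 : t.nat 14 = s.nat 14)
    (h5 : t.real 5 = s.real 5) : State φ₁ φ₂ A U w t :=
  ⟨by rw [h31]; exact h.map₁, by rw [h32]; exact h.map₂, by rw [h6]; exact h.mask,
    by rw [h14]; exact h.active, by rw [h5]; exact h.weight⟩

theorem State.exchange {V : Finset (Fin (n + n))} (h : State φ₁ φ₂ A U w s)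
    (hV : ∀ x : Fin (n + n), s.nat 7 0 x = 1 ↔ x ∈ V) :
    State φ₁ φ₂ (symmDiff A V) U w (exchange.run I s) := by
  have hfr := run_frame I Cmd.exchange s
  refine ⟨?_, ?_, run_exchange h.mask hV, ?_, ?_⟩
  · rw [hfr.nat 31 rfl]; exact h.map₁
  · rw [hfr.nat 32 rfl]; exact h.map₂
  · rw [hfr.nat 14 rfl]; exact h.active
  · rw [hfr.real 5 rfl]; exact h.weight

/-- The elements of the ground set, without the auxiliary elements. -/
def proper (n : ℕ) : Finset (Fin (n + n)) := Finset.univ.filter fun v => (v : ℕ) < n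

@[simp] theorem mem_proper {v : Fin (n + n)} : v ∈ proper n ↔ (v : ℕ) < n := by simp [proper]

/-- The active elements in round `k`, when there are `c` auxiliary elements in the beginning. -/
def remaining (n c k : ℕ) : Finset (Fin (n + n)) :=
  Finset.univ.filter fun v => (v : ℕ) < n ∨ k ≤ (v : ℕ) ∧ (v : ℕ) < n + c

@[simp] theorem mem_remaining {c k : ℕ} {v : Fin (n + n)} :
    v ∈ remaining n c k ↔ (v : ℕ) < n ∨ k ≤ (v : ℕ) ∧ (v : ℕ) < n + c := by simp [remaining]

theorem run_initMasks {c : ℕ} (hc : s.nat 17 0 0 = c) (h31 : ∀ x : Fin (n + n), s.nat 31 0 x = φ₁ x)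
    (h32 : ∀ x : Fin (n + n), s.nat 32 0 x = φ₂ x) (h5 : ∀ x, s.real 5 0 x = 0) :
    State φ₁ φ₂ (auxiliary n c) (remaining n c 0) (fun _ => 0) (initMasks.run I s) := by
  rw [initMasks, run_seq]
  set b₁ : Test :=
    .and (.natLe .size (rd 26)) (.natLe (.add (rd 26) (.const 1)) (.add .size (rd 17)))
  set b₂ : Test := .natLe (.add (rd 26) (.const 1)) (.add .size (rd 17))
  have h1 := run_fillMask (I := I) (s := s) (a := 6) (b := b₁)
    (P := fun x => n ≤ (x : ℕ) ∧ (x : ℕ) < n + c) (by omega)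
    (fun k t htk hfr => by
      simp [b₁, Test.Holds, NatExpr.eval, htk, hfr.nat 17 rfl, hc])
  have hfr1 := run_frame I (fillMask 6 b₁) s
  set s₁ := (fillMask 6 b₁).run I s
  have h2 := run_fillMask (I := I) (s := s₁) (a := 14) (b := b₂)
    (P := fun x => (x : ℕ) < n + c) (by omega)
    (fun k t htk hfr => by
      simp [b₂, Test.Holds, NatExpr.eval, htk, hfr.nat 17 rfl, hfr1.nat 17 rfl, hc])
  have hfr2 := run_frame I (fillMask 14 b₂) s₁
  set s₂ := (fillMask 14 b₂).run I s₁
  refine ⟨?_, ?_, fun x => ?_, fun x => ?_, ?_⟩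
  · rw [hfr2.nat 31 rfl, hfr1.nat 31 rfl]; exact h31
  · rw [hfr2.nat 32 rfl, hfr1.nat 32 rfl]; exact h32
  · rw [hfr2.nat 6 rfl, h1, mem_auxiliary]
    simp
  · rw [h2, mem_remaining]
    simp
    omega
  · rw [hfr2.real 5 rfl, hfr1.real 5 rfl]; exact fun x => h5 x

/-- Either the flag is raised and there is no common basis of proper elements, or the memory holds
a common basis. -/
def Cleared (M₁ M₂ : Matroid (Fin n)) (φ₁ φ₂ : Fin (n + n) → Fin n) (U : Finset (Fin (n + n)))
    (t : Store Γ) : Prop :=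
  (t.nat 15 0 0 = 1 ∧ ∀ B ⊆ proper n, ¬ IsCommonBase (M₁.comap φ₁) (M₂.comap φ₂) B) ∨
  (t.nat 15 0 0 = 0 ∧ ∃ A ⊆ U, IsCommonBase (M₁.comap φ₁) (M₂.comap φ₂) A ∧
    State φ₁ φ₂ A U (fun _ => 0) t)

/-- With all weights zero every common basis is lightest, so the removal step applies to any of
them. If it fails for an auxiliary element, each active common basis contains this element, and none
consists of proper elements. -/
theorem run_clear (hE₁ : I.M₁.E = Set.univ) (hE₂ : I.M₂.E = Set.univ) {c : ℕ}
    (h : Cleared I.M₁ I.M₂ φ₁ φ₂ (remaining n c 0) s) :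
    Cleared I.M₁ I.M₂ φ₁ φ₂ (proper n) ((forLoop 27 clearCell).run I s) := by
  have hend : remaining n c (n + n) = proper n := by
    ext v
    rw [mem_remaining, mem_proper]
    omega
  rw [← hend]
  have hput : ∀ (k j : ℕ) (t : Store Γ), Cleared I.M₁ I.M₂ φ₁ φ₂ (remaining n c j) t →
      Cleared I.M₁ I.M₂ φ₁ φ₂ (remaining n c j) (t.put 27 k) := by
    intro k j t h
    have hnat : ∀ a ≠ 27, (t.put 27 k).nat a = t.nat a := fun a ha => by
      funext i j; simp [put_nat, ha]
    refine h.imp (fun h => ⟨by rw [hnat _ (by omega)]; exact h.1, h.2⟩) ?_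
    rintro ⟨h1, A, h2, h3, h4⟩
    exact ⟨by rw [hnat _ (by omega)]; exact h1, A, h2, h3, h4.congr (hnat _ (by omega))
      (hnat _ (by omega)) (hnat _ (by omega)) (hnat _ (by omega)) rfl⟩
  refine run_forLoop (I := I) (fun k t => Cleared I.M₁ I.M₂ φ₁ φ₂ (remaining n c k) t)
    (hput _ _ _ h) ?_
  intro k hk t htk hfr hI
  apply hput
  rw [clearCell]
  by_cases hkn : n ≤ k
  swap
  · rw [run_cond_neg (by simpa [Test.Holds, NatExpr.eval, htk] using hkn), run_skip]
    have : remaining n c (k + 1) = remaining n c k := by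
      ext v
      rw [mem_remaining, mem_remaining]
      omega
    rwa [this]
  rw [run_cond_pos (by simpa [Test.Holds, NatExpr.eval, htk] using hkn)]
  rcases hI with ⟨h15, hno⟩ | ⟨h15, A, hAU, hA, hS⟩
  · refine Or.inl ⟨?_, hno⟩
    by_cases h6 : (isOne (rd1 6 (rd 27))).Holds I t
    · rw [run_cond_pos h6, run_cond_pos (by simpa using h15), run_skip, h15]
    · rw [run_cond_neg h6]
      simpa [run_assign1_nat] using h15
  have hsucc : ∀ x : Fin (n + n), x ∈ remaining n c (k + 1) ↔ x ∈ remaining n c k ∧ (x : ℕ) ≠ k := by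
    intro x
    rw [mem_remaining, mem_remaining]
    omega
  have hsub : ∀ B ⊆ remaining n c k, (⟨k, hk⟩ : Fin (n + n)) ∉ B → B ⊆ remaining n c (k + 1) :=
    fun B hB hkB x hx => (hsucc x).2 ⟨hB hx, fun h => hkB (by rwa [← show x = ⟨k, hk⟩ from Fin.ext h])⟩
  have hdrop : ∀ (B : Finset (Fin (n + n))) (t' : Store Γ), t'.nat 27 0 0 = k →
      State φ₁ φ₂ B (remaining n c k) (fun _ => 0) t' →
      State φ₁ φ₂ B (remaining n c (k + 1)) (fun _ => 0)
        ((assign1 14 (rd 27) (.const 0)).run I t') := by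
    intro B t' ht' hB
    have hg := run_frame I (assign1 14 (rd 27) (.const 0)) t'
    refine ⟨?_, ?_, ?_, fun x => ?_, ?_⟩
    · rw [hg.nat 31 rfl]; exact hB.map₁
    · rw [hg.nat 32 rfl]; exact hB.map₂
    · rw [hg.nat 6 rfl]; exact hB.mask
    · rw [hsucc, ← hB.active, run_assign1_nat]
      by_cases hx : (x : ℕ) = k <;> simp [ht', hx]
    · rw [hg.real 5 rfl]; exact hB.weight
  have hmask : t.nat 6 0 k = 1 ↔ (⟨k, hk⟩ : Fin (n + n)) ∈ A := hS.mask ⟨k, hk⟩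
  by_cases hkA : (⟨k, hk⟩ : Fin (n + n)) ∈ A
  swap
  · rw [run_cond_neg (by simpa [htk] using mt hmask.1 hkA)]
    exact Or.inr ⟨by simpa [run_assign1_nat] using h15, A, hsub A hAU hkA, hA, hdrop A t htk hS⟩
  rw [run_cond_pos (by simpa [htk] using hmask.2 hkA), run_cond_neg (by simp [h15]), run_seq,
    run_seq]
  set t₁ := (assign 12 (rd 27)).run I t with ht₁
  have hg1 : Frame (assign 12 (rd 27)) t t₁ := run_frame I _ _
  have hS1 : State φ₁ φ₂ A (remaining n c k) (fun _ => 0) t₁ :=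
    hS.congr (hg1.nat 31 rfl) (hg1.nat 32 rfl) (hg1.nat 6 rfl) (hg1.nat 14 rfl) (hg1.real 5 rfl)
  have hstep := run_removalStep hE₁ hE₂ hS1 hA hAU (by simp) hkA
    (by simp [ht₁, run_assign_nat, htk])
  set t₂ := removalStep.run I t₁
  have hg2 : Frame removalStep t₁ t₂ := run_frame I _ _
  have hS2 : State φ₁ φ₂ A (remaining n c k) (fun _ => 0) t₂ :=
    hS1.congr (hg2.nat 31 rfl) (hg2.nat 32 rfl) (hg2.nat 6 rfl) (hg2.nat 14 rfl) (hg2.real 5 rfl)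
  rcases hstep with ⟨h11, hno⟩ | ⟨h11, V, hV, hVU, hkV, hcb, -, -⟩
  · rw [run_cond_neg (by simp [h11])]
    refine Or.inl ⟨by simp [run_assign_nat], fun B hB hBc => ?_⟩
    have := hB (hno B (fun x hx => mem_remaining.2 (Or.inl (mem_proper.1 (hB hx)))) hBc)
    rw [mem_proper] at this
    exact absurd this (not_lt.2 hkn)
  · rw [run_cond_pos (by simp [h11]), run_seq]
    have hg3 := run_frame I exchange t₂
    have hS3 := hS2.exchange (I := I) hV
    set t₃ := exchange.run I t₂
    refine Or.inr ⟨?_, _, hsub _ hVU hkV, hcb, hdrop _ _ ?_ hS3⟩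
    · rw [run_assign1_nat, if_neg (by simp), hg3.nat 15 rfl, hg2.nat 15 rfl, hg1.nat 15 rfl, h15]
    · rw [hg3.nat 27 rfl, hg2.nat 27 rfl, hg1.nat 27 rfl, htk]

/-- The weights of the first `k` elements. -/
def partialWeight (I : Input Γ n) (k : ℕ) (v : Fin (n + n)) : ℝ :=
  if (v : ℕ) < k then elementWeight I v else 0

omit [AddCommGroup Γ] in
theorem sum_partialWeight_succ {k : ℕ} (hk : k < n + n) (B : Finset (Fin (n + n))) :
    ∑ v ∈ B, partialWeight I (k + 1) v =
      ∑ v ∈ B, partialWeight I k v + if ⟨k, hk⟩ ∈ B then elementWeight I ⟨k, hk⟩ else 0 := by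
  rw [← Finset.sum_ite_eq' B (⟨k, hk⟩ : Fin (n + n)) (elementWeight I), ← Finset.sum_add_distrib]
  refine Finset.sum_congr rfl fun v _ => ?_
  simp only [partialWeight, Fin.ext_iff]
  rcases lt_trichotomy (v : ℕ) k with h | h | h
  · simp [h, h.ne, h.trans (Nat.lt_succ_self k)]
  · simp [h]
  · simp [h.ne', h.not_gt, show ¬ (v : ℕ) < k + 1 by omega]

omit [AddCommGroup Γ] in
theorem elementWeight_nonneg (hw : ∀ e, 0 ≤ I.w e) (v : Fin (n + n)) : 0 ≤ elementWeight I v := by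
  rw [elementWeight]
  split_ifs
  exacts [hw _, le_rfl]

/-- The memory holds a common basis of proper elements that is lightest with respect to `w`. -/
def Lightest (M₁ M₂ : Matroid (Fin n)) (φ₁ φ₂ : Fin (n + n) → Fin n) (w : Fin (n + n) → ℝ)
    (t : Store Γ) : Prop :=
  ∃ A ⊆ proper n, IsCommonBase (M₁.comap φ₁) (M₂.comap φ₂) A ∧ State φ₁ φ₂ A (proper n) w t ∧
    ∀ B ⊆ proper n, IsCommonBase (M₁.comap φ₁) (M₂.comap φ₂) B → ∑ v ∈ A, w v ≤ ∑ v ∈ B, w v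

/-- The weight of one element `k` is raised from zero. If `k` is not in `A`, then `A` stays
lightest. Otherwise `A` becomes heavier by the same amount as the other bases containing `k`, so the
lightest basis is either `A` or the lightest one avoiding `k`, which the removal step provides. -/
theorem run_improve (hE₁ : I.M₁.E = Set.univ) (hE₂ : I.M₂.E = Set.univ) (hw : ∀ e, 0 ≤ I.w e)
    (h : Lightest I.M₁ I.M₂ φ₁ φ₂ (fun _ => 0) s) :
    Lightest I.M₁ I.M₂ φ₁ φ₂ (elementWeight I) ((forLoop 28 improveCell).run I s) := by
  have hend : elementWeight I = partialWeight I (n + n) := by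
    funext v
    simp [partialWeight]
  have hbegin : (fun _ => 0) = partialWeight I 0 := by
    funext v
    simp [partialWeight]
  rw [hend]
  rw [hbegin] at h
  have hput : ∀ (k j : ℕ) (t : Store Γ), Lightest I.M₁ I.M₂ φ₁ φ₂ (partialWeight I j) t →
      Lightest I.M₁ I.M₂ φ₁ φ₂ (partialWeight I j) (t.put 28 k) := by
    intro k j t h
    have hnat : ∀ a ≠ 28, (t.put 28 k).nat a = t.nat a := fun a ha => by
      funext i j; simp [put_nat, ha]
    obtain ⟨A, h1, h2, h3, h4⟩ := h
    exact ⟨A, h1, h2, h3.congr (hnat _ (by omega)) (hnat _ (by omega)) (hnat _ (by omega))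
      (hnat _ (by omega)) rfl, h4⟩
  refine run_forLoop (I := I) (fun k t => Lightest I.M₁ I.M₂ φ₁ φ₂ (partialWeight I k) t)
    (hput _ _ _ h) ?_
  rintro k hk t htk hfr ⟨A, hAU, hA, hS, hmin⟩
  apply hput
  rw [improveCell, run_seq]
  set a := elementWeight I ⟨k, hk⟩ with ha
  have ha0 : 0 ≤ a := elementWeight_nonneg hw _
  have heval : ∀ t' : Store Γ, t'.nat 28 0 0 = k → (RealExpr.weight (rd 28)).eval I t' = a := by
    intro t' h'
    simp [RealExpr.eval, h', ha, elementWeight]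
  have hupdate : ∀ (B : Finset (Fin (n + n))) (t' : Store Γ), t'.nat 28 0 0 = k →
      State φ₁ φ₂ B (proper n) (partialWeight I k) t' →
      State φ₁ φ₂ B (proper n) (partialWeight I (k + 1))
        ((Cmd.setReal 5 (.const 0) (rd 28) (.weight (rd 28))).run I t') := by
    intro B t' ht' hB
    refine ⟨hB.map₁, hB.map₂, hB.mask, hB.active, fun x => ?_⟩
    rw [run_setReal_real, heval t' ht', hB.weight, eval_rd, ht']
    simp only [partialWeight]
    rcases lt_trichotomy (x : ℕ) k with h | h | h
    · simp [h, h.ne, h.trans (Nat.lt_succ_self k)]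
    · have : x = ⟨k, hk⟩ := Fin.ext h
      simp [this, ha]
    · simp [h.ne', h.not_gt, show ¬ (x : ℕ) < k + 1 by omega]
  have hmask : t.nat 6 0 k = 1 ↔ (⟨k, hk⟩ : Fin (n + n)) ∈ A := hS.mask ⟨k, hk⟩
  by_cases hkA : (⟨k, hk⟩ : Fin (n + n)) ∈ A
  swap
  · rw [run_cond_neg (by simpa [htk] using mt hmask.1 hkA), run_skip]
    refine ⟨A, hAU, hA, hupdate A t htk hS, fun B hB hBc => ?_⟩
    rw [sum_partialWeight_succ hk, sum_partialWeight_succ hk, if_neg hkA]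
    have := hmin B hB hBc
    split_ifs <;> linarith
  rw [run_cond_pos (by simpa [htk] using hmask.2 hkA), run_seq, run_seq]
  set t₁ := (assign 12 (rd 28)).run I t with ht₁
  have hg1 : Frame (assign 12 (rd 28)) t t₁ := run_frame I _ _
  have hS1 : State φ₁ φ₂ A (proper n) (partialWeight I k) t₁ :=
    hS.congr (hg1.nat 31 rfl) (hg1.nat 32 rfl) (hg1.nat 6 rfl) (hg1.nat 14 rfl) (hg1.real 5 rfl)
  have hstep := run_removalStep hE₁ hE₂ hS1 hA hAU hmin hkA (by simp [ht₁, run_assign_nat, htk])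
  set t₂ := removalStep.run I t₁
  have hg2 : Frame removalStep t₁ t₂ := run_frame I _ _
  have hS2 : State φ₁ φ₂ A (proper n) (partialWeight I k) t₂ :=
    hS1.congr (hg2.nat 31 rfl) (hg2.nat 32 rfl) (hg2.nat 6 rfl) (hg2.nat 14 rfl) (hg2.real 5 rfl)
  have h28 : t₂.nat 28 0 0 = k := by rw [hg2.nat 28 rfl, hg1.nat 28 rfl, htk]
  rcases hstep with ⟨h11, hall⟩ | ⟨h11, V, hV, hVU, hkV, hcb, hsum, hle⟩
  · rw [run_cond_neg (by simp [Test.Holds, h11]), run_skip]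
    refine ⟨A, hAU, hA, hupdate A t₂ h28 hS2, fun B hB hBc => ?_⟩
    rw [sum_partialWeight_succ hk, sum_partialWeight_succ hk, if_pos hkA, if_pos (hall B hB hBc)]
    have := hmin B hB hBc
    linarith
  -- Keeping `k` costs `a`, avoiding it costs the optimal value of the exchange; the cheaper
  -- alternative is taken.
  · by_cases hc : a ≤ t₂.real 4 0 0
    · rw [run_cond_neg (by simp [Test.Holds, h11, heval t₂ h28, hc]), run_skip]
      refine ⟨A, hAU, hA, hupdate A t₂ h28 hS2, fun B hB hBc => ?_⟩
      rw [sum_partialWeight_succ hk, sum_partialWeight_succ hk, if_pos hkA]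
      have := hmin B hB hBc
      have := hle B hB hBc
      split_ifs with hkB
      · linarith
      · linarith [this hkB]
    · rw [run_cond_pos (by simpa [Test.Holds, h11, heval t₂ h28] using hc)]
      have hg3 := run_frame I exchange t₂
      have hS3 := hS2.exchange (I := I) hV
      refine ⟨_, hVU, hcb, hupdate _ _ (by rw [hg3.nat 28 rfl, h28]) hS3, fun B hB hBc => ?_⟩
      rw [sum_partialWeight_succ hk, sum_partialWeight_succ hk, if_neg hkV, hsum]
      have := hmin B hB hBc
      have := hle B hB hBc
      split_ifs with hkB
      · linarith
      · linarith [this hkB]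

end Cmd

end WeightedIntersection

/-! ### The complete algorithm and its correctness. -/

section MainProgram

namespace Cmd

/-- Announce the set in array `6`. -/
def announce : Cmd := seq (fillMask 1 (isOne (rd1 6 (rd 26)))) (assign 0 (.const 1))

/-- Compute the label of the set in array `6`. -/
def sumLabels : Cmd :=
  seq (.setGrp 3 (.const 0) (.const 0) .zero)
    (forLoop 26 (cond (isOne (rd1 6 (rd 26)))
      (.setGrp 3 (.const 0) (.const 0)
        (.add (.get 3 (.const 0) (.const 0)) (.label (rd 26)))) skip))

/-- Make the label of a lightest common basis non-zero. -/
def finish : Cmd :=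
  seq sumLabels <| cond (.isZero (.get 3 (.const 0) (.const 0)))
    (seq nonzeroStep (cond (isOne (rd 11)) (seq exchange announce) skip)) announce

/-- The algorithm: find a common basis of two matroids that are enlarged by auxiliary elements,
get rid of these elements, then find a lightest common basis, and finally a non-zero one. -/
def main : Cmd :=
  seq (greedy (.indep₁ 16 (.const 0)) 16 17 31) <| seq (greedy (.indep₂ 18 (.const 0)) 18 19 32) <|
    cond (.natEq (rd 17) (rd 19))
      (seq initMasks <| seq (forLoop 27 clearCell) <|
        cond (isOne (rd 15)) skip (seq (forLoop 28 improveCell) finish))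
      skip

variable {Γ : Type*} [AddCommGroup Γ] {n : ℕ} {I : Input Γ n}
  {φ₁ φ₂ : Fin (n + n) → Fin n} {A U : Finset (Fin (n + n))} {w : Fin (n + n) → ℝ} {s : Store Γ}

/-- The elements of the ground set whose copies belong to `A`. -/
def restrict (A : Finset (Fin (n + n))) : Finset (Fin n) :=
  Finset.univ.filter fun e => Fin.castAdd n e ∈ A

theorem map_restrict (hA : A ⊆ proper n) : (restrict A).map (Fin.castAddEmb n) = A := by
  ext v
  simp only [restrict, Finset.mem_map, Finset.mem_filter, Finset.mem_univ, true_and]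
  constructor
  · rintro ⟨e, he, rfl⟩
    exact he
  · intro hv
    exact ⟨⟨v, mem_proper.1 (hA hv)⟩, hv, rfl⟩

theorem map_subset_proper (B : Finset (Fin n)) : B.map (Fin.castAddEmb n) ⊆ proper n := by
  intro v hv
  obtain ⟨e, -, rfl⟩ := Finset.mem_map.1 hv
  exact mem_proper.2 e.2

/-- The map restricted to proper elements is the identity, so it is injective on these sets and
makes the pulled back matroid agree with `M` on them. -/
theorem isBase_comap_map {M : Matroid (Fin n)} {φ : Fin (n + n) → Fin n} (hE : M.E = Set.univ)
    (hφ : ∀ e : Fin n, φ (Fin.castAdd n e) = e) (B : Finset (Fin n)) :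
    (M.comap φ).IsBase (B.map (Fin.castAddEmb n) : Finset (Fin (n + n))) ↔ M.IsBase B := by
  have himage : φ '' (B.map (Fin.castAddEmb n) : Finset (Fin (n + n))) = B := by
    ext e
    simp [hφ]
  rw [Matroid.comap_isBase_iff, himage, hE, Set.preimage_univ, Set.image_univ,
    (Function.LeftInverse.surjective hφ).range_eq, ← hE, Matroid.isBasis_ground_iff]
  refine ⟨fun h => h.1, fun h => ⟨h, fun x hx y hy hxy => ?_, Set.subset_univ _⟩⟩
  obtain ⟨a, -, rfl⟩ := Finset.mem_map.1 (Finset.mem_coe.1 hx)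
  obtain ⟨b, -, rfl⟩ := Finset.mem_map.1 (Finset.mem_coe.1 hy)
  have : a = b := by simpa [hφ] using hxy
  rw [this]

omit [AddCommGroup Γ] in
theorem sum_elementWeight_map (B : Finset (Fin n)) :
    ∑ v ∈ B.map (Fin.castAddEmb n), elementWeight I v = I.weight B := by
  rw [Finset.sum_map, Input.weight]
  exact Finset.sum_congr rfl fun e _ => by simp [elementWeight]

theorem sum_elementLabel_map (B : Finset (Fin n)) :
    ∑ v ∈ B.map (Fin.castAddEmb n), elementLabel I v = ∑ e ∈ B, I.ψ e := by
  rw [Finset.sum_map]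
  exact Finset.sum_congr rfl fun e _ => by simp [elementLabel]

theorem isNonZeroCommonBasis_iff (hE₁ : I.M₁.E = Set.univ) (hE₂ : I.M₂.E = Set.univ)
    (hφ₁ : ∀ e : Fin n, φ₁ (Fin.castAdd n e) = e) (hφ₂ : ∀ e : Fin n, φ₂ (Fin.castAdd n e) = e)
    (B : Finset (Fin n)) : I.IsNonZeroCommonBasis B ↔
      IsCommonBase (I.M₁.comap φ₁) (I.M₂.comap φ₂) (B.map (Fin.castAddEmb n)) ∧
        ∑ v ∈ B.map (Fin.castAddEmb n), elementLabel I v ≠ 0 := by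
  rw [Input.IsNonZeroCommonBasis, IsCommonBase, isBase_comap_map hE₁ hφ₁, isBase_comap_map hE₂ hφ₂,
    sum_elementLabel_map, and_assoc]

theorem run_announce (hA : ∀ x : Fin (n + n), s.nat 6 0 x = 1 ↔ x ∈ A) :
    (announce.run I s).output n = some (restrict A) := by
  rw [announce, run_seq]
  have h := run_fillMask (I := I) (s := s) (a := 1) (b := isOne (rd1 6 (rd 26))) (P := fun x => x ∈ A)
    (by omega) (fun k t htk hfr => by rw [holds_isOne, eval_rd1, eval_rd, htk, hfr.nat 6 rfl, hA])
  rw [Store.output, if_neg (by simp [run_assign_nat])]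
  congr 1
  ext e
  simp only [Store.row, restrict, Finset.mem_filter, Finset.mem_univ, true_and]
  rw [run_assign_nat, if_neg (by simp), show (e : ℕ) = (Fin.castAdd n e : ℕ) from rfl, h]
  simp

theorem run_sumLabels (hA : ∀ x : Fin (n + n), s.nat 6 0 x = 1 ↔ x ∈ A) :
    (sumLabels.run I s).grp 3 0 0 = ∑ v ∈ A, elementLabel I v := by
  rw [sumLabels, run_seq]
  set s₁ := (Cmd.setGrp 3 (.const 0) (.const 0) .zero).run I s with hs₁
  have hend : ∑ v ∈ A, elementLabel I v =
      ∑ v ∈ A, if (v : ℕ) < n + n then elementLabel I v else 0 :=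
    Finset.sum_congr rfl fun v _ => by simp
  rw [hend]
  refine run_forLoop (I := I) (fun k t => t.grp 3 0 0 =
    ∑ v ∈ A, if (v : ℕ) < k then elementLabel I v else 0) ?_ ?_
  · simp [hs₁, run_setGrp_grp, GrpExpr.eval]
  · intro k hk t htk hfr hI
    have h6 : t.nat 6 0 k = 1 ↔ (⟨k, hk⟩ : Fin (n + n)) ∈ A := by
      rw [hfr.nat 6 rfl, hs₁, run_setGrp_nat]
      exact hA ⟨k, hk⟩
    have hsum : (∑ v ∈ A, if (v : ℕ) < k + 1 then elementLabel I v else 0) =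
        (∑ v ∈ A, if (v : ℕ) < k then elementLabel I v else 0) +
          if ⟨k, hk⟩ ∈ A then elementLabel I ⟨k, hk⟩ else 0 := by
      rw [← Finset.sum_ite_eq' A (⟨k, hk⟩ : Fin (n + n)) (elementLabel I),
        ← Finset.sum_add_distrib]
      refine Finset.sum_congr rfl fun v _ => ?_
      simp only [Fin.ext_iff]
      rcases lt_trichotomy (v : ℕ) k with h | h | h
      · simp [h, h.ne, h.trans (Nat.lt_succ_self k)]
      · simp [h]
      · simp [h.ne', h.not_gt, show ¬ (v : ℕ) < k + 1 by omega]
    rw [hsum, put_grp]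
    by_cases hkA : (⟨k, hk⟩ : Fin (n + n)) ∈ A
    · rw [run_cond_pos (by simpa [htk] using h6.2 hkA), if_pos hkA, run_setGrp_grp, ← hI]
      simp [GrpExpr.eval, htk, elementLabel]
    · rw [run_cond_neg (by simpa [htk] using mt h6.1 hkA), run_skip, if_neg hkA, add_zero, hI]

theorem run_finish (hΓ : ∀ x : Γ, x + x = 0 → x = 0) (hE₁ : I.M₁.E = Set.univ)
    (hE₂ : I.M₂.E = Set.univ) (hw : ∀ e, 0 ≤ I.w e)
    (hφ₁ : ∀ e : Fin n, φ₁ (Fin.castAdd n e) = e) (hφ₂ : ∀ e : Fin n, φ₂ (Fin.castAdd n e) = e)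
    (hs : Lightest I.M₁ I.M₂ φ₁ φ₂ (elementWeight I) s) (h0 : s.nat 0 0 0 = 0) :
    I.IsTwoApproxAnswer ((finish.run I s).output n) := by
  obtain ⟨A, hAU, hA, hS, hmin⟩ := hs
  rw [finish, run_seq]
  have hlabel := run_sumLabels (I := I) hS.mask
  have hg := run_frame I sumLabels s
  set s₁ := sumLabels.run I s
  have hS1 : State φ₁ φ₂ A (proper n) (elementWeight I) s₁ :=
    hS.congr (hg.nat 31 rfl) (hg.nat 32 rfl) (hg.nat 6 rfl) (hg.nat 14 rfl) (hg.real 5 rfl)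
  have heval : (GrpExpr.get 3 (.const 0) (.const 0)).eval I s₁ = ∑ v ∈ A, elementLabel I v := hlabel
  have hnz := isNonZeroCommonBasis_iff (I := I) hE₁ hE₂ hφ₁ hφ₂
  -- Since `A` is lightest, the additive bound gives the factor two. It covers both outcomes: `A`
  -- itself when its label is non-zero, and the result of the exchange.
  have hsome : ∀ C ⊆ proper n, IsCommonBase (I.M₁.comap φ₁) (I.M₂.comap φ₂) C →
      ∑ v ∈ C, elementLabel I v ≠ 0 →
      (∀ B ⊆ proper n, IsCommonBase (I.M₁.comap φ₁) (I.M₂.comap φ₂) B →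
        ∑ v ∈ B, elementLabel I v ≠ 0 →
          ∑ v ∈ C, elementWeight I v ≤ ∑ v ∈ A, elementWeight I v + ∑ v ∈ B, elementWeight I v) →
      I.IsTwoApproxAnswer (some (restrict C)) := by
    intro C hCU hC hC0 hle
    have hCmap := map_restrict hCU
    refine ⟨(hnz _).2 (by rw [hCmap]; exact ⟨hC, hC0⟩), fun B hB => ?_⟩
    obtain ⟨hB1, hB2⟩ := (hnz B).1 hB
    have h1 := hle _ (map_subset_proper B) hB1 hB2
    have h2 := hmin _ (map_subset_proper B) hB1
    rw [← sum_elementWeight_map, ← sum_elementWeight_map, hCmap]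
    linarith
  have hnonneg : ∀ B : Finset (Fin (n + n)), 0 ≤ ∑ v ∈ B, elementWeight I v := fun B =>
    Finset.sum_nonneg fun v _ => elementWeight_nonneg hw v
  by_cases hA0 : ∑ v ∈ A, elementLabel I v = 0
  swap
  · rw [run_cond_neg (by rw [Test.Holds, heval]; exact hA0), run_announce hS1.mask]
    exact hsome A hAU hA hA0 fun B _ _ _ => le_add_of_nonneg_right (hnonneg B)
  rw [run_cond_pos (by rw [Test.Holds, heval]; exact hA0), run_seq]
  have hstep := run_nonzeroStep hΓ hE₁ hE₂ hS1 hA hAU (elementWeight_nonneg hw) hA0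
  have hg2 := run_frame I nonzeroStep s₁
  set s₂ := nonzeroStep.run I s₁
  have hS2 : State φ₁ φ₂ A (proper n) (elementWeight I) s₂ :=
    hS1.congr (hg2.nat 31 rfl) (hg2.nat 32 rfl) (hg2.nat 6 rfl) (hg2.nat 14 rfl) (hg2.real 5 rfl)
  rcases hstep with ⟨h11, hno⟩ | ⟨h11, V, hV, hVU, hVc, hV0, hle⟩
  · rw [run_cond_neg (by simp [h11]), run_skip, Store.output,
      if_pos (by rw [hg2.nat 0 rfl, hg.nat 0 rfl, h0])]
    intro B hB
    obtain ⟨hB1, hB2⟩ := (hnz B).1 hB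
    exact hB2 (hno _ (map_subset_proper B) hB1)
  · rw [run_cond_pos (by simp [h11]), run_seq, run_announce (hS2.exchange (I := I) hV).mask]
    exact hsome _ hVU hVc hV0 hle

theorem run_main (hΓ : ∀ x : Γ, x + x = 0 → x = 0) (hE₁ : I.M₁.E = Set.univ)
    (hE₂ : I.M₂.E = Set.univ) (hw : ∀ e, 0 ≤ I.w e) :
    I.IsTwoApproxAnswer ((main.run I (Store.init Γ)).output n) := by
  rw [main, run_seq, run_seq]
  obtain ⟨l₁, h₁⟩ := run_greedy (I := I) (M := I.M₁) (o := .indep₁ 16 (.const 0)) (m := 16) (c := 17)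
    (f := 31) (s := Store.init Γ) (fun _ => Iff.rfl) (by omega) (by omega) (by omega) (by omega)
    (by omega) (by omega) (fun _ => rfl) rfl (fun _ => rfl)
  have hg1 := run_frame I (greedy (.indep₁ 16 (.const 0)) 16 17 31) (Store.init Γ)
  set s₁ := (greedy (.indep₁ 16 (.const 0)) 16 17 31).run I (Store.init Γ)
  obtain ⟨l₂, h₂⟩ := run_greedy (I := I) (M := I.M₂) (o := .indep₂ 18 (.const 0)) (m := 18) (c := 19)
    (f := 32) (s := s₁) (fun _ => Iff.rfl) (by omega) (by omega) (by omega) (by omega)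
    (by omega) (by omega) (fun _ => by rw [hg1.nat 18 rfl]; rfl) (by rw [hg1.nat 19 rfl]; rfl)
    (fun _ => by rw [hg1.nat 32 rfl]; rfl)
  have hg2 := run_frame I (greedy (.indep₂ 18 (.const 0)) 18 19 32) s₁
  set s₂ := (greedy (.indep₂ 18 (.const 0)) 18 19 32).run I s₁
  have h₁' : GreedyState I.M₁ 16 17 31 (n + n) l₁ s₂ :=
    ⟨h₁.nodup, h₁.indep, h₁.lt, h₁.maximal, by rw [hg2.nat 16 rfl]; exact h₁.mask,
      by rw [hg2.nat 17 rfl]; exact h₁.count, by rw [hg2.nat 31 rfl]; exact h₁.self,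
      by rw [hg2.nat 31 rfl]; exact h₁.copy⟩
  obtain ⟨φ₁, hf₁, hφ₁, hbase₁, hl₁⟩ := h₁'.exists_map hE₁
  obtain ⟨φ₂, hf₂, hφ₂, hbase₂, hl₂⟩ := h₂.exists_map hE₂
  have hzero : ∀ a, (greedy (.indep₁ 16 (.const 0)) 16 17 31).writesNat a = false →
      (greedy (.indep₂ 18 (.const 0)) 18 19 32).writesNat a = false → ∀ j, s₂.nat a 0 j = 0 :=
    fun a ha hb j => by rw [hg2.nat a hb, hg1.nat a ha]; rfl
  by_cases hcard : s₂.nat 17 0 0 = s₂.nat 19 0 0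
  swap
  · rw [run_cond_neg (by simpa [Test.Holds] using hcard), run_skip, Store.output, if_pos (hzero 0 rfl rfl 0)]
    rintro B ⟨hB1, hB2, -⟩
    -- The sizes of the greedy bases are the ranks; a common basis would make them equal.
    refine hcard ?_
    have hlist : ∀ l : List (Fin n), l.Nodup → {e | e ∈ l}.ncard = l.length := by
      intro l hl
      rw [← List.toFinset_card_of_nodup hl, ← Set.ncard_coe_finset, List.coe_toFinset]
    rw [h₁'.count, h₂.count, ← hlist l₁ h₁.nodup, ← hlist l₂ h₂.nodup,
      hl₁.ncard_eq_ncard_of_isBase hB1, hl₂.ncard_eq_ncard_of_isBase hB2]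
  rw [run_cond_pos (by simpa [Test.Holds] using hcard), run_seq, run_seq]
  set c := s₂.nat 17 0 0 with hc
  have hS := run_initMasks (I := I) (s := s₂) hc.symm hf₁ hf₂
    (fun x => by rw [hg2.real 5 rfl, hg1.real 5 rfl]; rfl)
  have hg3 := run_frame I initMasks s₂
  set s₃ := initMasks.run I s₂
  -- As the ranks agree, the same auxiliary elements copy a basis of either matroid, and so form a
  -- common basis to start with.
  have hclear := run_clear (s := s₃) (c := c) hE₁ hE₂ (Or.inr
    ⟨by rw [hg3.nat 15 rfl]; exact hzero 15 rfl rfl 0, auxiliary n c, fun v hv => by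
      rw [mem_auxiliary] at hv
      rw [mem_remaining]
      omega, ⟨hbase₁, by rw [hcard]; exact hbase₂⟩, hS⟩)
  have hg4 := run_frame I (forLoop 27 clearCell) s₃
  set s₄ := (forLoop 27 clearCell).run I s₃
  have h0 : s₄.nat 0 0 0 = 0 := by
    rw [hg4.nat 0 rfl, hg3.nat 0 rfl]
    exact hzero 0 rfl rfl 0
  rcases hclear with ⟨h15, hno⟩ | ⟨h15, A, hAU, hA, hSA⟩
  · rw [run_cond_pos (by simpa using h15), run_skip, Store.output, if_pos h0]
    intro B hB
    exact hno _ (map_subset_proper B) ((isNonZeroCommonBasis_iff hE₁ hE₂ hφ₁ hφ₂ B).1 hB).1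
  · rw [run_cond_neg (by simp [h15]), run_seq]
    have hg5 := run_frame I (forLoop 28 improveCell) s₄
    exact run_finish hΓ hE₁ hE₂ hw hφ₁ hφ₂
      (run_improve hE₁ hE₂ hw ⟨A, hAU, hA, hSA, fun _ _ _ => by simp⟩)
      (by rw [hg5.nat 0 rfl, h0])

end Cmd

/-- A non-zero `x` with `x + x = 0` has order two and would generate a copy of `ZMod 2`. -/
theorem eq_zero_of_add_self_eq_zero {Γ : Type*} [AddCommGroup Γ]
    (hΓ : ¬ ∃ H : AddSubgroup Γ, Nonempty (H ≃+ ZMod 2)) (x : Γ) (hx : x + x = 0) : x = 0 := by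
  by_contra hne
  have hord : addOrderOf x = 2 := addOrderOf_eq_prime (by rw [two_nsmul, hx]) hne
  refine hΓ ⟨AddSubgroup.zmultiples x, ⟨?_⟩⟩
  refine (zmodAddCyclicAddEquiv inferInstance).symm.trans ?_
  rw [Nat.card_zmultiples, hord]

end MainProgram

end GroupLabeledMatroid

open GroupLabeledMatroid in
theorem mainTheorem11 :
    ∃ (P : Program) (p : Polynomial ℕ),
      ∀ (Γ : Type*) [AddCommGroup Γ], (¬ ∃ H : AddSubgroup Γ, Nonempty (H ≃+ ZMod 2)) →
      ∀ (n : ℕ) (M₁ M₂ : Matroid (Fin n)) (ψ : Fin n → Γ) (w : Fin n → ℝ),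
        M₁.E = Set.univ → M₂.E = Set.univ → (∀ e, 0 ≤ w e) →
        ∃ (t : ℕ) (s : Store Γ),
          Runs ⟨M₁, M₂, ψ, w⟩ P (Store.init Γ) t s ∧ t ≤ p.eval n ∧
          Input.IsTwoApproxAnswer ⟨M₁, M₂, ψ, w⟩ (s.output n) := by
  refine ⟨Cmd.main.compile, Cmd.main.time, fun Γ _ hΓ n M₁ M₂ ψ w hE₁ hE₂ hw => ?_⟩
  obtain ⟨t, ht, h⟩ := Cmd.compile_runs ⟨M₁, M₂, ψ, w⟩ Cmd.main rfl (Store.init Γ)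
  exact ⟨t, _, h, ht, Cmd.run_main (I := ⟨M₁, M₂, ψ, w⟩) (eq_zero_of_add_self_eq_zero hΓ) hE₁ hE₂ hw⟩
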